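/- Let $(M^2,g)$ be a connected, oriented smooth Riemannian surface, let $(N^n,h)$ be an arbitrary smooth Riemannian manifold (both without boundary), and let $\varphi:M\to N$ be a Riemannian immersion, that is, a smooth map with $\langle d\varphi(X),d\varphi(Y)\rangle=\langle X,Y\rangle$. Let $\nabla$ denote the Levi-Civita connection of $M$ and also the pull-back to $M$ by $\varphi$ of the Levi-Civita connection of $N$. Let $B(X,Y)=(\nabla d\varphi)(X,Y)=\nabla_X(d\varphi(Y))-d\varphi(\nabla_XY)$ be the second fundamental form, $\tau(\varphi)=\operatorname{trace}\nabla d\varphi$ the tension field, $H=\frac12\operatorname{trace}B$ the mean curvature vector field, and $A_H$ the tensor field of type $(1,1)$ on $M$ defined by $\langle A_H(X),Y\rangle=\langle B(X,Y),H\rangle$. The stress-bienergy tensor $S_2$ is the symmetric tensor field of type $(1,1)$ on $M$ defined by $$\langle S_2(X),Y\rangle=\tfrac12|\tau(\varphi)|^2\langle X,Y\rangle+\langle d\varphi,\nabla\tau(\varphi)\rangle\langle X,Y\rangle-\langle d\varphi(X),\nabla_Y\tau(\varphi)\rangle-\langle d\varphi(Y),\nabla_X\tau(\varphi)\rangle ,$$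 where $\langle d\varphi,\nabla\tau(\varphi)\rangle=\sum_i\langle d\varphi(e_i),\nabla_{e_i}\tau(\varphi)\rangle$ for an orthonormal basis $\{e_i\}$. Consider the following four conditions: 1. $M$ is biconservative, i.e. $\operatorname{div}S_2=\sum_i(\nabla_{e_i}S_2)(e_i)=0$ on $M$; 2. $|H|$ is constant on $M$; 3. the generalized Hopf function $\langle A_H(\partial_z),\partial_z\rangle$ is holomorphic, i.e. for every positively oriented isothermal local chart $(x,y)$ of $M$ (a smooth chart in which $g=e^{2\rho}(dx^2+dy^2)$), the function $\langle A_H(\partial_z),\partial_z\rangle$, where $\partial_z=\frac12(\partial_x-i\,\partial_y)$ and $A_H$ and $\langle\cdot,\cdot\rangle$ are extended complex linearly, is a holomorphic function of $z=x+iy$; 4. $A_H$ is a Codazzi tensor field, i.e. $(\nabla_XA_H)(Y)=(\nabla_YA_H)(X)$ for all vector fields $X,Y$ on $M$. Then any two of these four conditions imply each of the other two. -/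

import Mathlib

open scoped Manifold ContDiff Bundle

noncomputable section

namespace SurfaceGeometry

/-! Riemannian manifolds are modelled on `EuclideanSpace ℝ (Fin m)` (so there is no boundary); the
metric is the inner product which `Bundle.RiemannianBundle` puts on every tangent space, and
`IsContMDiffRiemannianBundle` with exponent `∞` says that it is smooth. -/

/-- Tangent spaces of an `m`-dimensional manifold are finite-dimensional. -/
instance instFiniteDimensionalTangentSpace {m : ℕ} {M : Type*} [TopologicalSpace M]
    [ChartedSpace (EuclideanSpace ℝ (Fin m)) M] (x : M) :
    FiniteDimensional ℝ (TangentSpace (𝓡 m) x) :=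
  inferInstanceAs (FiniteDimensional ℝ (EuclideanSpace ℝ (Fin m)))

section Charts

variable {m : ℕ} {M : Type*} [TopologicalSpace M] [ChartedSpace (EuclideanSpace ℝ (Fin m)) M]

/-- The components of a tangent vector `v` at `x` with respect to a chart `c`. -/
def comp (c : OpenPartialHomeomorph M (EuclideanSpace ℝ (Fin m))) (x : M)
    (v : TangentSpace (𝓡 m) x) : EuclideanSpace ℝ (Fin m) :=
  mvfderiv (𝓡 m) (fun y => c y) x v

/-- The tangent vector at `x` with prescribed components `a` with respect to a chart `c` around
`x`. -/
def vecOfComp (c : OpenPartialHomeomorph M (EuclideanSpace ℝ (Fin m))) (x : M)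
    (a : EuclideanSpace ℝ (Fin m)) : TangentSpace (𝓡 m) x :=
  (mvfderiv (𝓡 m) (fun y => c y) x).inverse a

/-- The coordinate vector field `∂ᵢ` of a chart `c`, at the point `x` of the domain of `c`. -/
def coordVec (c : OpenPartialHomeomorph M (EuclideanSpace ℝ (Fin m))) (i : Fin m) (x : M) :
    TangentSpace (𝓡 m) x :=
  vecOfComp c x (EuclideanSpace.single i 1)

/-- The extension of a tangent vector `v` at `x` to a vector field which, around `x`, has constant
components in the preferred chart at `x`. -/
def localExtension (x : M) (v : TangentSpace (𝓡 m) x) (y : M) : TangentSpace (𝓡 m) y :=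
  vecOfComp (chartAt (EuclideanSpace ℝ (Fin m)) x) y
    (comp (chartAt (EuclideanSpace ℝ (Fin m)) x) x v)

variable [Bundle.RiemannianBundle (fun x : M => TangentSpace (𝓡 m) x)]

/-- The matrix `gᵢⱼ = ⟨∂ᵢ, ∂ⱼ⟩` of the metric in a chart `c`, at the point `x`. -/
def gram (c : OpenPartialHomeomorph M (EuclideanSpace ℝ (Fin m))) (x : M) :
    Matrix (Fin m) (Fin m) ℝ :=
  Matrix.of fun i j => inner ℝ (coordVec c i x) (coordVec c j x)

/-- The derivative `∂ₖ gᵢⱼ` at `x`. -/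
def dGram (c : OpenPartialHomeomorph M (EuclideanSpace ℝ (Fin m))) (x : M) (k i j : Fin m) : ℝ :=
  mvfderiv (𝓡 m) (fun y => gram c y i j) x (coordVec c k x)

/-- The Christoffel symbol
`Γᵏᵢⱼ = (1/2) ∑ₗ gᵏˡ (∂ᵢ gⱼₗ + ∂ⱼ gᵢₗ - ∂ₗ gᵢⱼ)` of the Levi-Civita connection in a chart `c`. -/
def christoffel (c : OpenPartialHomeomorph M (EuclideanSpace ℝ (Fin m))) (x : M)
    (k i j : Fin m) : ℝ :=
  (1 / 2 : ℝ) * ∑ l, (gram c x)⁻¹ k l * (dGram c x i j l + dGram c x j i l - dGram c x l i j)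

end Charts

section CovariantDerivative

variable {m n : ℕ} {M N : Type*}
  [TopologicalSpace M] [ChartedSpace (EuclideanSpace ℝ (Fin m)) M]
  [TopologicalSpace N] [ChartedSpace (EuclideanSpace ℝ (Fin n)) N]
  [Bundle.RiemannianBundle (fun y : N => TangentSpace (𝓡 n) y)]

/-- The pullback of the Levi-Civita connection of `N` by a map `φ : M → N`, computed in a chart `d`
of `N`: for a vector field `W` along `φ` and a tangent vector `v` of `M` at `x`,
`∇_v W = ∑ₐ (v(Wᵃ) + ∑_{b,c} Γᵃ_{bc}(φ(x)) (dφ v)ᵇ Wᶜ) ∂ₐ`. -/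
def covAlongIn (d : OpenPartialHomeomorph N (EuclideanSpace ℝ (Fin n))) (φ : M → N)
    (W : ∀ x : M, TangentSpace (𝓡 n) (φ x)) (x : M) (v : TangentSpace (𝓡 m) x) :
    TangentSpace (𝓡 n) (φ x) :=
  ∑ a, (mvfderiv (𝓡 m) (fun y => comp d (φ y) (W y) a) x v
      + ∑ b, ∑ c, christoffel d (φ x) a b c
        * comp d (φ x) (mfderiv (𝓡 m) (𝓡 n) φ x v) b * comp d (φ x) (W x) c) •
    coordVec d a (φ x)

/-- The pullback of the Levi-Civita connection of `N` by `φ : M → N`: `covAlong φ W x v` is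
`∇_v W`, for a vector field `W` along `φ` and a tangent vector `v` of `M` at `x`. -/
def covAlong (φ : M → N) (W : ∀ x : M, TangentSpace (𝓡 n) (φ x)) (x : M)
    (v : TangentSpace (𝓡 m) x) : TangentSpace (𝓡 n) (φ x) :=
  covAlongIn (chartAt (EuclideanSpace ℝ (Fin n)) (φ x)) φ W x v

end CovariantDerivative

section Tensors

variable {m : ℕ} {M : Type*} [TopologicalSpace M] [ChartedSpace (EuclideanSpace ℝ (Fin m)) M]
  [Bundle.RiemannianBundle (fun x : M => TangentSpace (𝓡 m) x)]

/-- The Levi-Civita connection of `M`: `leviCivita Y x v` is `∇_v Y`. -/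
def leviCivita (Y : ∀ x : M, TangentSpace (𝓡 m) x) (x : M) (v : TangentSpace (𝓡 m) x) :
    TangentSpace (𝓡 m) x :=
  covAlong (fun y : M => y) Y x v

/-- The covariant derivative of a tensor field `T` of type `(1,1)`:
`(∇_u T)(v) = ∇_u (T V) - T (∇_u V)`, where `V` is a vector field extending `v`. -/
def covTensor (T : ∀ x : M, TangentSpace (𝓡 m) x → TangentSpace (𝓡 m) x) (x : M)
    (u v : TangentSpace (𝓡 m) x) : TangentSpace (𝓡 m) x :=
  leviCivita (fun y => T y (localExtension x v y)) x u
    - T x (leviCivita (localExtension x v) x u)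

/-- The divergence of a tensor field of type `(1,1)`: `div T = ∑ᵢ (∇_{eᵢ} T)(eᵢ)` for an
orthonormal basis `(eᵢ)`. -/
def divTensor (T : ∀ x : M, TangentSpace (𝓡 m) x → TangentSpace (𝓡 m) x) (x : M) :
    TangentSpace (𝓡 m) x :=
  ∑ i, covTensor T x (stdOrthonormalBasis ℝ (TangentSpace (𝓡 m) x) i)
    (stdOrthonormalBasis ℝ (TangentSpace (𝓡 m) x) i)

/-- `T` is a Codazzi tensor field: `(∇_X T)(Y) = (∇_Y T)(X)`. -/
def IsCodazzi (T : ∀ x : M, TangentSpace (𝓡 m) x → TangentSpace (𝓡 m) x) : Prop :=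
  ∀ (x : M) (u v : TangentSpace (𝓡 m) x), covTensor T x u v = covTensor T x v u

/-- The field of endomorphisms at `x` which represents a bilinear form `β` on the tangent space:
`⟨T u, v⟩ = β u v`. -/
def sharp (x : M) (β : TangentSpace (𝓡 m) x → TangentSpace (𝓡 m) x → ℝ)
    (u : TangentSpace (𝓡 m) x) : TangentSpace (𝓡 m) x :=
  ∑ i, β u (stdOrthonormalBasis ℝ (TangentSpace (𝓡 m) x) i) •
    stdOrthonormalBasis ℝ (TangentSpace (𝓡 m) x) i

end Tensors

section Submanifolds

variable (m n : ℕ) {M N : Type*}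
  [TopologicalSpace M] [ChartedSpace (EuclideanSpace ℝ (Fin m)) M]
  [Bundle.RiemannianBundle (fun x : M => TangentSpace (𝓡 m) x)]
  [TopologicalSpace N] [ChartedSpace (EuclideanSpace ℝ (Fin n)) N]
  [Bundle.RiemannianBundle (fun y : N => TangentSpace (𝓡 n) y)]

/-- A Riemannian (isometric) immersion, that is, a submanifold `φ : M → N`. -/
def IsRiemannianImmersion (φ : M → N) : Prop :=
  ContMDiff (𝓡 m) (𝓡 n) ∞ φ ∧
    ∀ (x : M) (u v : TangentSpace (𝓡 m) x),
      inner ℝ (mfderiv (𝓡 m) (𝓡 n) φ x u) (mfderiv (𝓡 m) (𝓡 n) φ x v) = inner ℝ u v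

/-- The second fundamental form `B(u, v) = (∇dφ)(u, v) = ∇_u (dφ V) - dφ (∇_u V)`, where `V` is a
vector field extending `v`. -/
def secondFundForm (φ : M → N) (x : M) (u v : TangentSpace (𝓡 m) x) :
    TangentSpace (𝓡 n) (φ x) :=
  covAlong φ (fun y => mfderiv (𝓡 m) (𝓡 n) φ y (localExtension x v y)) x u
    - mfderiv (𝓡 m) (𝓡 n) φ x (leviCivita (localExtension x v) x u)

/-- The tension field `τ(φ) = trace ∇dφ`. -/
def tension (φ : M → N) (x : M) : TangentSpace (𝓡 n) (φ x) :=
  ∑ i, secondFundForm m n φ x (stdOrthonormalBasis ℝ (TangentSpace (𝓡 m) x) i)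
    (stdOrthonormalBasis ℝ (TangentSpace (𝓡 m) x) i)

/-- The mean curvature vector field `H = (1/m) trace B`. -/
def meanCurvature (φ : M → N) (x : M) : TangentSpace (𝓡 n) (φ x) :=
  (1 / (m : ℝ)) • ∑ i, secondFundForm m n φ x (stdOrthonormalBasis ℝ (TangentSpace (𝓡 m) x) i)
    (stdOrthonormalBasis ℝ (TangentSpace (𝓡 m) x) i)

/-- The shape operator `A_H` in the direction of the mean curvature vector field:
`⟨A_H u, v⟩ = ⟨B(u, v), H⟩`. -/
def shapeOperatorH (φ : M → N) (x : M) : TangentSpace (𝓡 m) x → TangentSpace (𝓡 m) x :=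
  sharp x fun u v => inner ℝ (secondFundForm m n φ x u v) (meanCurvature m n φ x)

/-- The stress-bienergy tensor `S₂`:
`⟨S₂ u, v⟩ = (1/2) |τ|² ⟨u, v⟩ + ⟨dφ, ∇τ⟩ ⟨u, v⟩ - ⟨dφ u, ∇_v τ⟩ - ⟨dφ v, ∇_u τ⟩`, where
`⟨dφ, ∇τ⟩ = ∑ᵢ ⟨dφ eᵢ, ∇_{eᵢ} τ⟩`. -/
def stressBienergy (φ : M → N) (x : M) : TangentSpace (𝓡 m) x → TangentSpace (𝓡 m) x :=
  sharp x fun u v =>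
    (1 / 2 : ℝ) * ‖tension m n φ x‖ ^ 2 * inner ℝ u v
    + (∑ i, inner ℝ
          (mfderiv (𝓡 m) (𝓡 n) φ x (stdOrthonormalBasis ℝ (TangentSpace (𝓡 m) x) i))
          (covAlong φ (tension m n φ) x (stdOrthonormalBasis ℝ (TangentSpace (𝓡 m) x) i)))
        * inner ℝ u v
    - inner ℝ (mfderiv (𝓡 m) (𝓡 n) φ x u) (covAlong φ (tension m n φ) x v)
    - inner ℝ (mfderiv (𝓡 m) (𝓡 n) φ x v) (covAlong φ (tension m n φ) x u)

/-- `M` is biconservative: `div S₂ = 0`. -/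
def IsBiconservative (φ : M → N) : Prop :=
  ∀ x : M, divTensor (stressBienergy m n φ) x = 0

/-- `M` is `CMC`: `|H|` is constant. -/
def HasConstantMeanCurvature (φ : M → N) : Prop :=
  ∃ r : ℝ, ∀ x : M, ‖meanCurvature m n φ x‖ = r

end Submanifolds

section Hopf

variable {M : Type*} [TopologicalSpace M] [ChartedSpace (EuclideanSpace ℝ (Fin 2)) M]

/-- An orientation of a smooth surface, given by an oriented atlas: a family of smooth charts which
cover the surface and whose changes of coordinates have positive Jacobian determinant. -/
structure OrientedAtlas (M : Type*) [TopologicalSpace M]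
    [ChartedSpace (EuclideanSpace ℝ (Fin 2)) M] where
  charts : Set (OpenPartialHomeomorph M (EuclideanSpace ℝ (Fin 2)))
  smooth : ∀ c ∈ charts, c ∈ IsManifold.maximalAtlas (𝓡 2) ∞ M
  cover : ∀ x : M, ∃ c ∈ charts, x ∈ c.source
  det_pos : ∀ c ∈ charts, ∀ d ∈ charts, ∀ x ∈ c.source ∩ d.source,
    0 < (fderiv ℝ (fun y => d (c.symm y)) (c x)).det

/-- A smooth chart is positively oriented if its changes of coordinates with the charts of the
oriented atlas have positive Jacobian determinant. -/
def OrientedAtlas.IsPositive (o : OrientedAtlas M)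
    (c : OpenPartialHomeomorph M (EuclideanSpace ℝ (Fin 2))) : Prop :=
  c ∈ IsManifold.maximalAtlas (𝓡 2) ∞ M ∧
    ∀ d ∈ o.charts, ∀ x ∈ c.source ∩ d.source,
      0 < (fderiv ℝ (fun y => d (c.symm y)) (c x)).det

variable [Bundle.RiemannianBundle (fun x : M => TangentSpace (𝓡 2) x)]

/-- The chart `c = (x, y)` is isothermal: `g = e^{2ρ} (dx² + dy²)` on its domain. -/
def IsIsothermal (c : OpenPartialHomeomorph M (EuclideanSpace ℝ (Fin 2))) : Prop :=
  ∃ ρ : M → ℝ, ∀ p ∈ c.source, gram c p = Real.exp (2 * ρ p) • (1 : Matrix (Fin 2) (Fin 2) ℝ)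

/-- The components of `∂_z = (1/2) (∂_x - i ∂_y)` with respect to `∂_x, ∂_y`. -/
def dzComp : Fin 2 → ℂ := ![1 / 2, -(Complex.I / 2)]

/-- The function `⟨T(∂_z), ∂_z⟩` of a tensor field `T` of type `(1,1)` in a chart `c = (x, y)`, where
`T` and the metric are extended complex linearly. -/
def hopfFunction (T : ∀ x : M, TangentSpace (𝓡 2) x → TangentSpace (𝓡 2) x)
    (c : OpenPartialHomeomorph M (EuclideanSpace ℝ (Fin 2))) (p : M) : ℂ :=
  ∑ i, ∑ j, dzComp i * dzComp j * ((inner ℝ (T p (coordVec c i p)) (coordVec c j p) : ℝ) : ℂ)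

/-- `⟨T(∂_z), ∂_z⟩` is holomorphic: in every positively oriented isothermal chart `(x, y)` it is a
holomorphic function of `z = x + i y`. -/
def HasHolomorphicHopf (o : OrientedAtlas M)
    (T : ∀ x : M, TangentSpace (𝓡 2) x → TangentSpace (𝓡 2) x) : Prop :=
  ∀ c : OpenPartialHomeomorph M (EuclideanSpace ℝ (Fin 2)), o.IsPositive c → IsIsothermal c →
    DifferentiableOn ℂ (fun z : ℂ => hopfFunction T c (c.symm !₂[z.re, z.im]))
      {z : ℂ | !₂[z.re, z.im] ∈ c.target}

end Hopf

/-- Any two of the relations `P i` imply each of the others. -/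
def AnyTwoImplyAll {ι : Type*} (P : ι → Prop) : Prop :=
  ∀ i j : ι, i ≠ j → P i → P j → ∀ k : ι, P k

end SurfaceGeometry

end

open SurfaceGeometry

/-! Each of the four conditions is a linear relation between the two one-forms a = ⟨div A_H, ·⟩ and
b = d|H|². Since B takes normal values, differentiating ⟨dφ X, τ⟩ = 0 gives ⟨dφ X, ∇_Y τ⟩ = -⟨B(Y,
X), τ⟩, and with τ = 2H the stress-bienergy tensor becomes -2|H|² I + 4 A_H (`stressBienergy_eq`).
Hence biconservativity reads 2a = b. On a connected surface, constancy of |H| reads 0 = b. For a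
symmetric tensor field T the Codazzi equation is div T = grad tr T (`isCodazzi_iff`), while the
Cauchy-Riemann equations for ⟨T ∂_z, ∂_z⟩ in an isothermal chart are div T = ½ grad tr T
(`differentiableAt_hopfFunction_iff`). As tr A_H = 2|H|², these two conditions read a = 2b and a =
b. The coefficient pairs (2, 1), (0, 1), (1, 1), (1, 2) are pairwise independent, so two conditions
force a = b = 0, and then all four hold (`anyTwoImplyAll_of_linear`).

Passing from a holomorphic Hopf function to a = b at every point requires a positively oriented
isothermal chart around every point (`exists_isothermal_chart`). Such a chart comes from the
Beltrami equation ∂̄w = μ ∂w. The unknowns s = ∂w - 1 and p = ∂̄w satisfy p = μ(1 + s) and ∂p = ∂̄s.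
On the Fourier side the second relation is multiplication by a symbol of modulus at most one, so a
Neumann series solves the system once μ is the Fourier transform of a function with small L¹ norm. A
linear change of coordinates, a rescaling and a cutoff reduce the local problem to that case.

The geometric calculus rests on one further point. Connections are given by Christoffel symbols in a
preferred chart that changes with the point, and traces use orthonormal bases chosen pointwise
without continuity. The Koszul formula gives chart independence (`covAlongIn_eq`), and traces are
rewritten with the inverse Gram matrix (`sum_orthonormalBasis_eq`); only then are the fields
involved visibly smooth. -/

/-! ### The Beltrami equation with small coefficient, solved on the Fourier side -/

section Beltrami

open MeasureTheory Filter Topology ContDiff FourierTransform ComplexConjugate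

/-- All moments of `g` are finite. -/
def HasFiniteMoments (g : ℂ → ℂ) : Prop :=
  AEStronglyMeasurable g ∧ ∀ k : ℕ, Integrable fun v => (1 + ‖v‖) ^ k * ‖g v‖

/-- A weighted `L¹` norm. -/
noncomputable def weightedNorm (k : ℕ) (ε : ℝ) (g : ℂ → ℂ) : ℝ :=
  ∫ v, (1 + ε * ‖v‖) ^ k * ‖g v‖

theorem HasFiniteMoments.integrable_weight {g : ℂ → ℂ} (hg : HasFiniteMoments g) (k : ℕ) {ε : ℝ}
    (hε : 0 ≤ ε) (hε1 : ε ≤ 1) : Integrable fun v => (1 + ε * ‖v‖) ^ k * ‖g v‖ := by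
  refine (hg.2 k).mono' ?_ (Eventually.of_forall fun v => ?_)
  · exact (by fun_prop : Continuous fun v : ℂ => (1 + ε * ‖v‖) ^ k).aestronglyMeasurable.mul
      hg.1.norm
  · rw [norm_mul, norm_norm, Real.norm_of_nonneg (by positivity)]
    gcongr
    nlinarith [norm_nonneg v]

theorem HasFiniteMoments.integrable_norm {g : ℂ → ℂ} (hg : HasFiniteMoments g) :
    Integrable fun v => ‖g v‖ := by
  simpa using hg.2 0

theorem HasFiniteMoments.integrable {g : ℂ → ℂ} (hg : HasFiniteMoments g) : Integrable g :=
  (integrable_norm_iff hg.1).1 hg.integrable_norm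

theorem HasFiniteMoments.integrable_pow {g : ℂ → ℂ} (hg : HasFiniteMoments g) (k : ℕ) :
    Integrable fun v => ‖v‖ ^ k * ‖g v‖ := by
  refine (hg.2 k).mono' ?_ (Eventually.of_forall fun v => ?_)
  · exact (by fun_prop : Continuous fun v : ℂ => ‖v‖ ^ k).aestronglyMeasurable.mul hg.1.norm
  · rw [norm_mul, norm_norm, Real.norm_of_nonneg (by positivity)]
    gcongr
    linarith

theorem weightedNorm_nonneg (k : ℕ) {ε : ℝ} (hε : 0 ≤ ε) (g : ℂ → ℂ) : 0 ≤ weightedNorm k ε g :=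
  integral_nonneg fun v => by positivity

/-- The pointwise bound ‖v‖ ≤ ε⁻¹(1 + ε‖v‖) suffices. Shrinking ε costs only a constant depending on
k, never convergence. -/
theorem HasFiniteMoments.integral_norm_mul_le {g : ℂ → ℂ} (hg : HasFiniteMoments g) (k : ℕ) {ε : ℝ}
    (hε : 0 < ε) (hε1 : ε ≤ 1) : ∫ v, ‖v‖ ^ k * ‖g v‖ ≤ (ε⁻¹) ^ k * weightedNorm k ε g := by
  rw [weightedNorm, ← integral_const_mul]
  refine integral_mono (hg.integrable_pow k)
    ((hg.integrable_weight k hε.le hε1).const_mul _) fun v => ?_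
  change ‖v‖ ^ k * ‖g v‖ ≤ (ε⁻¹) ^ k * ((1 + ε * ‖v‖) ^ k * ‖g v‖)
  rw [← mul_assoc, ← mul_pow]
  gcongr
  rw [mul_add, inv_mul_cancel_left₀ hε.ne']
  have := inv_nonneg.2 hε.le
  linarith

theorem HasFiniteMoments.of_schwartz (f : SchwartzMap ℂ ℂ) : HasFiniteMoments f := by
  refine ⟨f.continuous.aestronglyMeasurable, fun k => ?_⟩
  have h := ((f.integrable_pow_mul volume 0).add (f.integrable_pow_mul volume k)).const_mul (2 ^ k)
  refine h.mono' ?_ (Eventually.of_forall fun v => ?_)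
  · exact (by fun_prop : Continuous fun v : ℂ => (1 + ‖v‖) ^ k * ‖f v‖).aestronglyMeasurable
  · rw [norm_mul, norm_norm, Real.norm_of_nonneg (by positivity)]
    simp only [Pi.add_apply, pow_zero]
    rw [← add_mul, ← mul_assoc]
    gcongr
    rcases le_total ‖v‖ 1 with h1 | h1
    · calc (1 + ‖v‖) ^ k ≤ 2 ^ k := by gcongr; linarith
        _ ≤ 2 ^ k * (1 + ‖v‖ ^ k) := by
          have : 0 ≤ (2:ℝ) ^ k * ‖v‖ ^ k := by positivity
          linarith
    · calc (1 + ‖v‖) ^ k ≤ (2 * ‖v‖) ^ k := by gcongr; linarith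
        _ = 2 ^ k * ‖v‖ ^ k := mul_pow ..
        _ ≤ 2 ^ k * (1 + ‖v‖ ^ k) := by gcongr; linarith

/-- The multiplier `conj v / v`. -/
noncomputable def beurlingSymbol (v : ℂ) : ℂ := conj v / v

theorem norm_beurlingSymbol_le (v : ℂ) : ‖beurlingSymbol v‖ ≤ 1 := by
  rw [beurlingSymbol, norm_div, RCLike.norm_conj]
  exact div_self_le_one _

theorem measurable_beurlingSymbol : Measurable beurlingSymbol :=
  (Complex.continuous_conj.measurable).div measurable_id

theorem norm_beurlingSymbol_mul_le (g : ℂ → ℂ) (v : ℂ) : ‖beurlingSymbol v * g v‖ ≤ ‖g v‖ := by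
  rw [norm_mul]
  exact mul_le_of_le_one_left (norm_nonneg _) (norm_beurlingSymbol_le v)

theorem HasFiniteMoments.beurlingSymbol_mul {g : ℂ → ℂ} (hg : HasFiniteMoments g) :
    HasFiniteMoments fun v => beurlingSymbol v * g v := by
  have hm : AEStronglyMeasurable fun v => beurlingSymbol v * g v :=
    measurable_beurlingSymbol.aestronglyMeasurable.mul hg.1
  refine ⟨hm, fun k => (hg.2 k).mono' ?_ (Eventually.of_forall fun v => ?_)⟩
  · exact (by fun_prop : Continuous fun v : ℂ => (1 + ‖v‖) ^ k).aestronglyMeasurable.mul hm.norm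
  · rw [norm_mul, norm_norm, Real.norm_of_nonneg (by positivity)]
    gcongr
    exact norm_beurlingSymbol_mul_le g v

theorem weightedNorm_beurlingSymbol_mul_le {g : ℂ → ℂ} (hg : HasFiniteMoments g) (k : ℕ) {ε : ℝ}
    (hε : 0 ≤ ε) (hε1 : ε ≤ 1) :
    weightedNorm k ε (fun v => beurlingSymbol v * g v) ≤ weightedNorm k ε g := by
  refine integral_mono (hg.beurlingSymbol_mul.integrable_weight k hε hε1)
    (hg.integrable_weight k hε hε1) fun v => ?_
  change (1 + ε * ‖v‖) ^ k * _ ≤ (1 + ε * ‖v‖) ^ k * _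
  gcongr
  exact norm_beurlingSymbol_mul_le g v

/-- The convolution product on `ℂ`. -/
noncomputable def convol (f g : ℂ → ℂ) : ℂ → ℂ :=
  convolution f g (ContinuousLinearMap.mul ℂ ℂ) volume

/-- The weight is submultiplicative: 1 + ε‖x‖ ≤ (1 + ε‖t‖)(1 + ε‖x - t‖). The bound holds almost
everywhere because the convolution of the two weighted functions is only known to converge there. -/
theorem weight_mul_norm_convol_ae_le {f g : ℂ → ℂ} (hf : HasFiniteMoments f)
    (hg : HasFiniteMoments g) (k : ℕ) {ε : ℝ} (hε : 0 ≤ ε) (hε1 : ε ≤ 1) :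
    ∀ᵐ x : ℂ, (1 + ε * ‖x‖) ^ k * ‖convol f g x‖ ≤
      convolution (fun v => (1 + ε * ‖v‖) ^ k * ‖f v‖) (fun v => (1 + ε * ‖v‖) ^ k * ‖g v‖)
        (ContinuousLinearMap.mul ℝ ℝ) volume x := by
  have hF := hf.integrable_weight k hε hε1
  have hG := hg.integrable_weight k hε hε1
  filter_upwards [hF.ae_convolution_exists (ContinuousLinearMap.mul ℝ ℝ) hG] with x hx
  have hx' : Integrable fun t => (1 + ε * ‖t‖) ^ k * ‖f t‖ * ((1 + ε * ‖x - t‖) ^ k * ‖g (x - t)‖) :=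
    hx
  have h1 : ‖convol f g x‖ ≤ ∫ t, ‖f t‖ * ‖g (x - t)‖ := by
    refine (norm_integral_le_integral_norm _).trans (le_of_eq ?_)
    simp
  calc (1 + ε * ‖x‖) ^ k * ‖convol f g x‖
      ≤ (1 + ε * ‖x‖) ^ k * ∫ t, ‖f t‖ * ‖g (x - t)‖ := by gcongr
    _ = ∫ t, (1 + ε * ‖x‖) ^ k * (‖f t‖ * ‖g (x - t)‖) := by rw [integral_const_mul]
    _ ≤ ∫ t, (1 + ε * ‖t‖) ^ k * ‖f t‖ * ((1 + ε * ‖x - t‖) ^ k * ‖g (x - t)‖) := by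
      refine integral_mono_of_nonneg (Eventually.of_forall fun t => by positivity) hx'
        (Eventually.of_forall fun t => ?_)
      change (1 + ε * ‖x‖) ^ k * (‖f t‖ * ‖g (x - t)‖) ≤
        (1 + ε * ‖t‖) ^ k * ‖f t‖ * ((1 + ε * ‖x - t‖) ^ k * ‖g (x - t)‖)
      rw [show (1 + ε * ‖t‖) ^ k * ‖f t‖ * ((1 + ε * ‖x - t‖) ^ k * ‖g (x - t)‖) =
        ((1 + ε * ‖t‖) * (1 + ε * ‖x - t‖)) ^ k * (‖f t‖ * ‖g (x - t)‖) by rw [mul_pow]; ring]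
      gcongr
      have h2 : ‖x‖ ≤ ‖t‖ + ‖x - t‖ := by simpa using norm_add_le t (x - t)
      have h3 : 0 ≤ ε * ‖t‖ * (ε * ‖x - t‖) := by positivity
      nlinarith

theorem HasFiniteMoments.convol {f g : ℂ → ℂ} (hf : HasFiniteMoments f) (hg : HasFiniteMoments g) :
    HasFiniteMoments (convol f g) := by
  have hm : AEStronglyMeasurable (_root_.convol f g) :=
    (hf.integrable.integrable_convolution (ContinuousLinearMap.mul ℂ ℂ) hg.integrable).1
  refine ⟨hm, fun k => ?_⟩
  have hF := hf.integrable_weight k zero_le_one le_rfl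
  have hG := hg.integrable_weight k zero_le_one le_rfl
  refine (hF.integrable_convolution (ContinuousLinearMap.mul ℝ ℝ) hG).mono' ?_ ?_
  · exact (by fun_prop : Continuous fun v : ℂ => (1 + ‖v‖) ^ k).aestronglyMeasurable.mul hm.norm
  · filter_upwards [weight_mul_norm_convol_ae_le hf hg k zero_le_one le_rfl] with x hx
    rw [norm_mul, norm_norm, Real.norm_of_nonneg (by positivity)]
    simpa using hx

theorem weightedNorm_convol_le {f g : ℂ → ℂ} (hf : HasFiniteMoments f) (hg : HasFiniteMoments g)
    (k : ℕ) {ε : ℝ} (hε : 0 ≤ ε) (hε1 : ε ≤ 1) :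
    weightedNorm k ε (convol f g) ≤ weightedNorm k ε f * weightedNorm k ε g := by
  have hF := hf.integrable_weight k hε hε1
  have hG := hg.integrable_weight k hε hε1
  have h := integral_convolution (ContinuousLinearMap.mul ℝ ℝ) hF hG
  calc weightedNorm k ε (convol f g) ≤ _ :=
        integral_mono_ae ((hf.convol hg).integrable_weight k hε hε1)
          (hF.integrable_convolution (ContinuousLinearMap.mul ℝ ℝ) hG)
          (weight_mul_norm_convol_ae_le hf hg k hε hε1)
    _ = _ := h

/-- By dominated convergence, with the weight at ε = 1 as majorant, the weighted norms tend to the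
plain L¹ norm as ε → 0⁺. Smallness in L¹ alone therefore yields smallness with a weight of any
order. -/
theorem HasFiniteMoments.exists_weightedNorm_lt {g : ℂ → ℂ} (hg : HasFiniteMoments g) {c : ℝ}
    (h : ∫ v, ‖g v‖ < c) (k : ℕ) : ∃ ε : ℝ, 0 < ε ∧ ε ≤ 1 ∧ weightedNorm k ε g < c := by
  have ht : Tendsto (fun ε : ℝ => weightedNorm k ε g) (𝓝[>] 0) (𝓝 (∫ v, ‖g v‖)) := by
    refine tendsto_integral_filter_of_dominated_convergence (fun v => (1 + ‖v‖) ^ k * ‖g v‖) ?_ ?_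
      (hg.2 k) (Eventually.of_forall fun v => ?_)
    · refine Eventually.of_forall fun ε => ?_
      exact (by fun_prop : Continuous fun v : ℂ => (1 + ε * ‖v‖) ^ k).aestronglyMeasurable.mul
        hg.1.norm
    · filter_upwards [Ioc_mem_nhdsGT (zero_lt_one (α := ℝ))] with ε hε
      refine Eventually.of_forall fun v => ?_
      have := hε.1.le
      rw [norm_mul, norm_norm, Real.norm_of_nonneg (by positivity)]
      gcongr
      nlinarith [norm_nonneg v, hε.2]
    · have : Continuous fun ε : ℝ => (1 + ε * ‖v‖) ^ k * ‖g v‖ := by fun_prop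
      have h2 := (this.tendsto 0).mono_left (nhdsWithin_le_nhds (s := Set.Ioi 0))
      simpa using h2
  obtain ⟨ε, h1, h2⟩ := ((ht.eventually_lt_const h).and
    (Ioc_mem_nhdsGT (zero_lt_one (α := ℝ)))).exists
  exact ⟨ε, h2.1, h2.2, h1⟩

/-- Each derivative of the Fourier transform brings down a factor 2π‖v‖ under the integral. -/
theorem norm_iteratedFDeriv_fourier_le {g : ℂ → ℂ} (hg : HasFiniteMoments g) (k : ℕ) (x : ℂ) :
    ‖iteratedFDeriv ℝ k (𝓕 g) x‖ ≤ (2 * Real.pi) ^ k * ∫ v, ‖v‖ ^ k * ‖g v‖ := by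
  rw [Real.iteratedFDeriv_fourier (N := ⊤) (fun n _ => hg.integrable_pow n) hg.1 (n := k) le_top,
    ← integral_const_mul]
  refine (VectorFourier.norm_fourierIntegral_le_integral_norm _ _ _ _ _).trans ?_
  refine integral_mono
    (VectorFourier.integrable_fourierPowSMulRight _ (hg.integrable_pow k) hg.1).norm
    ((hg.integrable_pow k).const_mul _) fun v => ?_
  refine (VectorFourier.norm_fourierPowSMulRight_le _ _ _ _).trans ?_
  have hL : ‖innerSL ℝ (E := ℂ)‖ ≤ 1 := norm_innerSL_le ℝ
  change _ ≤ (2 * Real.pi) ^ k * (‖v‖ ^ k * ‖g v‖)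
  rw [← mul_assoc]
  have := Real.pi_pos
  have h2 : 2 * Real.pi * ‖innerSL ℝ (E := ℂ)‖ ≤ 2 * Real.pi :=
    mul_le_of_le_one_right (by positivity) hL
  gcongr

theorem HasFiniteMoments.contDiff_fourier {g : ℂ → ℂ} (hg : HasFiniteMoments g) :
    ContDiff ℝ ∞ (𝓕 g) :=
  Real.contDiff_fourier (N := ⊤) fun n _ => hg.integrable_pow n

theorem HasFiniteMoments.integrable_inner_mul {g : ℂ → ℂ} (hg : HasFiniteMoments g) (y : ℂ) :
    Integrable fun v => -(2 * Real.pi * Complex.I) * ((inner ℝ v y : ℝ) : ℂ) * g v := by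
  have hc : Continuous fun v : ℂ => -(2 * Real.pi * Complex.I) * ((inner ℝ v y : ℝ) : ℂ) := by
    fun_prop
  refine ((hg.integrable_pow 1).const_mul (2 * Real.pi * ‖y‖)).mono'
    (hc.aestronglyMeasurable.mul hg.1) (Eventually.of_forall fun v => ?_)
  have := Real.pi_pos
  simp only [norm_mul, norm_neg, Complex.norm_I, Complex.norm_real, Complex.norm_ofNat, mul_one,
    pow_one, Real.norm_of_nonneg this.le]
  have h := norm_inner_le_norm (𝕜 := ℝ) v y
  calc 2 * Real.pi * ‖(inner ℝ v y : ℝ)‖ * ‖g v‖ ≤ 2 * Real.pi * (‖v‖ * ‖y‖) * ‖g v‖ := by gcongr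
    _ = _ := by ring

theorem fderiv_fourier_apply {g : ℂ → ℂ} (hg : HasFiniteMoments g) (x y : ℂ) :
    fderiv ℝ (𝓕 g) x y =
      𝓕 (fun v => -(2 * Real.pi * Complex.I) * ((inner ℝ v y : ℝ) : ℂ) * g v) x := by
  have h1 : Integrable fun v => ‖v‖ * ‖g v‖ := by simpa using hg.integrable_pow 1
  rw [Real.fderiv_fourier hg.integrable h1, Real.fourier_continuousLinearMap_apply]
  · refine congrFun (congrArg _ (funext fun v => ?_)) x
    change -(2 * Real.pi * Complex.I) • (inner ℝ v y : ℝ) • g v = _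
    rw [Complex.real_smul, smul_eq_mul]
    ring
  · refine (h1.const_mul (2 * Real.pi * ‖innerSL ℝ (E := ℂ)‖)).mono'
      (hg.1.fourierSMulRight) (Eventually.of_forall fun v => ?_)
    rw [← mul_assoc]
    exact VectorFourier.norm_fourierSMulRight_le _ _ _

theorem fourier_add_const_mul {f g : ℂ → ℂ} (hf : Integrable f) (hg : Integrable g) (a x : ℂ) :
    𝓕 f x + a * 𝓕 g x = 𝓕 (fun v => f v + a * g v) x := by
  have hf' := (Real.fourierIntegral_convergent_iff (V := ℂ) x).2 hf
  have hg' := (Real.fourierIntegral_convergent_iff (V := ℂ) x).2 hg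
  simp only [Real.fourier_eq]
  rw [← integral_const_mul, ← integral_add hf' (hg'.const_mul a)]
  congr 1
  funext v
  simp only [Circle.smul_def, smul_eq_mul]
  ring

/-- On the Fourier side ∂_x - i∂_y multiplies by conj v and ∂_x + i∂_y by v, up to the common factor
-2πi. The symbol conj v / v converts one into the other. -/
theorem dz_fourier_eq_dzbar {g : ℂ → ℂ} (hg : HasFiniteMoments g) (x : ℂ) :
    fderiv ℝ (𝓕 g) x 1 + -Complex.I * fderiv ℝ (𝓕 g) x Complex.I =
      fderiv ℝ (𝓕 fun v => beurlingSymbol v * g v) x 1 +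
        Complex.I * fderiv ℝ (𝓕 fun v => beurlingSymbol v * g v) x Complex.I := by
  have hs := hg.beurlingSymbol_mul
  rw [fderiv_fourier_apply hg, fderiv_fourier_apply hg, fderiv_fourier_apply hs,
    fderiv_fourier_apply hs, fourier_add_const_mul (hg.integrable_inner_mul _)
      (hg.integrable_inner_mul _), fourier_add_const_mul (hs.integrable_inner_mul _)
      (hs.integrable_inner_mul _)]
  refine congrFun (congrArg _ (funext fun v => ?_)) x
  have h1 : ((inner ℝ v 1 : ℝ) : ℂ) = v.re := by simp [Complex.inner]
  have h2 : ((inner ℝ v Complex.I : ℝ) : ℂ) = v.im := by simp [Complex.inner]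
  rw [h1, h2]
  have h3 : conj v = v.re - v.im * Complex.I := by
    apply Complex.ext <;> simp
  -- At v = 0 the convention 0 / 0 = 0 does no harm, since both sides vanish.
  have h4 : v * beurlingSymbol v = conj v := by
    rcases eq_or_ne v 0 with rfl | hv
    · simp
    · rw [beurlingSymbol, mul_div_cancel₀ _ hv]
  have h5 : v = v.re + v.im * Complex.I := (Complex.re_add_im v).symm
  calc _ = -(2 * Real.pi * Complex.I) * (v.re - v.im * Complex.I) * g v := by ring
    _ = -(2 * Real.pi * Complex.I) * (v * beurlingSymbol v) * g v := by rw [← h3, h4]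
    _ = -(2 * Real.pi * Complex.I) * ((v.re + v.im * Complex.I) * beurlingSymbol v) * g v := by
      rw [← h5]
    _ = _ := by ring

/-- The terms of the Neumann series of the Beltrami equation, on the Fourier side. -/
noncomputable def neumannTerm (G : ℂ → ℂ) : ℕ → ℂ → ℂ
  | 0 => G
  | k + 1 => convol G fun v => beurlingSymbol v * neumannTerm G k v

theorem HasFiniteMoments.neumannTerm {G : ℂ → ℂ} (hG : HasFiniteMoments G) (j : ℕ) :
    HasFiniteMoments (neumannTerm G j) := by
  induction j with
  | zero => exact hG
  | succ j ih => exact hG.convol ih.beurlingSymbol_mul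

/-- Multiplication by the symbol costs nothing and each convolution with G costs one factor of its
weighted norm, so the series is dominated by a geometric one. -/
theorem weightedNorm_neumannTerm_le {G : ℂ → ℂ} (hG : HasFiniteMoments G) (k : ℕ) {ε : ℝ}
    (hε : 0 ≤ ε) (hε1 : ε ≤ 1) (j : ℕ) :
    weightedNorm k ε (neumannTerm G j) ≤ weightedNorm k ε G ^ (j + 1) := by
  induction j with
  | zero => simp [neumannTerm]
  | succ j ih =>
    have h := (hG.neumannTerm j)
    calc weightedNorm k ε (neumannTerm G (j + 1)) ≤ weightedNorm k ε G *
          weightedNorm k ε (fun v => beurlingSymbol v * neumannTerm G j v) :=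
          weightedNorm_convol_le hG h.beurlingSymbol_mul k hε hε1
      _ ≤ weightedNorm k ε G * weightedNorm k ε G ^ (j + 1) := by
          have := weightedNorm_nonneg k hε G
          gcongr
          exact (weightedNorm_beurlingSymbol_mul_le h k hε hε1).trans ih
      _ = _ := by ring

theorem norm_iteratedFDeriv_fourier_le_weightedNorm {g : ℂ → ℂ} (hg : HasFiniteMoments g) (k : ℕ)
    {ε : ℝ} (hε : 0 < ε) (hε1 : ε ≤ 1) (x : ℂ) :
    ‖iteratedFDeriv ℝ k (𝓕 g) x‖ ≤ (2 * Real.pi * ε⁻¹) ^ k * weightedNorm k ε g := by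
  refine (norm_iteratedFDeriv_fourier_le hg k x).trans ?_
  rw [mul_pow (2 * Real.pi), mul_assoc]
  have := Real.pi_pos
  gcongr
  exact hg.integral_norm_mul_le k hε hε1

theorem norm_fourier_le {g : ℂ → ℂ} (hg : HasFiniteMoments g) (x : ℂ) :
    ‖𝓕 g x‖ ≤ weightedNorm 0 1 g := by
  have := norm_iteratedFDeriv_fourier_le_weightedNorm hg 0 zero_lt_one le_rfl x
  simpa using this

/-- For each order k of differentiation a separate ε is chosen, small enough that the k-th weighted
norm of G stays below 1. One hypothesis on the L¹ norm thus controls derivatives of all orders and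
makes the sum smooth. -/
theorem exists_summable_bound_neumann {G : ℂ → ℂ} (hG : HasFiniteMoments G)
    (h1 : ∫ v, ‖G v‖ < 1) : ∃ b : ℕ → ℕ → ℝ, (∀ k, Summable (b k)) ∧
      (∀ k j x, ‖iteratedFDeriv ℝ k (𝓕 (neumannTerm G j)) x‖ ≤ b k j) ∧
      ∀ k j x, ‖iteratedFDeriv ℝ k (𝓕 fun v => beurlingSymbol v * neumannTerm G j v) x‖ ≤
        b k j := by
  choose ε hε hε1 hlt using hG.exists_weightedNorm_lt h1
  refine ⟨fun k j => (2 * Real.pi * (ε k)⁻¹) ^ k * weightedNorm k (ε k) G ^ (j + 1), fun k => ?_,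
    fun k j x => ?_, fun k j x => ?_⟩
  · have := weightedNorm_nonneg k (hε k).le G
    exact (((summable_nat_add_iff 1).2 (summable_geometric_of_lt_one this (hlt k)))).mul_left _
  · refine (norm_iteratedFDeriv_fourier_le_weightedNorm (hG.neumannTerm j) k (hε k) (hε1 k) x).trans
      ?_
    have := Real.pi_pos
    have := hε k
    beta_reduce
    gcongr
    exact weightedNorm_neumannTerm_le hG k this.le (hε1 k) j
  · refine (norm_iteratedFDeriv_fourier_le_weightedNorm (hG.neumannTerm j).beurlingSymbol_mul k
      (hε k) (hε1 k) x).trans ?_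
    have := Real.pi_pos
    have := hε k
    beta_reduce
    gcongr
    exact (weightedNorm_beurlingSymbol_mul_le (hG.neumannTerm j) k this.le (hε1 k)).trans
      (weightedNorm_neumannTerm_le hG k this.le (hε1 k) j)

theorem contDiff_tsum_and_fderiv {f : ℕ → ℂ → ℂ} {b : ℕ → ℕ → ℝ} (hf : ∀ j, ContDiff ℝ ∞ (f j))
    (hb : ∀ k, Summable (b k)) (h : ∀ k j x, ‖iteratedFDeriv ℝ k (f j) x‖ ≤ b k j) :
    ContDiff ℝ ∞ (fun x => ∑' j, f j x) ∧ (∀ x, Summable fun j => f j x) ∧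
      ∀ x y, HasSum (fun j => fderiv ℝ (f j) x y) (fderiv ℝ (fun x => ∑' j, f j x) x y) := by
  have h0 : ∀ x, Summable fun j => f j x := fun x =>
    Summable.of_norm_bounded (hb 0) fun j => by simpa using h 0 j x
  have h1 : ∀ j x, ‖fderiv ℝ (f j) x‖ ≤ b 1 j := fun j x => by
    simpa [norm_iteratedFDeriv_one] using h 1 j x
  refine ⟨contDiff_tsum (N := ⊤) hf (fun k _ => hb k) (fun k j x _ => h k j x), h0, fun x y => ?_⟩
  rw [fderiv_tsum_apply (hb 1) (fun j => (hf j).differentiable (by simp)) h1 (h0 0)]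
  have hs : Summable fun j => fderiv ℝ (f j) x := Summable.of_norm_bounded (hb 1) fun j => h1 j x
  exact (ContinuousLinearMap.apply ℝ ℂ y).hasSum hs.hasSum

/-- Solution of the Beltrami equation with a coefficient whose Fourier transform has small
`L¹` norm. -/
theorem exists_beltrami_pair {G : ℂ → ℂ} (hG : HasFiniteMoments G) (h1 : ∫ v, ‖G v‖ < 1 / 2) :
    ∃ p s : ℂ → ℂ, ContDiff ℝ ∞ p ∧ ContDiff ℝ ∞ s ∧ (∀ x, p x = 𝓕 G x * (1 + s x)) ∧
      (∀ x, ‖s x‖ < 1) ∧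
      ∀ x, fderiv ℝ p x 1 + -Complex.I * fderiv ℝ p x Complex.I =
        fderiv ℝ s x 1 + Complex.I * fderiv ℝ s x Complex.I := by
  obtain ⟨b, hb, hp, hs⟩ := exists_summable_bound_neumann hG (h1.trans (by norm_num))
  have hgm := fun j => hG.neumannTerm j
  obtain ⟨p1, p2, p3⟩ := contDiff_tsum_and_fderiv (fun j => (hgm j).contDiff_fourier) hb hp
  obtain ⟨s1, s2, s3⟩ := contDiff_tsum_and_fderiv
    (fun j => (hgm j).beurlingSymbol_mul.contDiff_fourier) hb hs
  refine ⟨_, _, p1, s1, fun x => ?_, fun x => ?_, fun x => ?_⟩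
  -- The zeroth term is 𝓕 G; by the convolution theorem the remaining terms are 𝓕 G times the terms
  -- of s.
  · rw [(p2 x).tsum_eq_zero_add, mul_add, mul_one, ← tsum_mul_left]
    congr 1
    refine tsum_congr fun j => ?_
    exact Real.fourier_mul_convolution_eq hG.integrable (hgm j).beurlingSymbol_mul.integrable x
  -- With q the L¹ norm of G, the series of s is bounded by q / (1 - q), which is below 1 exactly
  -- because q < 1/2.
  · have hw : weightedNorm 0 1 G < 1 / 2 := by simpa [weightedNorm] using h1
    have hw0 := weightedNorm_nonneg 0 zero_le_one G
    have hg := hasSum_geometric_of_lt_one hw0 (hw.trans (by norm_num))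
    have hg' := hg.mul_left (weightedNorm 0 1 G)
    have hle := tsum_of_norm_bounded hg' (f := fun j => 𝓕 (fun v => beurlingSymbol v *
      neumannTerm G j v) x) (fun j => by
        refine (norm_fourier_le (hgm j).beurlingSymbol_mul x).trans ?_
        refine (weightedNorm_beurlingSymbol_mul_le (hgm j) 0 zero_le_one le_rfl).trans ?_
        refine (weightedNorm_neumannTerm_le hG 0 zero_le_one le_rfl j).trans (le_of_eq ?_)
        ring)
    refine hle.trans_lt ?_
    rw [← div_eq_mul_inv, div_lt_one (by linarith)]
    linarith
  · have e1 := (p3 x 1).add ((p3 x Complex.I).mul_left (-Complex.I))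
    have e2 := (s3 x 1).add ((s3 x Complex.I).mul_left Complex.I)
    refine e1.unique ?_
    convert e2 using 2 with j
    exact dz_fourier_eq_dzbar (hgm j) x

/-- Integration of the Beltrami pair. -/
theorem exists_beltrami_solution {G : ℂ → ℂ} (hG : HasFiniteMoments G)
    (h1 : ∫ v, ‖G v‖ < 1 / 2) :
    ∃ w s : ℂ → ℂ, ContDiff ℝ ∞ w ∧ (∀ x, 1 + s x ≠ 0) ∧
      ∀ x h, fderiv ℝ w x h = (1 + s x) * (h + 𝓕 G x * conj h) := by
  obtain ⟨p, s, hp, hs, hps, hs1, hd⟩ := exists_beltrami_pair hG h1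
  let c : ℂ →L[ℝ] ℂ := Complex.conjCLE.toContinuousLinearMap
  let i : ℂ →L[ℝ] ℂ := ContinuousLinearMap.id ℝ ℂ
  -- This is the candidate for dw, namely (1 + s) dz + p dz̄.
  let η : ℂ → ℂ →L[ℝ] ℂ := fun x => (1 + s x) • i + p x • c
  have hη : ContDiff ℝ ∞ η :=
    ((contDiff_const.add hs).smul contDiff_const).add (hp.smul contDiff_const)
  have hpd : ∀ x, DifferentiableAt ℝ p x := hp.differentiable (by simp)
  have hsd : ∀ x, DifferentiableAt ℝ s x := hs.differentiable (by simp)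
  have hηd : ∀ x u v, fderiv ℝ η x u v = fderiv ℝ s x u * v + fderiv ℝ p x u * conj v := by
    intro x u v
    have h := (((hsd x).hasFDerivAt.const_add 1).smul_const i).add
      ((hpd x).hasFDerivAt.smul_const c)
    have h' : fderiv ℝ η x = _ := h.fderiv
    rw [h']
    simp [i, c]
  have hlin : ∀ (L : ℂ →L[ℝ] ℂ) (u : ℂ), L u = u.re * L 1 + u.im * L Complex.I := by
    intro L u
    have : u = u.re • (1 : ℂ) + u.im • Complex.I := by
      simp [Complex.re_add_im]
    conv_lhs => rw [this]
    rw [map_add, map_smul, map_smul, Complex.real_smul, Complex.real_smul]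
  -- Poincaré lemma on the plane: the symmetry of the derivative of η is equivalent to ∂p = ∂̄s.
  obtain ⟨w, hw⟩ := convex_univ.exists_forall_hasFDerivAt_of_fderiv_symmetric isOpen_univ
    (hη.differentiable (by simp) : Differentiable ℝ η).differentiableOn (fun x _ u v => by
      rw [hηd, hηd, hlin (fderiv ℝ s x) u, hlin (fderiv ℝ s x) v, hlin (fderiv ℝ p x) u,
        hlin (fderiv ℝ p x) v]
      have hu := Complex.re_add_im u
      have hv := Complex.re_add_im v
      have hcu : conj u = u.re - u.im * Complex.I := by apply Complex.ext <;> simp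
      have hcv : conj v = v.re - v.im * Complex.I := by apply Complex.ext <;> simp
      rw [hcu, hcv]
      have hI := Complex.I_mul_I
      have := hd x
      generalize fderiv ℝ s x 1 = s1 at *
      generalize fderiv ℝ s x Complex.I = s2 at *
      generalize fderiv ℝ p x 1 = p1 at *
      generalize fderiv ℝ p x Complex.I = p2 at *
      generalize (u.re : ℂ) = a at *
      generalize (u.im : ℂ) = b at *
      generalize (v.re : ℂ) = c at *
      generalize (v.im : ℂ) = d at *
      rw [← hu, ← hv]
      linear_combination (-(Complex.I) * (a * d - b * c)) * this - (a * d - b * c) * (s2 + p2) * hI)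
  refine ⟨w, s, ?_, fun x h0 => ?_, fun x h => ?_⟩
  · rw [contDiff_infty_iff_fderiv]
    refine ⟨fun x => (hw x trivial).differentiableAt, ?_⟩
    rwa [show fderiv ℝ w = η from funext fun x => (hw x trivial).fderiv]
  · have := hs1 x
    rw [eq_neg_of_add_eq_zero_right h0] at this
    simp at this
  · rw [(hw x trivial).fderiv]
    simp only [η, c, i, add_apply, smul_apply, hps]
    simp
    ring

/-! ### Localization: making the Beltrami coefficient small by rescaling -/

theorem ContDiff.exists_iteratedFDeriv_bound {f : ℂ → ℂ} (hf : ContDiff ℝ ∞ f)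
    (hs : HasCompactSupport f) (n : ℕ) : ∃ C, 0 ≤ C ∧ ∀ x, ‖iteratedFDeriv ℝ n f x‖ ≤ C := by
  have hc : Continuous (iteratedFDeriv ℝ n f) :=
    (hf.of_le (mod_cast le_top)).continuous_iteratedFDeriv'
  obtain ⟨C, hC⟩ := hc.bounded_above_of_compact_support (hs.iteratedFDeriv n)
  exact ⟨C, (norm_nonneg _).trans (hC 0), hC⟩

/-- Three derivatives give decay of order -3, which is integrable in real dimension two. The
constant is 36 = 4 + 4·2³, from (1 + t)³ ≤ 4(1 + t³) and the estimates of orders 0 and 3. -/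
theorem norm_fourier_le_of_bound {f : ℂ → ℂ} (hf : ContDiff ℝ ∞ f) {a : ℝ} {C : ℕ → ℝ}
    (hsupp : tsupport f ⊆ Metric.closedBall 0 a)
    (hC : ∀ n x, ‖iteratedFDeriv ℝ n f x‖ ≤ C n) (w : ℂ) :
    ‖𝓕 f w‖ ≤ (36 * ∑ p ∈ Finset.range 4, C p) *
      volume.real (Metric.closedBall (0 : ℂ) a) * (1 + ‖w‖) ^ (-3 : ℝ) := by
  have hcs : HasCompactSupport f :=
    (isCompact_closedBall (0 : ℂ) a).of_isClosed_subset (isClosed_tsupport f) hsupp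
  have hint : ∀ k n : ℕ, Integrable fun v => ‖v‖ ^ k * ‖iteratedFDeriv ℝ n f v‖ := fun k n =>
    (hcs.toSchwartzMap hf).integrable_pow_mul_iteratedFDeriv volume k n
  have hI : ∀ n, ∫ v, ‖iteratedFDeriv ℝ n f v‖ ≤ C n * volume.real (Metric.closedBall (0:ℂ) a) := by
    intro n
    have h0 : ∀ v, v ∉ Metric.closedBall (0 : ℂ) a → ‖iteratedFDeriv ℝ n f v‖ = 0 := fun v hv => by
      rw [norm_eq_zero]
      by_contra h
      exact hv (hsupp (support_iteratedFDeriv_subset n h))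
    rw [← setIntegral_eq_integral_of_forall_compl_eq_zero h0]
    refine (setIntegral_mono_on (g := fun _ => C n) ?_ ?_
      measurableSet_closedBall fun v _ => hC n v).trans ?_
    · simpa using (hint 0 n).integrableOn
    · exact integrableOn_const (isCompact_closedBall _ _).measure_lt_top.ne
    · rw [setIntegral_const, smul_eq_mul, mul_comm]
  set V := volume.real (Metric.closedBall (0 : ℂ) a)
  have key : ∀ n, ‖w‖ ^ n * ‖𝓕 f w‖ ≤ 2 ^ n * ∑ p ∈ Finset.range (n + 1), C p * V := by
    intro n
    have h := Real.pow_mul_norm_iteratedFDeriv_fourier_le (K := ⊤) (N := ⊤) hf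
      (fun k n _ _ => hint k n) (k := 0) (n := n) le_top le_top w
    simp only [norm_iteratedFDeriv_zero, pow_zero, CharP.cast_eq_zero,
      mul_zero, zero_add, one_mul, Finset.range_one, Finset.singleton_product, Finset.sum_map,
      Function.Embedding.coeFn_mk] at h
    refine h.trans ?_
    gcongr with p hp
    exact hI p
  have hC0 : ∀ n, 0 ≤ C n := fun n => (norm_nonneg _).trans (hC n 0)
  have hV : 0 ≤ V := measureReal_nonneg
  have h0 := key 0
  have h3 := key 3
  have hsum : C 0 ≤ ∑ p ∈ Finset.range 4, C p :=
    Finset.single_le_sum (f := C) (fun i _ => hC0 i) (by simp)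
  simp only [pow_zero, one_mul, zero_add, Finset.range_one, Finset.sum_singleton] at h0
  rw [← Finset.sum_mul] at h3
  have hw : 0 ≤ ‖w‖ := norm_nonneg w
  rw [Real.rpow_neg (by positivity), ← div_eq_mul_inv, le_div_iff₀ (by positivity)]
  norm_cast
  have h4 : (1 + ‖w‖) ^ 3 ≤ 4 * (1 + ‖w‖ ^ 3) := by
    nlinarith [mul_nonneg (sq_nonneg (‖w‖ - 1)) (by positivity : 0 ≤ 1 + ‖w‖)]
  calc ‖𝓕 f w‖ * (1 + ‖w‖) ^ 3 ≤ ‖𝓕 f w‖ * (4 * (1 + ‖w‖ ^ 3)) := by gcongr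
    _ = 4 * ‖𝓕 f w‖ + 4 * (‖w‖ ^ 3 * ‖𝓕 f w‖) := by ring
    _ ≤ _ := by
      norm_num at h3
      nlinarith [mul_le_mul_of_nonneg_right hsum hV]

theorem exists_integral_fourierInv_lt {f : ℝ → ℂ → ℂ} {a : ℝ} {K : ℕ → ℝ}
    (hf : ∀ r, ContDiff ℝ ∞ (f r)) (hsupp : ∀ r, tsupport (f r) ⊆ Metric.closedBall 0 a)
    (hK : ∀ r ∈ Set.Ioc (0 : ℝ) 1, ∀ n x, ‖iteratedFDeriv ℝ n (f r) x‖ ≤ r * K n) {c : ℝ}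
    (hc : 0 < c) : ∃ r : ℝ, 0 < r ∧ ∫ v, ‖𝓕⁻ (f r) v‖ < c := by
  have hint : Integrable fun v : ℂ => (1 + ‖v‖) ^ (-3 : ℝ) :=
    integrable_one_add_norm (by rw [Complex.finrank_real_complex]; norm_num)
  have hK0 : ∀ n, 0 ≤ K n := fun n => by
    have := (norm_nonneg _).trans (hK 1 (by simp) n 0)
    linarith
  set D := (36 * ∑ p ∈ Finset.range 4, K p) * volume.real (Metric.closedBall (0 : ℂ) a) *
    ∫ v : ℂ, (1 + ‖v‖) ^ (-3 : ℝ) with hD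
  have hD0 : 0 ≤ D := mul_nonneg (mul_nonneg (mul_nonneg (by norm_num)
    (Finset.sum_nonneg fun i _ => hK0 i)) measureReal_nonneg)
      (integral_nonneg fun v => by positivity)
  have hle : ∀ r ∈ Set.Ioc (0 : ℝ) 1, ∫ v, ‖𝓕⁻ (f r) v‖ ≤ r * D := by
    intro r hr
    calc ∫ v, ‖𝓕⁻ (f r) v‖ ≤ ∫ v : ℂ, r * (36 * ∑ p ∈ Finset.range 4, K p) *
          volume.real (Metric.closedBall (0 : ℂ) a) * (1 + ‖v‖) ^ (-3 : ℝ) := by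
          refine integral_mono_of_nonneg (Eventually.of_forall fun v => norm_nonneg _)
            (hint.const_mul _) (Eventually.of_forall fun v => ?_)
          beta_reduce
          rw [Real.fourierInv_eq_fourier_neg]
          have h := norm_fourier_le_of_bound (hf r) (hsupp r) (fun n x => hK r hr n x) (-v)
          rw [norm_neg, ← Finset.mul_sum] at h
          exact h.trans (le_of_eq (by ring))
      _ = r * D := by rw [integral_const_mul, hD]; ring
  -- The integral is at most r D for r ≤ 1; adding 1 to D avoids dividing by zero.
  refine ⟨min 1 (c / (2 * (D + 1))), by positivity, ?_⟩
  refine (hle _ ⟨by positivity, min_le_left _ _⟩).trans_lt ?_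
  calc min 1 (c / (2 * (D + 1))) * D ≤ c / (2 * (D + 1)) * (D + 1) := by
        gcongr
        · exact min_le_right _ _
        · linarith
    _ = c / 2 := by field_simp
    _ < c := by linarith

/-- Derivatives of x ↦ μ(r x) of positive order m carry r^m ≤ r. The value itself is O(r) on the
ball of radius 2 by the mean value inequality, and this is where μ(0) = 0 enters. The Leibniz rule
combines the two. -/
theorem exists_scaled_bound {χ μ : ℂ → ℂ} (hχ : ContDiff ℝ ∞ χ) (hχs : HasCompactSupport χ)
    (hχ2 : tsupport χ ⊆ Metric.closedBall 0 2) (hμ : ContDiff ℝ ∞ μ) (hμs : HasCompactSupport μ)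
    (h0 : μ 0 = 0) : ∃ K : ℕ → ℝ, ∀ r ∈ Set.Ioc (0 : ℝ) 1, ∀ n x,
      ‖iteratedFDeriv ℝ n (fun x => χ x * μ (r • x)) x‖ ≤ r * K n := by
  choose A hA0 hA using hχ.exists_iteratedFDeriv_bound hχs
  choose B hB0 hB using hμ.exists_iteratedFDeriv_bound hμs
  refine ⟨fun n => ∑ i ∈ Finset.range (n + 1), (n.choose i : ℝ) * A i * (2 * B 1 + B (n - i)),
    fun r hr n x => ?_⟩
  have hr0 := hr.1.le
  have hμr : ContDiff ℝ ∞ fun x : ℂ => μ (r • x) := hμ.comp (contDiff_const_smul r)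
  by_cases hx : x ∈ Metric.closedBall (0 : ℂ) 2
  · refine (norm_iteratedFDeriv_mul_le hχ hμr x (mod_cast le_top)).trans ?_
    rw [Finset.mul_sum]
    refine Finset.sum_le_sum fun i _ => ?_
    rw [show r * ((n.choose i : ℝ) * A i * (2 * B 1 + B (n - i))) =
      (n.choose i : ℝ) * A i * (r * (2 * B 1 + B (n - i))) by ring]
    have h1 := hA i x
    have h2 : ‖iteratedFDeriv ℝ (n - i) (fun x => μ (r • x)) x‖ ≤ r * (2 * B 1 + B (n - i)) := by
      generalize n - i = m
      rcases m with _ | m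
      · rw [norm_iteratedFDeriv_zero]
        have hl : ‖μ (r • x) - μ 0‖ ≤ B 1 * ‖r • x - 0‖ :=
          convex_univ.norm_image_sub_le_of_norm_fderiv_le
            (fun y _ => (hμ.differentiable (by simp)) y)
            (fun y _ => by simpa [norm_iteratedFDeriv_one] using hB 1 y) trivial trivial
        rw [h0, sub_zero, sub_zero, norm_smul, Real.norm_of_nonneg hr0] at hl
        have hx2 : ‖x‖ ≤ 2 := by simpa using hx
        have h3 : B 1 * (r * ‖x‖) ≤ B 1 * (r * 2) := by
          have := hB0 1
          gcongr
        nlinarith [mul_nonneg hr0 (hB0 0)]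
      · rw [iteratedFDeriv_comp_const_smul r (hμ.of_le (mod_cast le_top)), norm_smul, norm_pow,
          Real.norm_of_nonneg hr0]
        have h3 : r ^ (m + 1) ≤ r := by
          rw [pow_succ]
          exact mul_le_of_le_one_left hr0 (pow_le_one₀ hr0 hr.2)
        calc r ^ (m + 1) * _ ≤ r * B (m + 1) := by
              gcongr
              exact hB _ _
          _ ≤ _ := by
              have := hB0 1
              gcongr
              linarith
    have := hA0 i
    gcongr
  · have h1 : iteratedFDeriv ℝ n (fun x => χ x * μ (r • x)) x = 0 := by
      by_contra h
      exact hx (hχ2 (tsupport_mul_subset_left (support_iteratedFDeriv_subset n h)))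
    rw [h1, norm_zero]
    refine mul_nonneg hr0 (Finset.sum_nonneg fun i _ => ?_)
    have := hA0 i
    have := hB0 1
    have := hB0 (n - i)
    positivity

/-- After rescaling, a function vanishing at `0` agrees near `0` with a test function whose Fourier
transform has small `L¹` norm. -/
theorem exists_small_localization {μ : ℂ → ℂ} {U : Set ℂ} (hU : IsOpen U) (h0U : (0 : ℂ) ∈ U)
    (hμ : ContDiffOn ℝ ∞ μ U) (h0 : μ 0 = 0) :
    ∃ r : ℝ, 0 < r ∧ ∃ G : ℂ → ℂ, HasFiniteMoments G ∧ ∫ v, ‖G v‖ < 1 / 2 ∧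
      ∀ᶠ x in 𝓝 (0 : ℂ), 𝓕 G x = μ (r • x) := by
  obtain ⟨ε, hε, hεU⟩ := Metric.isOpen_iff.1 hU 0 h0U
  -- First cutoff: it turns μ into a globally smooth function with compact support in U.
  let b : ContDiffBump (0 : ℂ) := ⟨ε / 4, ε / 2, by positivity, by linarith⟩
  have hbs : tsupport (fun x => ((b x : ℝ) : ℂ)) ⊆ Metric.closedBall 0 (ε / 2) := by
    refine (tsupport_comp_subset (g := fun t : ℝ => (t : ℂ)) Complex.ofReal_zero b).trans ?_
    exact b.tsupport_eq.le
  have hbc : ContDiff ℝ ∞ fun x => ((b x : ℝ) : ℂ) := Complex.ofRealCLM.contDiff.comp b.contDiff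
  let μ₁ : ℂ → ℂ := fun x => (b x : ℂ) * μ x
  have hμ₁s : tsupport μ₁ ⊆ Metric.closedBall 0 (ε / 2) := tsupport_mul_subset_left.trans hbs
  have hμ₁c : HasCompactSupport μ₁ :=
    (isCompact_closedBall _ _).of_isClosed_subset (isClosed_tsupport _) hμ₁s
  have hμ₁ : ContDiff ℝ ∞ μ₁ := by
    refine contDiff_iff_contDiffAt.2 fun x => ?_
    by_cases hx : x ∈ tsupport μ₁
    · have hxU : x ∈ U := hεU (Metric.closedBall_subset_ball (by linarith) (hμ₁s hx))
      exact hbc.contDiffAt.mul (hμ.contDiffAt (hU.mem_nhds hxU))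
    · exact contDiffAt_const.congr_of_eventuallyEq (notMem_tsupport_iff_eventuallyEq.1 hx)
  -- Second cutoff, applied after rescaling, so that all supports lie in one ball independent of r.
  let c : ContDiffBump (0 : ℂ) := ⟨1, 2, one_pos, one_lt_two⟩
  have hcs : tsupport (fun x => ((c x : ℝ) : ℂ)) ⊆ Metric.closedBall 0 2 := by
    refine (tsupport_comp_subset (g := fun t : ℝ => (t : ℂ)) Complex.ofReal_zero c).trans ?_
    exact c.tsupport_eq.le
  have hcc : ContDiff ℝ ∞ fun x => ((c x : ℝ) : ℂ) := Complex.ofRealCLM.contDiff.comp c.contDiff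
  have hccs : HasCompactSupport fun x => ((c x : ℝ) : ℂ) :=
    (isCompact_closedBall _ _).of_isClosed_subset (isClosed_tsupport _) hcs
  obtain ⟨K, hK⟩ := exists_scaled_bound hcc hccs hcs hμ₁ hμ₁c (by simp [μ₁, h0])
  have hfr : ∀ r : ℝ, ContDiff ℝ ∞ fun x : ℂ => ((c x : ℝ) : ℂ) * μ₁ (r • x) := fun r =>
    hcc.mul (hμ₁.comp (contDiff_const_smul r))
  have hsr : ∀ r : ℝ, tsupport (fun x : ℂ => ((c x : ℝ) : ℂ) * μ₁ (r • x)) ⊆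
      Metric.closedBall 0 2 := fun r => tsupport_mul_subset_left.trans hcs
  obtain ⟨r, hr, hlt⟩ := exists_integral_fourierInv_lt hfr hsr hK (c := 1 / 2) (by norm_num)
  have hcr : HasCompactSupport fun x : ℂ => ((c x : ℝ) : ℂ) * μ₁ (r • x) :=
    (isCompact_closedBall _ _).of_isClosed_subset (isClosed_tsupport _) (hsr r)
  let ν := hcr.toSchwartzMap (hfr r)
  refine ⟨r, hr, (𝓕⁻ ν : SchwartzMap ℂ ℂ), .of_schwartz _, ?_, ?_⟩
  · rw [SchwartzMap.fourierInv_coe]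
    exact hlt
  · rw [← SchwartzMap.fourier_coe, FourierTransform.fourier_fourierInv_eq]
    have h1 : ∀ᶠ x in 𝓝 (0 : ℂ), c x = 1 := c.eventuallyEq_one
    have h2 : ∀ᶠ x in 𝓝 (0 : ℂ), b (r • x) = 1 := by
      have : Tendsto (fun x : ℂ => r • x) (𝓝 0) (𝓝 0) := by
        simpa using (continuous_const_smul r).tendsto (0 : ℂ)
      exact this.eventually b.eventuallyEq_one
    filter_upwards [h1, h2] with x hx1 hx2
    change ((c x : ℝ) : ℂ) * ((b (r • x) : ℂ) * μ (r • x)) = _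
    rw [hx1, hx2]
    simp

/-! ### Conformal maps for a given frame -/

/-- Here Im(conj a · b) is the determinant of the real frame (a, b); L sends 1, i to a, b and M is
given by Cramer's rule. -/
theorem exists_real_linear_frame_inverse {a b : ℂ} (hab : (conj a * b).im ≠ 0) :
    ∃ L M : ℂ →L[ℝ] ℂ, (∀ z, L (M z) = z) ∧ M a = 1 ∧ M b = Complex.I := by
  set d := (conj a * b).im with hd
  have hd' : d = a.re * b.im - a.im * b.re := by simp [hd]; ring
  let L : ℂ →ₗ[ℝ] ℂ :=
    { toFun := fun z => (z.re : ℂ) * a + (z.im : ℂ) * b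
      map_add' := fun x y => by simp; ring
      map_smul' := fun c x => by simp; ring }
  let M : ℂ →ₗ[ℝ] ℂ :=
    { toFun := fun z => ⟨(z.re * b.im - z.im * b.re) / d, (a.re * z.im - a.im * z.re) / d⟩
      map_add' := fun x y => by apply Complex.ext <;> simp <;> ring
      map_smul' := fun c x => by apply Complex.ext <;> simp <;> ring }
  refine ⟨L.toContinuousLinearMap, M.toContinuousLinearMap, fun z => ?_, ?_, ?_⟩
  · apply Complex.ext
    · simp [L, M]
      field_simp
      rw [hd']
      ring
    · simp [L, M]
      field_simp
      rw [hd']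
      ring
  · apply Complex.ext
    · simp only [LinearMap.coe_toContinuousLinearMap', LinearMap.coe_mk, AddHom.coe_mk, M,
        Complex.one_re]
      rw [← hd', div_self hab]
    · simp [M]
      left; ring
  · apply Complex.ext
    · simp [M]
      left; ring
    · simp only [LinearMap.coe_toContinuousLinearMap', LinearMap.coe_mk, AddHom.coe_mk, M,
        Complex.I_im]
      rw [← hd', div_self hab]

/-- Local existence of a smooth map which is conformal for the metric with a given orthogonal frame
of vectors of equal length. -/
theorem exists_conformal_map {U : Set ℂ} (hU : IsOpen U) {x₀ : ℂ} (hx₀ : x₀ ∈ U) {e₁ e₂ : ℂ → ℂ}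
    (he₁ : ContDiffOn ℝ ∞ e₁ U) (he₂ : ContDiffOn ℝ ∞ e₂ U)
    (h : (conj (e₁ x₀) * e₂ x₀).im ≠ 0) :
    ∃ w : ℂ → ℂ, ContDiff ℝ ∞ w ∧ ∀ᶠ x in 𝓝 x₀, fderiv ℝ w x (e₁ x) ≠ 0 ∧
      fderiv ℝ w x (e₂ x) = Complex.I * fderiv ℝ w x (e₁ x) := by
  obtain ⟨L, M, hLM, hM1, hM2⟩ := exists_real_linear_frame_inverse h
  let ψ : ℂ → ℂ := fun y => x₀ + L y
  have hψ : ContDiff ℝ ∞ ψ := contDiff_const.add L.contDiff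
  have hψ0 : ψ 0 = x₀ := by simp [ψ]
  let ζ₁ : ℂ → ℂ := fun y => M (e₁ (ψ y))
  let ζ₂ : ℂ → ℂ := fun y => M (e₂ (ψ y))
  have hV : IsOpen (ψ ⁻¹' U) := hU.preimage hψ.continuous
  have hζ₁ : ContDiffOn ℝ ∞ ζ₁ (ψ ⁻¹' U) :=
    M.contDiff.comp_contDiffOn (he₁.comp hψ.contDiffOn fun _ h => h)
  have hζ₂ : ContDiffOn ℝ ∞ ζ₂ (ψ ⁻¹' U) :=
    M.contDiff.comp_contDiffOn (he₂.comp hψ.contDiffOn fun _ h => h)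
  have hz1 : ζ₁ 0 = 1 := by simp only [ζ₁, hψ0, hM1]
  have hz2 : ζ₂ 0 = Complex.I := by simp only [ζ₂, hψ0, hM2]
  let q : ℂ → ℂ := fun y => conj (ζ₁ y) + Complex.I * conj (ζ₂ y)
  have hconj : ContDiff ℝ ∞ (fun z : ℂ => conj z) := Complex.conjCLE.contDiff
  have hq : ContDiffOn ℝ ∞ q (ψ ⁻¹' U) :=
    (hconj.comp_contDiffOn hζ₁).add (contDiffOn_const.mul (hconj.comp_contDiffOn hζ₂))
  have hq0 : q 0 ≠ 0 := by simp [q, hz1, hz2]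
  let W := ψ ⁻¹' U ∩ q ⁻¹' {0}ᶜ
  have hW : IsOpen W := hq.continuousOn.isOpen_inter_preimage hV isOpen_compl_singleton
  have h0W : (0 : ℂ) ∈ W := ⟨by simpa [ψ] using hx₀, hq0⟩
  -- Solving ζ₂ + μ conj ζ₂ = i(ζ₁ + μ conj ζ₁) for μ. The frame at the base point was normalized to
  -- (1, i), so μ vanishes at 0, as the localization requires.
  let μ : ℂ → ℂ := fun y => -(ζ₁ y + Complex.I * ζ₂ y) / q y
  have hμ : ContDiffOn ℝ ∞ μ W := by
    have hn : ContDiffOn ℝ ∞ (fun y => -(ζ₁ y + Complex.I * ζ₂ y)) W :=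
      ((hζ₁.add (contDiffOn_const.mul hζ₂)).neg).mono Set.inter_subset_left
    have hi : ContDiffOn ℝ ∞ (fun y => (q y)⁻¹) W :=
      (hq.mono Set.inter_subset_left).inv fun y hy => hy.2
    simpa only [μ, div_eq_mul_inv] using hn.mul hi
  obtain ⟨r, hr, G, hG, hlt, hGμ⟩ := exists_small_localization hW h0W hμ (by simp [μ, hz1, hz2])
  obtain ⟨w, s, hw, hs, hdw⟩ := exists_beltrami_solution hG hlt
  -- Chosen so that ψ(r T x) = x: it undoes both the linear normalization and the rescaling.
  let T : ℂ → ℂ := fun x => r⁻¹ • M (x - x₀)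
  have hT : ContDiff ℝ ∞ T := (M.contDiff.comp (contDiff_id.sub contDiff_const)).const_smul _
  have hTd : ∀ x, HasFDerivAt T (r⁻¹ • M) x := fun x => by
    have := (M.hasFDerivAt.comp x ((hasFDerivAt_id x).sub_const x₀)).const_smul r⁻¹
    simpa using! this
  have hT0 : T x₀ = 0 := by simp [T]
  have hcomp : ContDiff ℝ ∞ (w ∘ T) := hw.comp hT
  have hfd : ∀ x v, fderiv ℝ (w ∘ T) x v = (1 + s (T x)) *
      (r⁻¹ • M v + 𝓕 G (T x) * conj (r⁻¹ • M v)) := fun x v => by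
    have := (((hw.differentiable (by simp)) (T x)).hasFDerivAt.comp x (hTd x)).fderiv
    rw [this]
    simp only [ContinuousLinearMap.comp_apply, smul_apply, hdw]
  have hTt : Tendsto T (𝓝 x₀) (𝓝 0) := by
    have := hT.continuous.tendsto x₀
    rwa [hT0] at this
  have hrT : ∀ x, ψ (r • T x) = x := fun x => by
    simp only [ψ, T, smul_inv_smul₀ hr.ne', hLM, add_sub_cancel]
  have hev : ∀ᶠ x in 𝓝 x₀, 𝓕 G (T x) = μ (r • T x) := hTt.eventually hGμ
  refine ⟨w ∘ T, hcomp, ?_⟩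
  have hcont : ContinuousAt (fun x => fderiv ℝ (w ∘ T) x (e₁ x)) x₀ :=
    (hcomp.continuous_fderiv (by simp)).continuousAt.clm_apply
      (he₁.continuousOn.continuousAt (hU.mem_nhds hx₀))
  have hne0 : fderiv ℝ (w ∘ T) x₀ (e₁ x₀) ≠ 0 := by
    rw [hfd, hev.self_of_nhds, hT0, hM1]
    have : μ 0 = 0 := by simp [μ, hz1, hz2]
    rw [smul_zero, this]
    have := hs 0
    simp [this, hr.ne']
  have hWev : ∀ᶠ x in 𝓝 x₀, r • T x ∈ W := by
    have : Tendsto (fun x => r • T x) (𝓝 x₀) (𝓝 0) := by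
      simpa using hTt.const_smul r
    exact this (hW.mem_nhds h0W)
  filter_upwards [hcont.eventually_ne hne0, hev, hWev] with x hx1 hx2 hx3
  refine ⟨hx1, ?_⟩
  rw [hfd, hfd, hx2]
  have e1 : M (e₁ x) = ζ₁ (r • T x) := by simp only [ζ₁, hrT]
  have e2 : M (e₂ x) = ζ₂ (r • T x) := by simp only [ζ₂, hrT]
  rw [e1, e2]
  generalize r • T x = y at *
  have hμq : μ y * q y = -(ζ₁ y + Complex.I * ζ₂ y) := div_mul_cancel₀ _ hx3.2
  simp only [q] at hμq
  simp only [Complex.real_smul, map_mul, Complex.conj_ofReal]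
  linear_combination (-Complex.I * (1 + s (T x)) * ((r⁻¹ : ℝ) : ℂ)) * hμq +
    ((1 + s (T x)) * ((r⁻¹ : ℝ) : ℂ)) * (ζ₂ y + μ y * conj (ζ₂ y)) * Complex.I_mul_I

end Beltrami

noncomputable section

namespace SurfaceGeometry

set_option linter.unusedSectionVars false

open Filter Topology

/-! ### Components, coordinate fields and derivatives in a chart -/

section ChartCalculus

variable {m : ℕ} {M : Type*} [TopologicalSpace M] [ChartedSpace (EuclideanSpace ℝ (Fin m)) M]
  [IsManifold (𝓡 m) ∞ M]
  {c : OpenPartialHomeomorph M (EuclideanSpace ℝ (Fin m))} {x : M}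

theorem mdifferentiable_of_mem_maximalAtlas (hc : c ∈ IsManifold.maximalAtlas (𝓡 m) ∞ M) :
    c.MDifferentiable (𝓡 m) (𝓡 m) :=
  ⟨(contMDiffOn_of_mem_maximalAtlas hc).mdifferentiableOn (by simp),
    (contMDiffOn_symm_of_mem_maximalAtlas hc).mdifferentiableOn (by simp)⟩

theorem mvfderiv_eq_mfderiv (hc : c ∈ IsManifold.maximalAtlas (𝓡 m) ∞ M) (hx : x ∈ c.source) :
    mvfderiv (𝓡 m) (fun y => c y) x =
      ((mdifferentiable_of_mem_maximalAtlas hc).mfderiv hx : TangentSpace (𝓡 m) x →L[ℝ]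
        TangentSpace (𝓡 m) (c x)) := rfl

theorem comp_add (u v : TangentSpace (𝓡 m) x) : comp c x (u + v) = comp c x u + comp c x v :=
  map_add _ _ _

theorem comp_sub (u v : TangentSpace (𝓡 m) x) : comp c x (u - v) = comp c x u - comp c x v :=
  map_sub _ _ _

theorem comp_smul (r : ℝ) (v : TangentSpace (𝓡 m) x) : comp c x (r • v) = r • comp c x v :=
  map_smul _ _ _

theorem comp_sum {ι : Type*} (s : Finset ι) (v : ι → TangentSpace (𝓡 m) x) :
    comp c x (∑ i ∈ s, v i) = ∑ i ∈ s, comp c x (v i) :=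
  map_sum (mvfderiv (𝓡 m) (fun y => c y) x) _ _

theorem vecOfComp_smul (r : ℝ) (a : EuclideanSpace ℝ (Fin m)) :
    vecOfComp c x (r • a) = r • vecOfComp c x a :=
  map_smul _ _ _

theorem vecOfComp_eq_sum (a : EuclideanSpace ℝ (Fin m)) :
    vecOfComp c x a = ∑ i, a i • coordVec c i x := by
  have h : a = ∑ i, a i • EuclideanSpace.single i (1 : ℝ) := by
    ext j
    simp [Finset.sum_apply, Pi.single_apply]
  conv_lhs => rw [h]
  exact (map_sum (mvfderiv (𝓡 m) (fun y => c y) x).inverse _ _).trans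
    (Finset.sum_congr rfl fun i _ => vecOfComp_smul _ _)

theorem comp_vecOfComp (hc : c ∈ IsManifold.maximalAtlas (𝓡 m) ∞ M) (hx : x ∈ c.source)
    (a : EuclideanSpace ℝ (Fin m)) : comp c x (vecOfComp c x a) = a := by
  have h := ContinuousLinearMap.inverse_equiv ((mdifferentiable_of_mem_maximalAtlas hc).mfderiv hx)
  unfold comp vecOfComp
  rw [mvfderiv_eq_mfderiv hc hx]
  erw [h]
  exact ((mdifferentiable_of_mem_maximalAtlas hc).mfderiv hx).apply_symm_apply a

theorem vecOfComp_comp (hc : c ∈ IsManifold.maximalAtlas (𝓡 m) ∞ M) (hx : x ∈ c.source)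
    (v : TangentSpace (𝓡 m) x) : vecOfComp c x (comp c x v) = v := by
  have h := ContinuousLinearMap.inverse_equiv ((mdifferentiable_of_mem_maximalAtlas hc).mfderiv hx)
  unfold comp vecOfComp
  rw [mvfderiv_eq_mfderiv hc hx]
  erw [h]
  exact ((mdifferentiable_of_mem_maximalAtlas hc).mfderiv hx).symm_apply_apply v

theorem comp_coordVec (hc : c ∈ IsManifold.maximalAtlas (𝓡 m) ∞ M) (hx : x ∈ c.source) (i : Fin m) :
    comp c x (coordVec c i x) = EuclideanSpace.single i 1 :=
  comp_vecOfComp hc hx _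

theorem sum_comp_smul_coordVec (hc : c ∈ IsManifold.maximalAtlas (𝓡 m) ∞ M) (hx : x ∈ c.source)
    (v : TangentSpace (𝓡 m) x) : ∑ i, comp c x v i • coordVec c i x = v := by
  rw [← vecOfComp_eq_sum, vecOfComp_comp hc hx]

theorem comp_injective (hc : c ∈ IsManifold.maximalAtlas (𝓡 m) ∞ M) (hx : x ∈ c.source)
    {u v : TangentSpace (𝓡 m) x} (h : ∀ i, comp c x u i = comp c x v i) : u = v := by
  rw [← sum_comp_smul_coordVec hc hx u, ← sum_comp_smul_coordVec hc hx v]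
  simp only [h]

/-- The derivative of a function in the direction of a coordinate vector field. -/
def coordDeriv (c : OpenPartialHomeomorph M (EuclideanSpace ℝ (Fin m))) (i : Fin m) (f : M → ℝ)
    (x : M) : ℝ :=
  mvfderiv (𝓡 m) f x (coordVec c i x)

theorem mvfderiv_eq_sum (hc : c ∈ IsManifold.maximalAtlas (𝓡 m) ∞ M) (hx : x ∈ c.source)
    (f : M → ℝ) (v : TangentSpace (𝓡 m) x) :
    mvfderiv (𝓡 m) f x v = ∑ i, comp c x v i * coordDeriv c i f x := by
  conv_lhs => rw [← sum_comp_smul_coordVec hc hx v]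
  rw [map_sum]
  simp [coordDeriv]

theorem contDiffAt_comp_symm {F : Type*} [NormedAddCommGroup F] [NormedSpace ℝ F]
    (hc : c ∈ IsManifold.maximalAtlas (𝓡 m) ∞ M) (hx : x ∈ c.source)
    {f : M → F} (hf : ContMDiffAt (𝓡 m) 𝓘(ℝ, F) ∞ f x) : ContDiffAt ℝ ∞ (f ∘ c.symm) (c x) := by
  rw [← contMDiffAt_iff_contDiffAt]
  exact ContMDiffAt.comp_of_eq hf
    (contMDiffAt_symm_of_mem_maximalAtlas hc (c.map_source hx)) (c.left_inv hx)

theorem contMDiffAt_of_comp_symm {F : Type*} [NormedAddCommGroup F] [NormedSpace ℝ F]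
    (hc : c ∈ IsManifold.maximalAtlas (𝓡 m) ∞ M) (hx : x ∈ c.source)
    {f : M → F} (hf : ContDiffAt ℝ ∞ (f ∘ c.symm) (c x)) : ContMDiffAt (𝓡 m) 𝓘(ℝ, F) ∞ f x := by
  have h := ContMDiffAt.comp x (contMDiffAt_iff_contDiffAt.2 hf)
    (contMDiffAt_of_mem_maximalAtlas hc hx)
  refine h.congr_of_eventuallyEq ?_
  filter_upwards [c.open_source.mem_nhds hx] with y hy
  simp [c.left_inv hy]

theorem mvfderiv_eq_fderiv {F : Type*} [NormedAddCommGroup F] [NormedSpace ℝ F]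
    (hc : c ∈ IsManifold.maximalAtlas (𝓡 m) ∞ M) (hx : x ∈ c.source)
    {f : M → F} (hf : MDifferentiableAt (𝓡 m) 𝓘(ℝ, F) f x) (v : TangentSpace (𝓡 m) x) :
    mvfderiv (𝓡 m) f x v = fderiv ℝ (f ∘ c.symm) (c x) (comp c x v) := by
  have hcs := (contMDiffAt_symm_of_mem_maximalAtlas hc (c.map_source hx)).mdifferentiableAt (by simp)
  have hd : MDifferentiableAt (𝓡 m) 𝓘(ℝ, F) (f ∘ c.symm) (c x) :=
    MDifferentiableAt.comp_of_eq _ hf hcs (c.left_inv hx)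
  have hcd : MDifferentiableAt (𝓡 m) (𝓡 m) (fun y => c y) x :=
    (contMDiffAt_of_mem_maximalAtlas hc hx).mdifferentiableAt (by simp)
  have he : f =ᶠ[𝓝 x] (f ∘ c.symm) ∘ (fun y => c y) := by
    filter_upwards [c.open_source.mem_nhds hx] with y hy
    simp [c.left_inv hy]
  have h1 : mfderiv (𝓡 m) 𝓘(ℝ, F) f x =
      (mfderiv (𝓡 m) 𝓘(ℝ, F) (f ∘ c.symm) (c x)).comp (mfderiv (𝓡 m) (𝓡 m) (fun y => c y) x) := by
    rw [he.mfderiv_eq]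
    exact mfderiv_comp x hd hcd
  unfold mvfderiv comp
  rw [h1, mfderiv_eq_fderiv]
  rfl

theorem coordDeriv_eq_fderiv (hc : c ∈ IsManifold.maximalAtlas (𝓡 m) ∞ M) (hx : x ∈ c.source)
    {f : M → ℝ} (hf : MDifferentiableAt (𝓡 m) 𝓘(ℝ, ℝ) f x) (i : Fin m) :
    coordDeriv c i f x = fderiv ℝ (f ∘ c.symm) (c x) (EuclideanSpace.single i 1) := by
  rw [coordDeriv, mvfderiv_eq_fderiv hc hx hf, comp_coordVec hc hx]

theorem eventually_mdifferentiableAt {F : Type*} [NormedAddCommGroup F] [NormedSpace ℝ F]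
    {f : M → F} (hf : ContMDiffAt (𝓡 m) 𝓘(ℝ, F) ∞ f x) :
    ∀ᶠ y in 𝓝 x, MDifferentiableAt (𝓡 m) 𝓘(ℝ, F) f y := by
  have : IsManifold (𝓡 m) 1 M := IsManifold.of_le (n := ∞) (by simp)
  have h1 : ContMDiffAt (𝓡 m) 𝓘(ℝ, F) 1 f x := hf.of_le (by simp)
  exact ((contMDiffAt_iff_contMDiffAt_nhds (by simp)).1 h1).mono fun y hy => hy.mdifferentiableAt (by simp)

theorem eventually_coordDeriv_comp_symm
    (hc : c ∈ IsManifold.maximalAtlas (𝓡 m) ∞ M) (hx : x ∈ c.source) {f : M → ℝ}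
    (hf : ContMDiffAt (𝓡 m) 𝓘(ℝ, ℝ) ∞ f x) (i : Fin m) :
    coordDeriv c i f ∘ c.symm =ᶠ[𝓝 (c x)]
      fun u => fderiv ℝ (f ∘ c.symm) u (EuclideanSpace.single i 1) := by
  have ht : Tendsto c.symm (𝓝 (c x)) (𝓝 x) := by
    have := c.tendsto_symm (x := x) hx
    exact this
  filter_upwards [ht.eventually (eventually_mdifferentiableAt hf),
    c.open_target.mem_nhds (c.map_source hx)] with u hu hu'
  have := coordDeriv_eq_fderiv hc (c.map_target hu') hu i
  simpa [c.right_inv hu'] using this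

theorem contMDiffAt_coordDeriv
    (hc : c ∈ IsManifold.maximalAtlas (𝓡 m) ∞ M) (hx : x ∈ c.source) {f : M → ℝ}
    (hf : ContMDiffAt (𝓡 m) 𝓘(ℝ, ℝ) ∞ f x) (i : Fin m) :
    ContMDiffAt (𝓡 m) 𝓘(ℝ, ℝ) ∞ (coordDeriv c i f) x := by
  refine contMDiffAt_of_comp_symm hc hx ?_
  have h1 := contDiffAt_comp_symm hc hx hf
  have h2 : ContDiffAt ℝ ∞ (fderiv ℝ (f ∘ c.symm)) (c x) := h1.fderiv_right (by simp)
  exact (h2.clm_apply contDiffAt_const).congr_of_eventuallyEq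
    (eventually_coordDeriv_comp_symm hc hx hf i)

/-- Read in the chart, this is the symmetry of the second derivative. Vanishing of torsion is
derived from it. -/
theorem coordDeriv_comm
    (hc : c ∈ IsManifold.maximalAtlas (𝓡 m) ∞ M) (hx : x ∈ c.source) {f : M → ℝ}
    (hf : ContMDiffAt (𝓡 m) 𝓘(ℝ, ℝ) ∞ f x) (i j : Fin m) :
    coordDeriv c i (coordDeriv c j f) x = coordDeriv c j (coordDeriv c i f) x := by
  have h1 := contDiffAt_comp_symm hc hx hf
  have h2 : ContDiffAt ℝ ∞ (fderiv ℝ (f ∘ c.symm)) (c x) := h1.fderiv_right (by simp)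
  have key : ∀ i j, coordDeriv c i (coordDeriv c j f) x =
      fderiv ℝ (fderiv ℝ (f ∘ c.symm)) (c x) (EuclideanSpace.single i 1)
        (EuclideanSpace.single j 1) := by
    intro i j
    rw [coordDeriv_eq_fderiv hc hx
      ((contMDiffAt_coordDeriv hc hx hf j).mdifferentiableAt (by simp)),
      (eventually_coordDeriv_comp_symm hc hx hf j).fderiv_eq,
      fderiv_clm_apply (h2.differentiableAt (by simp)) (differentiableAt_const _)]
    simp
  rw [key, key]
  have hs : IsSymmSndFDerivAt ℝ (f ∘ c.symm) (c x) :=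
    ContDiffAt.isSymmSndFDerivAt h1 (by
      rw [minSmoothness_of_isRCLikeNormedField]; exact ENat.LEInfty.out)
  exact hs _ _

theorem contMDiffAt_chart_apply (hc : c ∈ IsManifold.maximalAtlas (𝓡 m) ∞ M) (hx : x ∈ c.source)
    (i : Fin m) : ContMDiffAt (𝓡 m) 𝓘(ℝ, ℝ) ∞ (fun y => c y i) x := by
  have h : ContMDiffAt (𝓡 m) (𝓡 m) ∞ (fun y => c y) x := contMDiffAt_of_mem_maximalAtlas hc hx
  exact ContMDiffAt.comp x (g := fun u : EuclideanSpace ℝ (Fin m) => u i)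
    (contMDiffAt_iff_contDiffAt.2 (contDiffAt_piLp_apply 2)) h

theorem comp_symm_mfderiv (hc : c ∈ IsManifold.maximalAtlas (𝓡 m) ∞ M)
    {u : EuclideanSpace ℝ (Fin m)} (hu : u ∈ c.target) (a : EuclideanSpace ℝ (Fin m)) :
    vecOfComp c (c.symm u) a = mfderiv (𝓡 m) (𝓡 m) c.symm u a := by
  have h := (mdifferentiable_of_mem_maximalAtlas hc).comp_symm_deriv hu
  have h2 : comp c (c.symm u) (mfderiv (𝓡 m) (𝓡 m) c.symm u a) = a :=
    DFunLike.congr_fun h a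
  rw [← vecOfComp_comp hc (c.map_target hu) (mfderiv (𝓡 m) (𝓡 m) c.symm u a), h2]

/-- A field with constant components is the image of a constant field under the tangent map of
`c.symm`, which is smooth. -/
theorem contMDiffAt_vecOfComp (hc : c ∈ IsManifold.maximalAtlas (𝓡 m) ∞ M)
    (hx : x ∈ c.source) (a : EuclideanSpace ℝ (Fin m)) :
    ContMDiffAt (𝓡 m) (𝓡 m).tangent ∞
      (fun y => (⟨y, vecOfComp c y a⟩ : TangentBundle (𝓡 m) M)) x := by
  have h1 := (contMDiffOn_symm_of_mem_maximalAtlas hc).contMDiffOn_tangentMapWithin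
    (m := ∞) (by simp) c.open_target.uniqueMDiffOn
  have h2 : ContMDiffAt (𝓡 m) (𝓡 m).tangent ∞
      (fun y => (⟨c y, a⟩ : TangentBundle (𝓡 m) (EuclideanSpace ℝ (Fin m)))) x := by
    have h5 : ContMDiffAt (𝓡 m) (𝓡 m).tangent ∞
        (fun u => (⟨u, a⟩ : TangentBundle (𝓡 m) (EuclideanSpace ℝ (Fin m)))) (c x) :=
      contMDiffAt_vectorSpace_iff_contDiffAt.2 contDiffAt_const
    exact h5.comp x (contMDiffAt_of_mem_maximalAtlas hc hx)
  have h3 := (h1.contMDiffAt (x := (⟨c x, a⟩ : TangentBundle (𝓡 m) (EuclideanSpace ℝ (Fin m))))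
    ((FiberBundle.continuous_proj _ _).continuousAt.preimage_mem_nhds
      (c.open_target.mem_nhds (c.map_source hx)))).comp x h2
  refine h3.congr_of_eventuallyEq ?_
  filter_upwards [c.open_source.mem_nhds hx] with y hy
  have hu := c.map_source hy
  have h4 : (⟨c.symm (c y), vecOfComp c (c.symm (c y)) a⟩ : TangentBundle (𝓡 m) M) =
      ⟨y, vecOfComp c y a⟩ := by rw [c.left_inv hy]
  rw [← h4, comp_symm_mfderiv hc hu]
  simp only [Function.comp, tangentMapWithin]
  rw [mfderivWithin_of_isOpen c.open_target hu]

end ChartCalculus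

/-! ### The Gram matrix and the Christoffel symbols -/

section Metric

variable {m : ℕ} {M : Type*} [TopologicalSpace M] [ChartedSpace (EuclideanSpace ℝ (Fin m)) M]
  [IsManifold (𝓡 m) ∞ M]
  [Bundle.RiemannianBundle (fun x : M => TangentSpace (𝓡 m) x)]
  [IsContMDiffRiemannianBundle (𝓡 m) ∞ (EuclideanSpace ℝ (Fin m))
      (fun x : M => TangentSpace (𝓡 m) x)]
  {c : OpenPartialHomeomorph M (EuclideanSpace ℝ (Fin m))} {x : M}

theorem contMDiffAt_gram (hc : c ∈ IsManifold.maximalAtlas (𝓡 m) ∞ M) (hx : x ∈ c.source)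
    (i j : Fin m) : ContMDiffAt (𝓡 m) 𝓘(ℝ, ℝ) ∞ (fun y => gram c y i j) x :=
  ContMDiffAt.inner_bundle (contMDiffAt_vecOfComp hc hx _) (contMDiffAt_vecOfComp hc hx _)

theorem gram_comm (i j : Fin m) : gram c x i j = gram c x j i :=
  real_inner_comm (coordVec c j x) (coordVec c i x)

theorem inner_eq_sum (hc : c ∈ IsManifold.maximalAtlas (𝓡 m) ∞ M) (hx : x ∈ c.source)
    (u v : TangentSpace (𝓡 m) x) :
    inner ℝ u v = ∑ i, ∑ j, comp c x u i * comp c x v j * gram c x i j := by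
  conv_lhs => rw [← sum_comp_smul_coordVec hc hx u, ← sum_comp_smul_coordVec hc hx v]
  rw [sum_inner]
  refine Finset.sum_congr rfl fun i _ => ?_
  rw [inner_sum]
  refine Finset.sum_congr rfl fun j _ => ?_
  rw [real_inner_smul_left, real_inner_smul_right, mul_assoc]
  rfl

/-- A kernel vector of the Gram matrix would be the components of a tangent vector of length zero.
-/
theorem gram_det_ne_zero (hc : c ∈ IsManifold.maximalAtlas (𝓡 m) ∞ M) (hx : x ∈ c.source) :
    (gram c x).det ≠ 0 := by
  intro h
  obtain ⟨a, ha, h0⟩ := Matrix.exists_mulVec_eq_zero_iff.2 h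
  have h1 : comp c x (vecOfComp c x (WithLp.toLp 2 a)) = WithLp.toLp 2 a := comp_vecOfComp hc hx _
  have h2 : inner ℝ (vecOfComp c x (WithLp.toLp 2 a)) (vecOfComp c x (WithLp.toLp 2 a)) = 0 := by
    rw [inner_eq_sum hc hx, h1]
    refine Finset.sum_eq_zero fun i _ => ?_
    have := congrFun h0 i
    simp only [Matrix.mulVec, dotProduct, Pi.zero_apply] at this
    simp_rw [mul_assoc, ← Finset.mul_sum]
    rw [mul_eq_zero]
    right
    rw [← this]
    exact Finset.sum_congr rfl fun j _ => mul_comm _ _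
  rw [inner_self_eq_zero.1 h2] at h1
  have h3 : comp c x (0 : TangentSpace (𝓡 m) x) = 0 := map_zero (mvfderiv (𝓡 m) (fun y => c y) x)
  rw [h3] at h1
  exact ha (funext fun i => (congrArg (fun z : EuclideanSpace ℝ (Fin m) => z i) h1).symm)

theorem sum_gram_inv_mul (hc : c ∈ IsManifold.maximalAtlas (𝓡 m) ∞ M) (hx : x ∈ c.source)
    (i j : Fin m) : ∑ k, gram c x i k * (gram c x)⁻¹ k j = if i = j then 1 else 0 := by
  have h := Matrix.mul_nonsing_inv (gram c x) (isUnit_iff_ne_zero.2 (gram_det_ne_zero hc hx))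
  have := congrFun (congrFun h i) j
  rwa [Matrix.mul_apply, Matrix.one_apply] at this

theorem contMDiffAt_det {ι : Type*} [Fintype ι] [DecidableEq ι] {A : M → Matrix ι ι ℝ}
    (hA : ∀ i j, ContMDiffAt (𝓡 m) 𝓘(ℝ, ℝ) ∞ (fun y => A y i j) x) :
    ContMDiffAt (𝓡 m) 𝓘(ℝ, ℝ) ∞ (fun y => (A y).det) x := by
  simp only [Matrix.det_apply']
  refine contMDiffAt_finsetSum fun σ _ => ?_
  exact contMDiffAt_const.mul (contMDiffAt_finsetProd fun i _ => hA _ _)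

theorem contMDiffAt_matrix_inv {ι : Type*} [Fintype ι] [DecidableEq ι] {A : M → Matrix ι ι ℝ}
    (hA : ∀ i j, ContMDiffAt (𝓡 m) 𝓘(ℝ, ℝ) ∞ (fun y => A y i j) x) (h0 : (A x).det ≠ 0) (i j : ι) :
    ContMDiffAt (𝓡 m) 𝓘(ℝ, ℝ) ∞ (fun y => (A y)⁻¹ i j) x := by
  simp only [Matrix.inv_def, Matrix.smul_apply, Ring.inverse_eq_inv', smul_eq_mul,
    Matrix.adjugate_apply]
  refine ContMDiffAt.mul ((contMDiffAt_det hA).inv₀ h0) (contMDiffAt_det fun k l => ?_)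
  by_cases h : k = j
  · subst h
    simpa using contMDiffAt_const
  · simpa [Matrix.updateRow_ne h] using hA k l

theorem contMDiffAt_gram_inv (hc : c ∈ IsManifold.maximalAtlas (𝓡 m) ∞ M) (hx : x ∈ c.source)
    (i j : Fin m) : ContMDiffAt (𝓡 m) 𝓘(ℝ, ℝ) ∞ (fun y => (gram c y)⁻¹ i j) x :=
  contMDiffAt_matrix_inv (contMDiffAt_gram hc hx) (gram_det_ne_zero hc hx) i j

theorem dGram_eq_coordDeriv (k i j : Fin m) :
    dGram c x k i j = coordDeriv c k (fun y => gram c y i j) x := rfl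

theorem dGram_comm (k i j : Fin m) : dGram c x k i j = dGram c x k j i := by
  simp only [dGram_eq_coordDeriv, gram_comm (c := c) i j]

theorem contMDiffAt_christoffel (hc : c ∈ IsManifold.maximalAtlas (𝓡 m) ∞ M) (hx : x ∈ c.source)
    (k i j : Fin m) : ContMDiffAt (𝓡 m) 𝓘(ℝ, ℝ) ∞ (fun y => christoffel c y k i j) x := by
  simp only [christoffel, dGram_eq_coordDeriv]
  refine contMDiffAt_const.mul (contMDiffAt_finsetSum fun l _ => ?_)
  have h := fun k i j => contMDiffAt_coordDeriv hc hx (contMDiffAt_gram hc hx i j) k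
  exact (contMDiffAt_gram_inv hc hx k l).mul (((h i j l).add (h j i l)).sub (h l i j))

theorem christoffel_comm (k i j : Fin m) : christoffel c x k i j = christoffel c x k j i := by
  unfold christoffel
  congr 1
  refine Finset.sum_congr rfl fun l _ => ?_
  rw [dGram_comm l i j, add_comm (dGram c x i j l)]

theorem sum_christoffel_mul_gram (hc : c ∈ IsManifold.maximalAtlas (𝓡 m) ∞ M) (hx : x ∈ c.source)
    (i j l : Fin m) : ∑ k, christoffel c x k i j * gram c x k l =
      (1 / 2 : ℝ) * (dGram c x i j l + dGram c x j i l - dGram c x l i j) := by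
  set K : Fin m → ℝ := fun l => dGram c x i j l + dGram c x j i l - dGram c x l i j with hK
  have h1 : ∀ k, christoffel c x k i j = (1 / 2 : ℝ) * ∑ l, (gram c x)⁻¹ k l * K l := fun k => rfl
  calc ∑ k, christoffel c x k i j * gram c x k l
      = ∑ k, ∑ p, (1 / 2 : ℝ) * K p * (gram c x l k * (gram c x)⁻¹ k p) := by
        refine Finset.sum_congr rfl fun k _ => ?_
        rw [h1, mul_assoc, Finset.sum_mul, Finset.mul_sum]
        refine Finset.sum_congr rfl fun p _ => ?_
        rw [gram_comm l k]
        ring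
    _ = ∑ p, (1 / 2 : ℝ) * K p * ∑ k, (gram c x l k * (gram c x)⁻¹ k p) := by
        rw [Finset.sum_comm]
        simp_rw [Finset.mul_sum]
    _ = _ := by
        simp only [sum_gram_inv_mul hc hx]
        simp [hK]

/-- Metric compatibility in coordinates: in the sum of the two lowered Christoffel symbols all
derivatives of the metric except ∂_i g_{jl} cancel. -/
theorem dGram_eq_sum (hc : c ∈ IsManifold.maximalAtlas (𝓡 m) ∞ M) (hx : x ∈ c.source)
    (i j l : Fin m) : dGram c x i j l = ∑ k, christoffel c x k i j * gram c x k l +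
      ∑ k, christoffel c x k i l * gram c x j k := by
  simp_rw [gram_comm (c := c) j]
  rw [sum_christoffel_mul_gram hc hx, sum_christoffel_mul_gram hc hx, dGram_comm i l j,
    dGram_comm l i j]
  ring

end Metric

/-! ### Vector fields along a map -/

section Along

variable {m n : ℕ} {M N : Type*}
  [TopologicalSpace M] [ChartedSpace (EuclideanSpace ℝ (Fin m)) M] [IsManifold (𝓡 m) ∞ M]
  [TopologicalSpace N] [ChartedSpace (EuclideanSpace ℝ (Fin n)) N] [IsManifold (𝓡 n) ∞ N]

/-- Smoothness at `x` of a vector field along `φ`, in a chart `d` around `φ x`. -/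
def SmoothAlong (m : ℕ) {n : ℕ} {M N : Type*} [TopologicalSpace M]
    [ChartedSpace (EuclideanSpace ℝ (Fin m)) M] [TopologicalSpace N]
    [ChartedSpace (EuclideanSpace ℝ (Fin n)) N]
    (d : OpenPartialHomeomorph N (EuclideanSpace ℝ (Fin n))) (φ : M → N)
    (W : ∀ x : M, TangentSpace (𝓡 n) (φ x)) (x : M) : Prop :=
  ∀ a, ContMDiffAt (𝓡 m) 𝓘(ℝ, ℝ) ∞ (fun y => comp d (φ y) (W y) a) x

variable {c : OpenPartialHomeomorph M (EuclideanSpace ℝ (Fin m))}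
  {d d' : OpenPartialHomeomorph N (EuclideanSpace ℝ (Fin n))} {φ : M → N}
  {W Z : ∀ x : M, TangentSpace (𝓡 n) (φ x)} {x : M}

theorem eventually_mem_source (hφ : ContMDiffAt (𝓡 m) (𝓡 n) ∞ φ x) (hx : φ x ∈ d.source) :
    ∀ᶠ y in 𝓝 x, φ y ∈ d.source :=
  hφ.continuousAt.eventually (d.open_source.mem_nhds hx)

theorem SmoothAlong.congr (h : SmoothAlong m d φ W x) (he : ∀ᶠ y in 𝓝 x, Z y = W y) :
    SmoothAlong m d φ Z x := fun a =>
  (h a).congr_of_eventuallyEq (he.mono fun y hy => by simp only [hy])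

theorem SmoothAlong.add (hW : SmoothAlong m d φ W x) (hZ : SmoothAlong m d φ Z x) :
    SmoothAlong m d φ (fun y => W y + Z y) x := fun a => by
  simp only [comp_add]
  exact (hW a).add (hZ a)

theorem SmoothAlong.smul {f : M → ℝ} (hf : ContMDiffAt (𝓡 m) 𝓘(ℝ, ℝ) ∞ f x)
    (hW : SmoothAlong m d φ W x) : SmoothAlong m d φ (fun y => f y • W y) x := fun a => by
  simp only [comp_smul]
  exact hf.mul (hW a)

theorem SmoothAlong.sum_smul {ι : Type*} {s : Finset ι} {f : ι → M → ℝ}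
    {V : ι → ∀ x : M, TangentSpace (𝓡 n) (φ x)}
    (hf : ∀ i ∈ s, ContMDiffAt (𝓡 m) 𝓘(ℝ, ℝ) ∞ (f i) x)
    (hV : ∀ i ∈ s, SmoothAlong m d φ (V i) x) :
    SmoothAlong m d φ (fun y => ∑ i ∈ s, f i y • V i y) x := fun a => by
  have h : ContMDiffAt (𝓡 m) 𝓘(ℝ, ℝ) ∞ (fun y => ∑ i ∈ s, f i y * comp d (φ y) (V i y) a) x :=
    contMDiffAt_finsetSum fun i hi => (hf i hi).mul (hV i hi a)
  simpa [comp_sum, comp_smul] using h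

theorem smoothAlong_coordVec (hφ : ContMDiffAt (𝓡 m) (𝓡 n) ∞ φ x)
    (hd : d ∈ IsManifold.maximalAtlas (𝓡 n) ∞ N) (hx : φ x ∈ d.source) (a : Fin n) :
    SmoothAlong m d φ (fun y => coordVec d a (φ y)) x := fun b => by
  refine (contMDiffAt_const (c := (EuclideanSpace.single a (1 : ℝ)) b)).congr_of_eventuallyEq ?_
  filter_upwards [eventually_mem_source hφ hx] with y hy
  rw [comp_coordVec hd hy]

theorem contMDiffAt_comp_apply (hφ : ContMDiffAt (𝓡 m) (𝓡 n) ∞ φ x)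
    (hd : d ∈ IsManifold.maximalAtlas (𝓡 n) ∞ N) (hx : φ x ∈ d.source) (a : Fin n) :
    ContMDiffAt (𝓡 m) 𝓘(ℝ, ℝ) ∞ (fun y => d (φ y) a) x :=
  ContMDiffAt.comp x (g := fun z => d z a) (contMDiffAt_chart_apply hd hx a) hφ

theorem comp_mfderiv (hφ : MDifferentiableAt (𝓡 m) (𝓡 n) φ x)
    (hd : d ∈ IsManifold.maximalAtlas (𝓡 n) ∞ N) (hx : φ x ∈ d.source) (v : TangentSpace (𝓡 m) x)
    (a : Fin n) : comp d (φ x) (mfderiv (𝓡 m) (𝓡 n) φ x v) a =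
      mvfderiv (𝓡 m) (fun y => d (φ y) a) x v := by
  have hdd : MDifferentiableAt (𝓡 n) (𝓡 n) (fun y => d y) (φ x) :=
    (contMDiffAt_of_mem_maximalAtlas hd hx).mdifferentiableAt (by simp)
  have h1 : mfderiv (𝓡 m) (𝓡 n) (fun y => d (φ y)) x =
    (mfderiv (𝓡 n) (𝓡 n) (fun y => d y) (φ x)).comp (mfderiv (𝓡 m) (𝓡 n) φ x) :=
    mfderiv_comp x hdd hφ
  let p : EuclideanSpace ℝ (Fin n) →L[ℝ] ℝ := EuclideanSpace.proj a
  have h2 : mfderiv (𝓡 m) 𝓘(ℝ, ℝ) (fun y => d (φ y) a) x =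
      (mfderiv (𝓡 n) 𝓘(ℝ, ℝ) p (d (φ x))).comp (mfderiv (𝓡 m) (𝓡 n) (fun y => d (φ y)) x) :=
    mfderiv_comp x p.mdifferentiableAt (hdd.comp x hφ)
  unfold mvfderiv
  rw [h2, h1, p.mfderiv_eq]
  rfl

theorem mvfderiv_comp_eq (hφ : MDifferentiableAt (𝓡 m) (𝓡 n) φ x) {f : N → ℝ}
    (hf : MDifferentiableAt (𝓡 n) 𝓘(ℝ, ℝ) f (φ x)) (v : TangentSpace (𝓡 m) x) :
    mvfderiv (𝓡 m) (fun y => f (φ y)) x v =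
      mvfderiv (𝓡 n) f (φ x) (mfderiv (𝓡 m) (𝓡 n) φ x v) := by
  have h1 : mfderiv (𝓡 m) 𝓘(ℝ, ℝ) (fun y => f (φ y)) x =
    (mfderiv (𝓡 n) 𝓘(ℝ, ℝ) f (φ x)).comp (mfderiv (𝓡 m) (𝓡 n) φ x) := mfderiv_comp x hf hφ
  unfold mvfderiv
  rw [h1]
  rfl

/-- Components change by the Jacobian matrix of the transition map, whose entries are smooth. -/
theorem SmoothAlong.change_chart (hφ : ContMDiffAt (𝓡 m) (𝓡 n) ∞ φ x)
    (hd : d ∈ IsManifold.maximalAtlas (𝓡 n) ∞ N) (hx : φ x ∈ d.source)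
    (hd' : d' ∈ IsManifold.maximalAtlas (𝓡 n) ∞ N) (hx' : φ x ∈ d'.source)
    (hW : SmoothAlong m d φ W x) : SmoothAlong m d' φ W x := fun a => by
  have h1 : ∀ b, ContMDiffAt (𝓡 m) 𝓘(ℝ, ℝ) ∞
      (fun y => coordDeriv d b (fun z => d' z a) (φ y)) x := fun b =>
    ContMDiffAt.comp x (contMDiffAt_coordDeriv hd hx (contMDiffAt_chart_apply hd' hx' a) b) hφ
  have h2 : ContMDiffAt (𝓡 m) 𝓘(ℝ, ℝ) ∞ (fun y => ∑ b, comp d (φ y) (W y) b *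
      coordDeriv d b (fun z => d' z a) (φ y)) x :=
    contMDiffAt_finsetSum fun b _ => (hW b).mul (h1 b)
  refine h2.congr_of_eventuallyEq ?_
  filter_upwards [eventually_mem_source hφ hx, eventually_mem_source hφ hx'] with y hy hy'
  have h3 := comp_mfderiv (φ := fun z : N => z) mdifferentiableAt_id hd' hy' (W y) a
  have h4 : mfderiv (𝓡 n) (𝓡 n) (fun z : N => z) (φ y) = ContinuousLinearMap.id ℝ _ :=
    mfderiv_id
  rw [h4] at h3
  rw [← mvfderiv_eq_sum hd hy, ← h3]
  rfl

end Along

theorem sum_swap_first_third {ι : Type*} [Fintype ι] (F : ι → ι → ι → ℝ) :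
    ∑ a, ∑ e, ∑ k, F a e k = ∑ a, ∑ e, ∑ k, F k e a := by
  rw [Finset.sum_comm]
  conv_rhs => rw [Finset.sum_comm]
  exact Finset.sum_congr rfl fun e _ => Finset.sum_comm

/-- This renames summation indices where Christoffel terms coming from the derivative of the metric
are matched with those of the connection. -/
theorem sum_swap_first_last {ι : Type*} [Fintype ι] (F : ι → ι → ι → ι → ℝ) :
    ∑ a, ∑ b, ∑ e, ∑ k, F a b e k = ∑ a, ∑ b, ∑ e, ∑ k, F k b e a := by
  rw [Finset.sum_comm]
  conv_rhs => rw [Finset.sum_comm]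
  exact Finset.sum_congr rfl fun b _ => sum_swap_first_third fun a e k => F a b e k

/-! ### Derivation rules for real functions -/

section Derivations

variable {m : ℕ} {M : Type*} [TopologicalSpace M] [ChartedSpace (EuclideanSpace ℝ (Fin m)) M]
  {x : M}

theorem mvfderiv_congr {F : Type*} [NormedAddCommGroup F] [NormedSpace ℝ F] {f g : M → F}
    (h : f =ᶠ[𝓝 x] g) (v : TangentSpace (𝓡 m) x) : mvfderiv (𝓡 m) f x v = mvfderiv (𝓡 m) g x v := by
  unfold mvfderiv
  have := h.mfderiv_eq (I := 𝓡 m) (I' := 𝓘(ℝ, F))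
  have h2 := DFunLike.congr_fun this v
  exact h2

theorem mvfderiv_add_apply {f g : M → ℝ} (hf : ContMDiffAt (𝓡 m) 𝓘(ℝ, ℝ) ∞ f x)
    (hg : ContMDiffAt (𝓡 m) 𝓘(ℝ, ℝ) ∞ g x) (v : TangentSpace (𝓡 m) x) :
    mvfderiv (𝓡 m) (fun y => f y + g y) x v = mvfderiv (𝓡 m) f x v + mvfderiv (𝓡 m) g x v := by
  have := mvfderiv_fun_add (hf.mdifferentiableAt (by simp)) (hg.mdifferentiableAt (by simp))
  rw [this]
  rfl

theorem mvfderiv_mul_apply {f g : M → ℝ} (hf : ContMDiffAt (𝓡 m) 𝓘(ℝ, ℝ) ∞ f x)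
    (hg : ContMDiffAt (𝓡 m) 𝓘(ℝ, ℝ) ∞ g x) (v : TangentSpace (𝓡 m) x) :
    mvfderiv (𝓡 m) (fun y => f y * g y) x v =
      mvfderiv (𝓡 m) f x v * g x + f x * mvfderiv (𝓡 m) g x v := by
  have := mvfderiv_fun_mul (hf.mdifferentiableAt (by simp)) (hg.mdifferentiableAt (by simp))
  rw [this]
  simp only [add_apply, smul_apply, smul_eq_mul]
  ring

theorem contMDiffAt_fun_mul {f g : M → ℝ} (hf : ContMDiffAt (𝓡 m) 𝓘(ℝ, ℝ) ∞ f x)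
    (hg : ContMDiffAt (𝓡 m) 𝓘(ℝ, ℝ) ∞ g x) :
    ContMDiffAt (𝓡 m) 𝓘(ℝ, ℝ) ∞ (fun y => f y * g y) x := hf.mul hg

theorem mvfderiv_const_apply (r : ℝ) (v : TangentSpace (𝓡 m) x) :
    mvfderiv (𝓡 m) (fun _ : M => r) x v = 0 := by
  rw [mvfderiv_const]
  rfl

theorem mvfderiv_sum_apply {ι : Type*} (s : Finset ι) {f : ι → M → ℝ}
    (hf : ∀ i, ContMDiffAt (𝓡 m) 𝓘(ℝ, ℝ) ∞ (f i) x) (v : TangentSpace (𝓡 m) x) :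
    mvfderiv (𝓡 m) (fun y => ∑ i ∈ s, f i y) x v = ∑ i ∈ s, mvfderiv (𝓡 m) (f i) x v := by
  classical
  induction s using Finset.induction with
  | empty => simpa using mvfderiv_const_apply (m := m) (x := x) 0 v
  | insert i s hi ih =>
    simp only [Finset.sum_insert hi]
    rw [mvfderiv_add_apply (hf i) (contMDiffAt_finsetSum fun j _ => hf j), ih]

end Derivations

/-! ### The pulled-back connection in a fixed chart -/

section Connection

variable {m n : ℕ} {M N : Type*}
  [TopologicalSpace M] [ChartedSpace (EuclideanSpace ℝ (Fin m)) M] [IsManifold (𝓡 m) ∞ M]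
  [TopologicalSpace N] [ChartedSpace (EuclideanSpace ℝ (Fin n)) N] [IsManifold (𝓡 n) ∞ N]
  [Bundle.RiemannianBundle (fun y : N => TangentSpace (𝓡 n) y)]
  [IsContMDiffRiemannianBundle (𝓡 n) ∞ (EuclideanSpace ℝ (Fin n))
      (fun y : N => TangentSpace (𝓡 n) y)]
  {c : OpenPartialHomeomorph M (EuclideanSpace ℝ (Fin m))}
  {d d' : OpenPartialHomeomorph N (EuclideanSpace ℝ (Fin n))} {φ : M → N}
  {W Z : ∀ x : M, TangentSpace (𝓡 n) (φ x)} {x : M}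

theorem comp_sum_smul_coordVec (hd : d ∈ IsManifold.maximalAtlas (𝓡 n) ∞ N) {p : N}
    (hp : p ∈ d.source) (s : Fin n → ℝ) (a : Fin n) :
    comp d p (∑ b, s b • coordVec d b p) a = s a := by
  have h := vecOfComp_eq_sum (c := d) (x := p) (WithLp.toLp 2 s)
  change vecOfComp d p (WithLp.toLp 2 s) = ∑ b, s b • coordVec d b p at h
  rw [← h, comp_vecOfComp hd hp]

theorem comp_covAlongIn (hd : d ∈ IsManifold.maximalAtlas (𝓡 n) ∞ N) (hx : φ x ∈ d.source)
    (v : TangentSpace (𝓡 m) x) (a : Fin n) :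
    comp d (φ x) (covAlongIn d φ W x v) a = mvfderiv (𝓡 m) (fun y => comp d (φ y) (W y) a) x v
      + ∑ b, ∑ c, christoffel d (φ x) a b c
        * comp d (φ x) (mfderiv (𝓡 m) (𝓡 n) φ x v) b * comp d (φ x) (W x) c :=
  comp_sum_smul_coordVec hd hx _ a

theorem covAlongIn_congr (h : ∀ᶠ y in 𝓝 x, W y = Z y) (v : TangentSpace (𝓡 m) x) :
    covAlongIn d φ W x v = covAlongIn d φ Z x v := by
  unfold covAlongIn
  refine Finset.sum_congr rfl fun a _ => ?_
  rw [h.self_of_nhds, mvfderiv_congr (f := fun y => comp d (φ y) (W y) a)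
    (g := fun y => comp d (φ y) (Z y) a) (h.mono fun y hy => by simp only [hy])]

theorem covAlongIn_add_vec (u v : TangentSpace (𝓡 m) x) :
    covAlongIn d φ W x (u + v) = covAlongIn d φ W x u + covAlongIn d φ W x v := by
  unfold covAlongIn
  rw [← Finset.sum_add_distrib]
  refine Finset.sum_congr rfl fun a _ => ?_
  rw [← add_smul, map_add, map_add, comp_add]
  congr 1
  simp only [PiLp.add_apply, mul_add, add_mul, Finset.sum_add_distrib]
  ring

theorem covAlongIn_smul_vec (r : ℝ) (v : TangentSpace (𝓡 m) x) :
    covAlongIn d φ W x (r • v) = r • covAlongIn d φ W x v := by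
  unfold covAlongIn
  rw [Finset.smul_sum]
  refine Finset.sum_congr rfl fun a _ => ?_
  rw [smul_smul, map_smul, map_smul, comp_smul]
  congr 1
  simp only [PiLp.smul_apply, smul_eq_mul, mul_add, Finset.mul_sum]
  congr 1
  refine Finset.sum_congr rfl fun b _ => Finset.sum_congr rfl fun e _ => ?_
  ring

theorem covAlongIn_add (hd : d ∈ IsManifold.maximalAtlas (𝓡 n) ∞ N) (hx : φ x ∈ d.source)
    (hW : SmoothAlong m d φ W x) (hZ : SmoothAlong m d φ Z x) (v : TangentSpace (𝓡 m) x) :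
    covAlongIn d φ (fun y => W y + Z y) x v = covAlongIn d φ W x v + covAlongIn d φ Z x v := by
  refine comp_injective hd hx fun a => ?_
  rw [comp_add, PiLp.add_apply, comp_covAlongIn hd hx, comp_covAlongIn hd hx, comp_covAlongIn hd hx]
  simp only [comp_add, PiLp.add_apply]
  rw [mvfderiv_add_apply (hW a) (hZ a)]
  simp only [mul_add, Finset.sum_add_distrib]
  ring

theorem covAlongIn_smul (hd : d ∈ IsManifold.maximalAtlas (𝓡 n) ∞ N) (hx : φ x ∈ d.source)
    {f : M → ℝ} (hf : ContMDiffAt (𝓡 m) 𝓘(ℝ, ℝ) ∞ f x)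
    (hW : SmoothAlong m d φ W x) (v : TangentSpace (𝓡 m) x) :
    covAlongIn d φ (fun y => f y • W y) x v =
      mvfderiv (𝓡 m) f x v • W x + f x • covAlongIn d φ W x v := by
  refine comp_injective hd hx fun a => ?_
  rw [comp_add, comp_smul, comp_smul, PiLp.add_apply, PiLp.smul_apply, PiLp.smul_apply,
    comp_covAlongIn hd hx, comp_covAlongIn hd hx]
  simp only [comp_smul, PiLp.smul_apply, smul_eq_mul]
  rw [mvfderiv_mul_apply hf (hW a), mul_add, Finset.mul_sum, add_assoc]
  congr 2
  refine Finset.sum_congr rfl fun b _ => ?_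
  rw [Finset.mul_sum]
  refine Finset.sum_congr rfl fun e _ => ?_
  ring

theorem covAlongIn_sum_smul (hd : d ∈ IsManifold.maximalAtlas (𝓡 n) ∞ N) (hx : φ x ∈ d.source)
    {ι : Type*} (s : Finset ι) {f : ι → M → ℝ} {V : ι → ∀ x : M, TangentSpace (𝓡 n) (φ x)}
    (hf : ∀ i, ContMDiffAt (𝓡 m) 𝓘(ℝ, ℝ) ∞ (f i) x)
    (hV : ∀ i, SmoothAlong m d φ (V i) x) (v : TangentSpace (𝓡 m) x) :
    covAlongIn d φ (fun y => ∑ i ∈ s, f i y • V i y) x v =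
      ∑ i ∈ s, (mvfderiv (𝓡 m) (f i) x v • V i x + f i x • covAlongIn d φ (V i) x v) := by
  classical
  induction s using Finset.induction with
  | empty =>
    refine comp_injective hd hx fun a => ?_
    have h0 : ∀ y, comp d (φ y) (0 : TangentSpace (𝓡 n) (φ y)) = 0 := fun y =>
      map_zero (mvfderiv (𝓡 n) (fun y => d y) (φ y))
    rw [comp_covAlongIn hd hx]
    simp only [Finset.sum_empty, h0, PiLp.zero_apply, mul_zero, Finset.sum_const_zero, add_zero]
    exact mvfderiv_const_apply 0 v
  | insert i s hi ih =>
    simp only [Finset.sum_insert hi]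
    rw [covAlongIn_add hd hx (SmoothAlong.smul (hf i) (hV i))
      (SmoothAlong.sum_smul (fun j _ => hf j) (fun j _ => hV j)), covAlongIn_smul hd hx (hf i) (hV i),
      ih]

/-- Compatibility of the pulled back connection with the metric. -/
theorem mvfderiv_inner (hd : d ∈ IsManifold.maximalAtlas (𝓡 n) ∞ N) (hx : φ x ∈ d.source)
    (hφ : ContMDiffAt (𝓡 m) (𝓡 n) ∞ φ x)
    (hW : SmoothAlong m d φ W x) (hZ : SmoothAlong m d φ Z x) (v : TangentSpace (𝓡 m) x) :
    mvfderiv (𝓡 m) (fun y => inner ℝ (W y) (Z y)) x v =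
      inner ℝ (covAlongIn d φ W x v) (Z x) + inner ℝ (W x) (covAlongIn d φ Z x v) := by
  have hev : (fun y => inner ℝ (W y) (Z y)) =ᶠ[𝓝 x] fun y =>
      ∑ a, ∑ b, comp d (φ y) (W y) a * comp d (φ y) (Z y) b * gram d (φ y) a b := by
    filter_upwards [eventually_mem_source hφ hx] with y hy
    rw [inner_eq_sum hd hy]
  have hg : ∀ a b, ContMDiffAt (𝓡 m) 𝓘(ℝ, ℝ) ∞ (fun y => gram d (φ y) a b) x := fun a b =>
    ContMDiffAt.comp x (g := fun z => gram d z a b) (contMDiffAt_gram hd hx a b) hφ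
  have hgd : ∀ a b, mvfderiv (𝓡 m) (fun y => gram d (φ y) a b) x v =
      ∑ e, comp d (φ x) (mfderiv (𝓡 m) (𝓡 n) φ x v) e *
        (∑ k, christoffel d (φ x) k e a * gram d (φ x) k b +
          ∑ k, christoffel d (φ x) k e b * gram d (φ x) a k) := by
    intro a b
    rw [mvfderiv_comp_eq (f := fun z => gram d z a b) (hφ.mdifferentiableAt (by simp))
      ((contMDiffAt_gram hd hx a b).mdifferentiableAt (by simp)), mvfderiv_eq_sum hd hx]
    refine Finset.sum_congr rfl fun e _ => ?_
    rw [← dGram_eq_sum hd hx]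
    rfl
  rw [mvfderiv_congr hev, mvfderiv_sum_apply]
  swap
  · exact fun a => contMDiffAt_finsetSum fun b _ => ((hW a).mul (hZ b)).mul (hg a b)
  rw [inner_eq_sum hd hx, inner_eq_sum hd hx]
  have e1 : ∀ a, mvfderiv (𝓡 m) (fun y => ∑ b, comp d (φ y) (W y) a * comp d (φ y) (Z y) b *
      gram d (φ y) a b) x v = ∑ b, ((mvfderiv (𝓡 m) (fun y => comp d (φ y) (W y) a) x v *
        comp d (φ x) (Z x) b + comp d (φ x) (W x) a *
          mvfderiv (𝓡 m) (fun y => comp d (φ y) (Z y) b) x v) * gram d (φ x) a b +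
        comp d (φ x) (W x) a * comp d (φ x) (Z x) b *
          mvfderiv (𝓡 m) (fun y => gram d (φ y) a b) x v) := by
    intro a
    refine (mvfderiv_sum_apply (f := fun b y => comp d (φ y) (W y) a * comp d (φ y) (Z y) b *
      gram d (φ y) a b) _
        (fun b => contMDiffAt_fun_mul (contMDiffAt_fun_mul (hW a) (hZ b)) (hg a b)) v).trans ?_
    refine Finset.sum_congr rfl fun b _ => ?_
    refine (mvfderiv_mul_apply (contMDiffAt_fun_mul (hW a) (hZ b)) (hg a b) v).trans ?_
    rw [mvfderiv_mul_apply (hW a) (hZ b) v]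
  simp only [e1, hgd, comp_covAlongIn hd hx]
  generalize hA : (fun a => comp d (φ x) (W x) a) = A
  generalize hB : (fun a => comp d (φ x) (Z x) a) = B
  generalize hdA : (fun a => mvfderiv (𝓡 m) (fun y => comp d (φ y) (W y) a) x v) = dA
  generalize hdB : (fun a => mvfderiv (𝓡 m) (fun y => comp d (φ y) (Z y) a) x v) = dB
  generalize hu : (fun e => comp d (φ x) (mfderiv (𝓡 m) (𝓡 n) φ x v) e) = u
  simp only [funext_iff] at hA hB hdA hdB hu
  simp only [hA, hB, hdA, hdB, hu]
  -- The derivative of the metric contributes two families of Christoffel terms; `k1` identifies the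
  -- first with the correction in ∇W and `k2` the second with that in ∇Z.
  have k1 : ∑ a, ∑ b, A a * B b * ∑ e, u e * ∑ k, christoffel d (φ x) k e a * gram d (φ x) k b =
      ∑ a, ∑ b, (∑ e, ∑ k, christoffel d (φ x) a e k * u e * A k) * B b * gram d (φ x) a b := by
    simp only [Finset.mul_sum, Finset.sum_mul]
    rw [sum_swap_first_last]
    refine Finset.sum_congr rfl fun a _ => Finset.sum_congr rfl fun b _ =>
      Finset.sum_congr rfl fun e _ => Finset.sum_congr rfl fun k _ => ?_
    ring
  have k2 : ∑ a, ∑ b, A a * B b * ∑ e, u e * ∑ k, christoffel d (φ x) k e b * gram d (φ x) a k =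
      ∑ a, ∑ b, A a * (∑ e, ∑ k, christoffel d (φ x) b e k * u e * B k) * gram d (φ x) a b := by
    simp only [Finset.mul_sum, Finset.sum_mul]
    refine Finset.sum_congr rfl fun a _ => ?_
    rw [sum_swap_first_third]
    refine Finset.sum_congr rfl fun b _ =>
      Finset.sum_congr rfl fun e _ => Finset.sum_congr rfl fun k _ => ?_
    ring
  simp only [mul_add, add_mul, Finset.sum_add_distrib] at k1 k2 ⊢
  rw [k1, k2]
  ring

end Connection

/-! ### Koszul formula and independence of the chart -/

section ChartIndependence

variable {m n : ℕ} {M N : Type*}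
  [TopologicalSpace M] [ChartedSpace (EuclideanSpace ℝ (Fin m)) M] [IsManifold (𝓡 m) ∞ M]
  [Bundle.RiemannianBundle (fun x : M => TangentSpace (𝓡 m) x)]
  [IsContMDiffRiemannianBundle (𝓡 m) ∞ (EuclideanSpace ℝ (Fin m))
      (fun x : M => TangentSpace (𝓡 m) x)]
  [TopologicalSpace N] [ChartedSpace (EuclideanSpace ℝ (Fin n)) N] [IsManifold (𝓡 n) ∞ N]
  [Bundle.RiemannianBundle (fun y : N => TangentSpace (𝓡 n) y)]
  [IsContMDiffRiemannianBundle (𝓡 n) ∞ (EuclideanSpace ℝ (Fin n))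
      (fun y : N => TangentSpace (𝓡 n) y)]
  {c c' : OpenPartialHomeomorph M (EuclideanSpace ℝ (Fin m))}
  {d d' : OpenPartialHomeomorph N (EuclideanSpace ℝ (Fin n))} {φ : M → N}
  {W Z : ∀ x : M, TangentSpace (𝓡 n) (φ x)} {x : M}

theorem ext_inner_coordVec (hc : c ∈ IsManifold.maximalAtlas (𝓡 m) ∞ M) (hx : x ∈ c.source)
    {u v : TangentSpace (𝓡 m) x}
    (h : ∀ k, inner ℝ u (coordVec c k x) = inner ℝ v (coordVec c k x)) : u = v := by
  refine ext_inner_right ℝ fun w => ?_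
  rw [← sum_comp_smul_coordVec hc hx w, inner_sum, inner_sum]
  refine Finset.sum_congr rfl fun k _ => ?_
  rw [real_inner_smul_right, real_inner_smul_right, h]

theorem eventually_comp_mfderiv_coordVec (hφ : ContMDiff (𝓡 m) (𝓡 n) ∞ φ)
    (hd : d ∈ IsManifold.maximalAtlas (𝓡 n) ∞ N) (hxd : φ x ∈ d.source) (j : Fin m) (a : Fin n) :
    (fun y => comp d (φ y) (mfderiv (𝓡 m) (𝓡 n) φ y (coordVec c j y)) a) =ᶠ[𝓝 x]
      coordDeriv c j fun y => d (φ y) a := by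
  filter_upwards [eventually_mem_source (hφ x) hxd] with y hy
  exact comp_mfderiv ((hφ y).mdifferentiableAt (by simp)) hd hy _ a

theorem smoothAlong_mfderiv_coordVec (hφ : ContMDiff (𝓡 m) (𝓡 n) ∞ φ)
    (hc : c ∈ IsManifold.maximalAtlas (𝓡 m) ∞ M) (hx : x ∈ c.source)
    (hd : d ∈ IsManifold.maximalAtlas (𝓡 n) ∞ N) (hxd : φ x ∈ d.source) (j : Fin m) :
    SmoothAlong m d φ (fun y => mfderiv (𝓡 m) (𝓡 n) φ y (coordVec c j y)) x := fun a =>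
  (contMDiffAt_coordDeriv hc hx (contMDiffAt_comp_apply (hφ x) hd hxd a)
    j).congr_of_eventuallyEq (eventually_comp_mfderiv_coordVec hφ hd hxd j a)

/-- The pulled back connection is torsion free. -/
theorem covAlongIn_mfderiv_coordVec_comm (hφ : ContMDiff (𝓡 m) (𝓡 n) ∞ φ)
    (hc : c ∈ IsManifold.maximalAtlas (𝓡 m) ∞ M) (hx : x ∈ c.source)
    (hd : d ∈ IsManifold.maximalAtlas (𝓡 n) ∞ N) (hxd : φ x ∈ d.source) (i j : Fin m) :
    covAlongIn d φ (fun y => mfderiv (𝓡 m) (𝓡 n) φ y (coordVec c j y)) x (coordVec c i x) =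
      covAlongIn d φ (fun y => mfderiv (𝓡 m) (𝓡 n) φ y (coordVec c i y)) x (coordVec c j x) := by
  refine comp_injective hd hxd fun a => ?_
  rw [comp_covAlongIn hd hxd, comp_covAlongIn hd hxd,
    mvfderiv_congr (eventually_comp_mfderiv_coordVec hφ hd hxd j a),
    mvfderiv_congr (eventually_comp_mfderiv_coordVec hφ hd hxd i a)]
  congr 1
  · exact coordDeriv_comm hc hx (contMDiffAt_comp_apply (hφ x) hd hxd a) i j
  · rw [Finset.sum_comm]
    refine Finset.sum_congr rfl fun b _ => Finset.sum_congr rfl fun e _ => ?_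
    rw [christoffel_comm]
    ring

/-- The Koszul formula. -/
theorem koszul_formula (hφ : ContMDiff (𝓡 m) (𝓡 n) ∞ φ)
    (hiso : ∀ (x : M) (u v : TangentSpace (𝓡 m) x),
      inner ℝ (mfderiv (𝓡 m) (𝓡 n) φ x u) (mfderiv (𝓡 m) (𝓡 n) φ x v) = inner ℝ u v)
    (hc : c ∈ IsManifold.maximalAtlas (𝓡 m) ∞ M) (hx : x ∈ c.source)
    (hd : d ∈ IsManifold.maximalAtlas (𝓡 n) ∞ N) (hxd : φ x ∈ d.source) (i j k : Fin m) :
    inner ℝ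
      (covAlongIn d φ (fun y => mfderiv (𝓡 m) (𝓡 n) φ y (coordVec c j y)) x (coordVec c i x))
      (mfderiv (𝓡 m) (𝓡 n) φ x (coordVec c k x)) =
      (1 / 2 : ℝ) * (dGram c x i j k + dGram c x j i k - dGram c x k i j) := by
  -- By isometry ⟨dφ ∂_j, dφ ∂_k⟩ is the Gram coefficient of M, so metric compatibility on N
  -- computes its derivative. The cyclic sum with vanishing torsion concludes as usual.
  have key : ∀ i j k, dGram c x i j k = inner ℝ
      (covAlongIn d φ (fun y => mfderiv (𝓡 m) (𝓡 n) φ y (coordVec c j y)) x (coordVec c i x))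
      (mfderiv (𝓡 m) (𝓡 n) φ x (coordVec c k x)) + inner ℝ
      (covAlongIn d φ (fun y => mfderiv (𝓡 m) (𝓡 n) φ y (coordVec c k y)) x (coordVec c i x))
      (mfderiv (𝓡 m) (𝓡 n) φ x (coordVec c j x)) := by
    intro i j k
    have h := mvfderiv_inner hd hxd (hφ x) (smoothAlong_mfderiv_coordVec hφ hc hx hd hxd j)
      (smoothAlong_mfderiv_coordVec hφ hc hx hd hxd k) (coordVec c i x)
    simp only [hiso] at h
    rw [real_inner_comm (covAlongIn d φ _ x (coordVec c i x))
      (mfderiv (𝓡 m) (𝓡 n) φ x (coordVec c j x))] at h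
    exact h
  have h1 := key i j k
  have h2 := key j i k
  have h3 := key k i j
  rw [covAlongIn_mfderiv_coordVec_comm hφ hc hx hd hxd j i] at h2
  rw [covAlongIn_mfderiv_coordVec_comm hφ hc hx hd hxd k i,
    covAlongIn_mfderiv_coordVec_comm hφ hc hx hd hxd k j] at h3
  linarith

theorem mfderiv_id_apply (v : TangentSpace (𝓡 m) x) :
    mfderiv (𝓡 m) (𝓡 m) (fun y : M => y) x v = v := by
  have h4 : mfderiv (𝓡 m) (𝓡 m) (fun z : M => z) x = ContinuousLinearMap.id ℝ _ := mfderiv_id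
  rw [h4]
  rfl

theorem koszul_formula_id
    (hc : c ∈ IsManifold.maximalAtlas (𝓡 m) ∞ M) (hx : x ∈ c.source)
    (hc' : c' ∈ IsManifold.maximalAtlas (𝓡 m) ∞ M) (hx' : x ∈ c'.source) (i j k : Fin m) :
    inner ℝ (covAlongIn c' (fun y : M => y) (fun y => coordVec c j y) x (coordVec c i x))
      (coordVec c k x) =
      (1 / 2 : ℝ) * (dGram c x i j k + dGram c x j i k - dGram c x k i j) := by
  have h := koszul_formula (φ := fun y : M => y) contMDiff_id
    (fun x u v => by rw [mfderiv_id_apply, mfderiv_id_apply]) hc hx hc' hx' i j k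
  simp only [mfderiv_id_apply] at h
  exact h

/-- Computed in any chart, the inner products of the derivatives of the coordinate fields of c with
those fields are Koszul expressions in the metric of c alone, and such inner products determine a
vector. -/
theorem covAlongIn_id_eq (hc : c ∈ IsManifold.maximalAtlas (𝓡 m) ∞ M) (hx : x ∈ c.source)
    (hc' : c' ∈ IsManifold.maximalAtlas (𝓡 m) ∞ M) (hx' : x ∈ c'.source) (j : Fin m)
    (v : TangentSpace (𝓡 m) x) :
    covAlongIn c' (fun y : M => y) (fun y => coordVec c j y) x v =
      covAlongIn c (fun y : M => y) (fun y => coordVec c j y) x v := by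
  have hl : ∀ e : OpenPartialHomeomorph M (EuclideanSpace ℝ (Fin m)),
      covAlongIn e (fun y : M => y) (fun y => coordVec c j y) x v = ∑ i, comp c x v i •
        covAlongIn e (fun y : M => y) (fun y => coordVec c j y) x (coordVec c i x) := by
    intro e
    let L : TangentSpace (𝓡 m) x →ₗ[ℝ] TangentSpace (𝓡 m) x :=
      { toFun := fun v => covAlongIn e (fun y : M => y) (fun y => coordVec c j y) x v
        map_add' := fun u v => covAlongIn_add_vec u v
        map_smul' := fun r v => covAlongIn_smul_vec r v }
    conv_lhs => rw [← sum_comp_smul_coordVec hc hx v]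
    change L _ = ∑ i, comp c x v i • L (coordVec c i x)
    rw [map_sum]
    simp only [map_smul]
  rw [hl c', hl c]
  refine Finset.sum_congr rfl fun i _ => ?_
  congr 1
  refine ext_inner_coordVec hc hx fun k => ?_
  rw [koszul_formula_id hc hx hc' hx', koszul_formula_id hc hx hc hx]

/-- The chain rule reduces fields pulled back from N to the connection of N itself, where chart
independence is known for coordinate fields. -/
theorem covAlongIn_comp (hφ : ContMDiff (𝓡 m) (𝓡 n) ∞ φ)
    (hd : d ∈ IsManifold.maximalAtlas (𝓡 n) ∞ N) (hxd : φ x ∈ d.source)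
    {Y : ∀ z : N, TangentSpace (𝓡 n) z} (hY : SmoothAlong n d (fun z => z) Y (φ x))
    (v : TangentSpace (𝓡 m) x) :
    covAlongIn d φ (fun y => Y (φ y)) x v =
      covAlongIn d (fun z : N => z) Y (φ x) (mfderiv (𝓡 m) (𝓡 n) φ x v) := by
  refine comp_injective hd hxd fun a => ?_
  rw [comp_covAlongIn hd hxd]
  refine Eq.trans ?_ (comp_covAlongIn (φ := fun z : N => z) (x := φ x) hd hxd _ a).symm
  rw [mvfderiv_comp_eq (f := fun z => comp d z (Y z) a) ((hφ x).mdifferentiableAt (by simp))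
    ((hY a).mdifferentiableAt (by simp)), mfderiv_id_apply]

theorem eventually_eq_sum_coordVec (hφ : ContMDiffAt (𝓡 m) (𝓡 n) ∞ φ x)
    (hd : d ∈ IsManifold.maximalAtlas (𝓡 n) ∞ N) (hxd : φ x ∈ d.source)
    (W : ∀ x : M, TangentSpace (𝓡 n) (φ x)) :
    ∀ᶠ y in 𝓝 x, W y = ∑ a, comp d (φ y) (W y) a • coordVec d a (φ y) := by
  filter_upwards [eventually_mem_source hφ hxd] with y hy
  rw [sum_comp_smul_coordVec hd hy]

/-- The pulled back connection does not depend on the chart used to compute it. -/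
theorem covAlongIn_eq (hφ : ContMDiff (𝓡 m) (𝓡 n) ∞ φ)
    (hd : d ∈ IsManifold.maximalAtlas (𝓡 n) ∞ N) (hxd : φ x ∈ d.source)
    (hd' : d' ∈ IsManifold.maximalAtlas (𝓡 n) ∞ N) (hxd' : φ x ∈ d'.source)
    (hW : SmoothAlong m d φ W x) (v : TangentSpace (𝓡 m) x) :
    covAlongIn d' φ W x v = covAlongIn d φ W x v := by
  have hev := eventually_eq_sum_coordVec (hφ x) hd hxd W
  have hs : ∀ a, SmoothAlong m d φ (fun y => coordVec d a (φ y)) x :=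
    smoothAlong_coordVec (hφ x) hd hxd
  have hsN : ∀ a, SmoothAlong n d (fun z : N => z) (fun z => coordVec d a z) (φ x) := fun a =>
    smoothAlong_coordVec (φ := fun z : N => z) contMDiffAt_id hd hxd a
  have hs' : ∀ a, SmoothAlong m d' φ (fun y => coordVec d a (φ y)) x := fun a =>
    (hs a).change_chart (hφ x) hd hxd hd' hxd'
  have hsN' : ∀ a, SmoothAlong n d' (fun z : N => z) (fun z => coordVec d a z) (φ x) := fun a =>
    (hsN a).change_chart contMDiffAt_id hd hxd hd' hxd'
  -- W is expanded near x in the coordinate fields of d; the Leibniz rule leaves only derivatives of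
  -- those fields to be compared.
  rw [covAlongIn_congr hev, covAlongIn_congr hev, covAlongIn_sum_smul hd hxd _ hW hs,
    covAlongIn_sum_smul hd' hxd' _ hW hs']
  refine Finset.sum_congr rfl fun a _ => ?_
  congr 2
  rw [covAlongIn_comp hφ hd hxd (hsN a), covAlongIn_comp hφ hd' hxd' (hsN' a)]
  exact covAlongIn_id_eq hd hxd hd' hxd' a _

theorem covAlong_eq (hφ : ContMDiff (𝓡 m) (𝓡 n) ∞ φ)
    (hd : d ∈ IsManifold.maximalAtlas (𝓡 n) ∞ N) (hxd : φ x ∈ d.source)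
    (hW : SmoothAlong m d φ W x) (v : TangentSpace (𝓡 m) x) :
    covAlong φ W x v = covAlongIn d φ W x v :=
  covAlongIn_eq hφ hd hxd (IsManifold.chart_mem_maximalAtlas _)
    (mem_chart_source _ _) hW v

theorem leviCivita_eq (hc : c ∈ IsManifold.maximalAtlas (𝓡 m) ∞ M) (hx : x ∈ c.source)
    {V : ∀ x : M, TangentSpace (𝓡 m) x} (hV : SmoothAlong m c (fun y => y) V x)
    (v : TangentSpace (𝓡 m) x) : leviCivita V x v = covAlongIn c (fun y => y) V x v :=
  covAlong_eq (φ := fun y : M => y) contMDiff_id hc hx hV v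

end ChartIndependence

/-! ### Smooth fields, without reference to a chart -/

section Fields

variable {m n : ℕ} {M N : Type*}
  [TopologicalSpace M] [ChartedSpace (EuclideanSpace ℝ (Fin m)) M] [IsManifold (𝓡 m) ∞ M]
  [TopologicalSpace N] [ChartedSpace (EuclideanSpace ℝ (Fin n)) N] [IsManifold (𝓡 n) ∞ N]
  {c : OpenPartialHomeomorph M (EuclideanSpace ℝ (Fin m))}
  {d : OpenPartialHomeomorph N (EuclideanSpace ℝ (Fin n))} {φ : M → N}
  {W Z : ∀ x : M, TangentSpace (𝓡 n) (φ x)} {x : M}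

/-- Smoothness at `x` of a vector field along `φ`. -/
def SmoothFieldAt (m : ℕ) {n : ℕ} {M N : Type*} [TopologicalSpace M]
    [ChartedSpace (EuclideanSpace ℝ (Fin m)) M] [TopologicalSpace N]
    [ChartedSpace (EuclideanSpace ℝ (Fin n)) N] (φ : M → N)
    (W : ∀ x : M, TangentSpace (𝓡 n) (φ x)) (x : M) : Prop :=
  SmoothAlong m (chartAt (EuclideanSpace ℝ (Fin n)) (φ x)) φ W x

theorem chartAt_mem (p : N) :
    chartAt (EuclideanSpace ℝ (Fin n)) p ∈ IsManifold.maximalAtlas (𝓡 n) ∞ N :=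
  IsManifold.chart_mem_maximalAtlas _

theorem SmoothFieldAt.smoothAlong (hφ : ContMDiff (𝓡 m) (𝓡 n) ∞ φ) (hW : SmoothFieldAt m φ W x)
    (hd : d ∈ IsManifold.maximalAtlas (𝓡 n) ∞ N) (hx : φ x ∈ d.source) : SmoothAlong m d φ W x :=
  SmoothAlong.change_chart (hφ x) (chartAt_mem _) (mem_chart_source _ _) hd hx hW

theorem SmoothAlong.smoothFieldAt (hφ : ContMDiff (𝓡 m) (𝓡 n) ∞ φ)
    (hd : d ∈ IsManifold.maximalAtlas (𝓡 n) ∞ N) (hx : φ x ∈ d.source)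
    (hW : SmoothAlong m d φ W x) : SmoothFieldAt m φ W x :=
  SmoothAlong.change_chart (hφ x) hd hx (chartAt_mem _) (mem_chart_source _ _) hW

theorem SmoothFieldAt.congr (h : SmoothFieldAt m φ W x) (he : ∀ᶠ y in 𝓝 x, Z y = W y) :
    SmoothFieldAt m φ Z x := SmoothAlong.congr h he

theorem SmoothFieldAt.sum_smul {ι : Type*} (s : Finset ι) {f : ι → M → ℝ}
    {V : ι → ∀ x : M, TangentSpace (𝓡 n) (φ x)}
    (hf : ∀ i, ContMDiffAt (𝓡 m) 𝓘(ℝ, ℝ) ∞ (f i) x) (hV : ∀ i, SmoothFieldAt m φ (V i) x) :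
    SmoothFieldAt m φ (fun y => ∑ i ∈ s, f i y • V i y) x :=
  SmoothAlong.sum_smul (fun i _ => hf i) fun i _ => hV i

theorem smoothFieldAt_coordVec (hc : c ∈ IsManifold.maximalAtlas (𝓡 m) ∞ M) (hx : x ∈ c.source)
    (j : Fin m) : SmoothFieldAt m (fun y : M => y) (coordVec c j) x :=
  SmoothAlong.smoothFieldAt (φ := fun y : M => y) contMDiff_id hc hx
    (smoothAlong_coordVec (φ := fun y : M => y) contMDiffAt_id hc hx j)

theorem SmoothFieldAt.contMDiffAt_comp {V : ∀ x : M, TangentSpace (𝓡 m) x}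
    (hV : SmoothFieldAt m (fun y : M => y) V x)
    (hc : c ∈ IsManifold.maximalAtlas (𝓡 m) ∞ M) (hx : x ∈ c.source) (j : Fin m) :
    ContMDiffAt (𝓡 m) 𝓘(ℝ, ℝ) ∞ (fun y => comp c y (V y) j) x :=
  SmoothFieldAt.smoothAlong (φ := fun y : M => y) contMDiff_id hV hc hx j

theorem localExtension_self (v : TangentSpace (𝓡 m) x) : localExtension x v x = v :=
  vecOfComp_comp (chartAt_mem x) (mem_chart_source _ x) v

theorem smoothFieldAt_localExtension (v : TangentSpace (𝓡 m) x) :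
    SmoothFieldAt m (fun y : M => y) (localExtension x v) x := by
  have h := SmoothFieldAt.sum_smul (m := m) (φ := fun y : M => y) (x := x) Finset.univ
    (f := fun i _ => comp (chartAt (EuclideanSpace ℝ (Fin m)) x) x v i)
    (V := fun i => coordVec (chartAt (EuclideanSpace ℝ (Fin m)) x) i)
    (fun _ => contMDiffAt_const)
    (fun i => smoothFieldAt_coordVec (chartAt_mem x) (mem_chart_source _ x) i)
  exact h.congr (Eventually.of_forall fun y => vecOfComp_eq_sum _)

end Fields

/-! ### Covariant derivatives of bundle maps from TM to φ*TN -/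

section Covariant

variable {m n : ℕ} {M N : Type*}
  [TopologicalSpace M] [ChartedSpace (EuclideanSpace ℝ (Fin m)) M] [IsManifold (𝓡 m) ∞ M]
  [Bundle.RiemannianBundle (fun x : M => TangentSpace (𝓡 m) x)]
  [IsContMDiffRiemannianBundle (𝓡 m) ∞ (EuclideanSpace ℝ (Fin m))
      (fun x : M => TangentSpace (𝓡 m) x)]
  [TopologicalSpace N] [ChartedSpace (EuclideanSpace ℝ (Fin n)) N] [IsManifold (𝓡 n) ∞ N]
  [Bundle.RiemannianBundle (fun y : N => TangentSpace (𝓡 n) y)]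
  [IsContMDiffRiemannianBundle (𝓡 n) ∞ (EuclideanSpace ℝ (Fin n))
      (fun y : N => TangentSpace (𝓡 n) y)]
  {c : OpenPartialHomeomorph M (EuclideanSpace ℝ (Fin m))} {φ : M → N}
  {W Z : ∀ x : M, TangentSpace (𝓡 n) (φ x)} {x : M}

theorem covAlong_congr (h : ∀ᶠ y in 𝓝 x, W y = Z y) (v : TangentSpace (𝓡 m) x) :
    covAlong φ W x v = covAlong φ Z x v := covAlongIn_congr h v

theorem covAlong_add_vec (u v : TangentSpace (𝓡 m) x) :
    covAlong φ W x (u + v) = covAlong φ W x u + covAlong φ W x v := covAlongIn_add_vec u v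

theorem covAlong_smul_vec (r : ℝ) (v : TangentSpace (𝓡 m) x) :
    covAlong φ W x (r • v) = r • covAlong φ W x v := covAlongIn_smul_vec r v

theorem covAlong_add (hW : SmoothFieldAt m φ W x) (hZ : SmoothFieldAt m φ Z x)
    (v : TangentSpace (𝓡 m) x) :
    covAlong φ (fun y => W y + Z y) x v = covAlong φ W x v + covAlong φ Z x v :=
  covAlongIn_add (chartAt_mem _) (mem_chart_source _ _) hW hZ v

theorem covAlong_smul {f : M → ℝ} (hf : ContMDiffAt (𝓡 m) 𝓘(ℝ, ℝ) ∞ f x)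
    (hW : SmoothFieldAt m φ W x) (v : TangentSpace (𝓡 m) x) :
    covAlong φ (fun y => f y • W y) x v =
      mvfderiv (𝓡 m) f x v • W x + f x • covAlong φ W x v :=
  covAlongIn_smul (chartAt_mem _) (mem_chart_source _ _) hf hW v

theorem covAlong_const_smul (r : ℝ) (hW : SmoothFieldAt m φ W x) (v : TangentSpace (𝓡 m) x) :
    covAlong φ (fun y => r • W y) x v = r • covAlong φ W x v := by
  rw [covAlong_smul (f := fun _ => r) contMDiffAt_const hW, mvfderiv_const_apply, zero_smul,
    zero_add]

theorem covAlong_sum_smul {ι : Type*} (s : Finset ι) {f : ι → M → ℝ}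
    {V : ι → ∀ x : M, TangentSpace (𝓡 n) (φ x)}
    (hf : ∀ i, ContMDiffAt (𝓡 m) 𝓘(ℝ, ℝ) ∞ (f i) x) (hV : ∀ i, SmoothFieldAt m φ (V i) x)
    (v : TangentSpace (𝓡 m) x) :
    covAlong φ (fun y => ∑ i ∈ s, f i y • V i y) x v =
      ∑ i ∈ s, (mvfderiv (𝓡 m) (f i) x v • V i x + f i x • covAlong φ (V i) x v) :=
  covAlongIn_sum_smul (chartAt_mem _) (mem_chart_source _ _) s hf hV v

theorem mvfderiv_inner_covAlong (hφ : ContMDiff (𝓡 m) (𝓡 n) ∞ φ) (hW : SmoothFieldAt m φ W x)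
    (hZ : SmoothFieldAt m φ Z x) (v : TangentSpace (𝓡 m) x) :
    mvfderiv (𝓡 m) (fun y => inner ℝ (W y) (Z y)) x v =
      inner ℝ (covAlong φ W x v) (Z x) + inner ℝ (W x) (covAlong φ Z x v) :=
  mvfderiv_inner (chartAt_mem _) (mem_chart_source _ _) (hφ x) hW hZ v

theorem mvfderiv_inner_leviCivita {V U : ∀ x : M, TangentSpace (𝓡 m) x}
    (hV : SmoothFieldAt m (fun y : M => y) V x) (hU : SmoothFieldAt m (fun y : M => y) U x)
    (v : TangentSpace (𝓡 m) x) :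
    mvfderiv (𝓡 m) (fun y => inner ℝ (V y) (U y)) x v =
      inner ℝ (leviCivita V x v) (U x) + inner ℝ (V x) (leviCivita U x v) :=
  mvfderiv_inner_covAlong (φ := fun y : M => y) contMDiff_id hV hU v

theorem contMDiffAt_inner (hφ : ContMDiff (𝓡 m) (𝓡 n) ∞ φ) (hW : SmoothFieldAt m φ W x)
    (hZ : SmoothFieldAt m φ Z x) :
    ContMDiffAt (𝓡 m) 𝓘(ℝ, ℝ) ∞ (fun y => inner ℝ (W y) (Z y)) x := by
  set d := chartAt (EuclideanSpace ℝ (Fin n)) (φ x)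
  have hd : d ∈ IsManifold.maximalAtlas (𝓡 n) ∞ N := chartAt_mem _
  have hx : φ x ∈ d.source := mem_chart_source _ _
  have hg : ∀ a b, ContMDiffAt (𝓡 m) 𝓘(ℝ, ℝ) ∞ (fun y => gram d (φ y) a b) x := fun a b =>
    ContMDiffAt.comp x (g := fun z => gram d z a b) (contMDiffAt_gram hd hx a b) (hφ x)
  have h : ContMDiffAt (𝓡 m) 𝓘(ℝ, ℝ) ∞ (fun y =>
      ∑ a, ∑ b, comp d (φ y) (W y) a * comp d (φ y) (Z y) b * gram d (φ y) a b) x :=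
    contMDiffAt_finsetSum fun a _ => contMDiffAt_finsetSum fun b _ =>
      ((hW a).mul (hZ b)).mul (hg a b)
  refine h.congr_of_eventuallyEq ?_
  filter_upwards [eventually_mem_source (hφ x) hx] with y hy
  rw [inner_eq_sum hd hy]

/-- The covariant derivative of a family of linear maps from the tangent spaces of `M` to the
tangent spaces of `N` along `φ`. -/
def covHom (Φ : ∀ x : M, TangentSpace (𝓡 m) x → TangentSpace (𝓡 n) (φ x)) (x : M)
    (u v : TangentSpace (𝓡 m) x) : TangentSpace (𝓡 n) (φ x) :=
  covAlong φ (fun y => Φ y (localExtension x v y)) x u - Φ x (leviCivita (localExtension x v) x u)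

/-- A family of linear maps from the tangent spaces of `M` to those of `N` along `φ`, smooth at
`x`. -/
structure IsSmoothHomAt (Φ : ∀ x : M, TangentSpace (𝓡 m) x → TangentSpace (𝓡 n) (φ x)) (x : M) :
    Prop where
  linear : ∀ y, IsLinearMap ℝ (Φ y)
  smooth : ∀ j, SmoothFieldAt m φ
    (fun y => Φ y (coordVec (chartAt (EuclideanSpace ℝ (Fin m)) x) j y)) x

variable {Φ : ∀ x : M, TangentSpace (𝓡 m) x → TangentSpace (𝓡 n) (φ x)}

theorem map_sum_smul_of_isLinearMap {E F : Type*} [AddCommGroup E] [Module ℝ E] [AddCommGroup F]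
    [Module ℝ F] {f : E → F} (hf : IsLinearMap ℝ f) {ι : Type*} (s : Finset ι) (r : ι → ℝ)
    (v : ι → E) : f (∑ i ∈ s, r i • v i) = ∑ i ∈ s, r i • f (v i) := by
  have h := map_sum (IsLinearMap.mk' f hf) (fun i => r i • v i) s
  simp only [map_smul] at h
  exact h

theorem IsSmoothHomAt.eventually_eq (hΦ : IsSmoothHomAt Φ x) (V : ∀ x : M, TangentSpace (𝓡 m) x)
    (hc : c ∈ IsManifold.maximalAtlas (𝓡 m) ∞ M) (hx : x ∈ c.source) :
    ∀ᶠ y in 𝓝 x, Φ y (V y) = ∑ j, comp c y (V y) j • Φ y (coordVec c j y) := by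
  filter_upwards [c.open_source.mem_nhds hx] with y hy
  rw [← map_sum_smul_of_isLinearMap (hΦ.linear y), sum_comp_smul_coordVec hc hy]

theorem IsSmoothHomAt.smoothFieldAt (hΦ : IsSmoothHomAt Φ x) {V : ∀ x : M, TangentSpace (𝓡 m) x}
    (hV : SmoothFieldAt m (fun y : M => y) V x) : SmoothFieldAt m φ (fun y => Φ y (V y)) x :=
  SmoothFieldAt.congr (SmoothFieldAt.sum_smul Finset.univ
    (fun j => hV.contMDiffAt_comp (chartAt_mem x) (mem_chart_source _ x) j) hΦ.smooth)
    (hΦ.eventually_eq V (chartAt_mem x) (mem_chart_source _ x))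

/-- The Leibniz terms containing derivatives of the components of V occur in both covariant
derivatives and cancel, so only V x survives. Tensoriality and linearity of `covHom` in its last
argument follow. -/
theorem covAlong_sub_eq_sum (hΦ : IsSmoothHomAt Φ x) {V : ∀ x : M, TangentSpace (𝓡 m) x}
    (hV : SmoothFieldAt m (fun y : M => y) V x)
    (hc : c ∈ IsManifold.maximalAtlas (𝓡 m) ∞ M) (hx : x ∈ c.source) (u : TangentSpace (𝓡 m) x) :
    covAlong φ (fun y => Φ y (V y)) x u - Φ x (leviCivita V x u) =
      ∑ j, comp c x (V x) j • (covAlong φ (fun y => Φ y (coordVec c j y)) x u -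
        Φ x (leviCivita (coordVec c j) x u)) := by
  have hVj := fun j => hV.contMDiffAt_comp hc hx j
  have hcv := fun j => smoothFieldAt_coordVec hc hx j
  have e1 := covAlong_congr (hΦ.eventually_eq V hc hx) u
  rw [covAlong_sum_smul _ hVj (fun j => hΦ.smoothFieldAt (hcv j))] at e1
  have e2 : leviCivita V x u = _ := covAlong_congr (φ := fun y : M => y)
    (eventually_eq_sum_coordVec (φ := fun y : M => y) contMDiffAt_id hc hx V) u
  rw [covAlong_sum_smul (φ := fun y : M => y) _ hVj hcv] at e2
  rw [e1, e2, Finset.sum_add_distrib, Finset.sum_add_distrib, (hΦ.linear x).map_add,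
    map_sum_smul_of_isLinearMap (hΦ.linear x), map_sum_smul_of_isLinearMap (hΦ.linear x)]
  simp only [smul_sub, Finset.sum_sub_distrib]
  rw [add_sub_add_left_eq_sub]
  rfl

/-- `covHom` is tensorial: any smooth extension of the vector may be used. -/
theorem covHom_eq (hΦ : IsSmoothHomAt Φ x) {V : ∀ x : M, TangentSpace (𝓡 m) x}
    (hV : SmoothFieldAt m (fun y : M => y) V x) (u : TangentSpace (𝓡 m) x) :
    covHom Φ x u (V x) = covAlong φ (fun y => Φ y (V y)) x u - Φ x (leviCivita V x u) := by
  rw [covAlong_sub_eq_sum hΦ hV (chartAt_mem x) (mem_chart_source _ x), covHom,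
    covAlong_sub_eq_sum hΦ (smoothFieldAt_localExtension (V x)) (chartAt_mem x)
      (mem_chart_source _ x), localExtension_self]

theorem covHom_add_left (hΦ : IsSmoothHomAt Φ x) (u u' v : TangentSpace (𝓡 m) x) :
    covHom Φ x (u + u') v = covHom Φ x u v + covHom Φ x u' v := by
  unfold covHom leviCivita
  rw [covAlong_add_vec, covAlong_add_vec (φ := fun y : M => y), (hΦ.linear x).map_add]
  abel

theorem covHom_smul_left (hΦ : IsSmoothHomAt Φ x) (r : ℝ) (u v : TangentSpace (𝓡 m) x) :
    covHom Φ x (r • u) v = r • covHom Φ x u v := by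
  unfold covHom leviCivita
  rw [covAlong_smul_vec, covAlong_smul_vec (φ := fun y : M => y), (hΦ.linear x).map_smul, smul_sub]

theorem covHom_add_right (hΦ : IsSmoothHomAt Φ x) (u v v' : TangentSpace (𝓡 m) x) :
    covHom Φ x u (v + v') = covHom Φ x u v + covHom Φ x u v' := by
  have h := fun w => covAlong_sub_eq_sum hΦ (smoothFieldAt_localExtension w) (chartAt_mem x)
      (mem_chart_source _ x) u
  simp only [covHom, h, localExtension_self, comp_add, PiLp.add_apply, add_smul,
    Finset.sum_add_distrib]

theorem covHom_smul_right (hΦ : IsSmoothHomAt Φ x) (r : ℝ) (u v : TangentSpace (𝓡 m) x) :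
    covHom Φ x u (r • v) = r • covHom Φ x u v := by
  have h := fun w => covAlong_sub_eq_sum hΦ (smoothFieldAt_localExtension w) (chartAt_mem x)
      (mem_chart_source _ x) u
  simp only [covHom, h, localExtension_self, comp_smul, PiLp.smul_apply, smul_eq_mul, mul_smul,
    Finset.smul_sum]

end Covariant

/-! ### Smoothness of covariant derivatives -/

section SmoothCovariant

variable {m n : ℕ} {M N : Type*}
  [TopologicalSpace M] [ChartedSpace (EuclideanSpace ℝ (Fin m)) M] [IsManifold (𝓡 m) ∞ M]
  [Bundle.RiemannianBundle (fun x : M => TangentSpace (𝓡 m) x)]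
  [IsContMDiffRiemannianBundle (𝓡 m) ∞ (EuclideanSpace ℝ (Fin m))
      (fun x : M => TangentSpace (𝓡 m) x)]
  [TopologicalSpace N] [ChartedSpace (EuclideanSpace ℝ (Fin n)) N] [IsManifold (𝓡 n) ∞ N]
  [Bundle.RiemannianBundle (fun y : N => TangentSpace (𝓡 n) y)]
  [IsContMDiffRiemannianBundle (𝓡 n) ∞ (EuclideanSpace ℝ (Fin n))
      (fun y : N => TangentSpace (𝓡 n) y)]
  {c : OpenPartialHomeomorph M (EuclideanSpace ℝ (Fin m))} {φ : M → N}
  {W Z : ∀ x : M, TangentSpace (𝓡 n) (φ x)} {x : M}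
  {Φ : ∀ x : M, TangentSpace (𝓡 m) x → TangentSpace (𝓡 n) (φ x)}

theorem SmoothFieldAt.add (hW : SmoothFieldAt m φ W x) (hZ : SmoothFieldAt m φ Z x) :
    SmoothFieldAt m φ (fun y => W y + Z y) x := SmoothAlong.add hW hZ

theorem SmoothFieldAt.smul {f : M → ℝ} (hf : ContMDiffAt (𝓡 m) 𝓘(ℝ, ℝ) ∞ f x)
    (hW : SmoothFieldAt m φ W x) : SmoothFieldAt m φ (fun y => f y • W y) x :=
  SmoothAlong.smul hf hW

theorem SmoothFieldAt.sub (hW : SmoothFieldAt m φ W x) (hZ : SmoothFieldAt m φ Z x) :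
    SmoothFieldAt m φ (fun y => W y - Z y) x := by
  have h := hW.add (hZ.smul (contMDiffAt_const (c := (-1 : ℝ))))
  exact h.congr (Eventually.of_forall fun y => by rw [neg_one_smul, sub_eq_add_neg])

/-- By unfolding, the second fundamental form is `covHom` of dφ; this makes all results on `covHom`
available for it. -/
theorem isSmoothHomAt_mfderiv (hφ : ContMDiff (𝓡 m) (𝓡 n) ∞ φ) (x : M) :
    IsSmoothHomAt (φ := φ) (fun y v => mfderiv (𝓡 m) (𝓡 n) φ y v) x where
  linear y := (mfderiv (𝓡 m) (𝓡 n) φ y).toLinearMap.isLinear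
  smooth j := smoothAlong_mfderiv_coordVec hφ (chartAt_mem x) (mem_chart_source _ x)
    (chartAt_mem _) (mem_chart_source _ _) j

/-- `covAlong` uses the preferred chart at φ y, which may jump with y. Chart independence allows a
single chart around φ x to be used for all nearby y, where the formula is visibly smooth. -/
theorem smoothFieldAt_covAlong_coordVec (hφ : ContMDiff (𝓡 m) (𝓡 n) ∞ φ)
    (hc : c ∈ IsManifold.maximalAtlas (𝓡 m) ∞ M) (hx : x ∈ c.source)
    (hW : ∀ᶠ y in 𝓝 x, SmoothFieldAt m φ W y) (i : Fin m) :
    SmoothFieldAt m φ (fun y => covAlong φ W y (coordVec c i y)) x := by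
  intro a
  set d := chartAt (EuclideanSpace ℝ (Fin n)) (φ x)
  have hd : d ∈ IsManifold.maximalAtlas (𝓡 n) ∞ N := chartAt_mem _
  have hxd : φ x ∈ d.source := mem_chart_source _ _
  have hWx : SmoothAlong m d φ W x := hW.self_of_nhds
  have hΓ : ∀ b k, ContMDiffAt (𝓡 m) 𝓘(ℝ, ℝ) ∞ (fun y => christoffel d (φ y) a b k) x :=
    fun b k => ContMDiffAt.comp x (g := fun z => christoffel d z a b k)
      (contMDiffAt_christoffel hd hxd a b k) (hφ x)
  have h : ContMDiffAt (𝓡 m) 𝓘(ℝ, ℝ) ∞ (fun y =>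
      coordDeriv c i (fun z => comp d (φ z) (W z) a) y
      + ∑ b, ∑ k, christoffel d (φ y) a b k
        * comp d (φ y) (mfderiv (𝓡 m) (𝓡 n) φ y (coordVec c i y)) b
          * comp d (φ y) (W y) k) x :=
    (contMDiffAt_coordDeriv hc hx (hWx a) i).add <| contMDiffAt_finsetSum fun b _ =>
      contMDiffAt_finsetSum fun k _ =>
        ((hΓ b k).mul (smoothAlong_mfderiv_coordVec hφ hc hx hd hxd i b)).mul (hWx k)
  refine h.congr_of_eventuallyEq ?_
  filter_upwards [eventually_mem_source (hφ x) hxd, hW] with y hy hWy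
  rw [covAlong_eq hφ hd hy (hWy.smoothAlong hφ hd hy), comp_covAlongIn hd hy]
  rfl

theorem eventually_smoothFieldAt_coordVec (hc : c ∈ IsManifold.maximalAtlas (𝓡 m) ∞ M)
    (hx : x ∈ c.source) (j : Fin m) :
    ∀ᶠ y in 𝓝 x, SmoothFieldAt m (fun y : M => y) (coordVec c j) y := by
  filter_upwards [c.open_source.mem_nhds hx] with y hy using smoothFieldAt_coordVec hc hy j

theorem smoothFieldAt_covHom_coordVec (hφ : ContMDiff (𝓡 m) (𝓡 n) ∞ φ)
    (hΦ : ∀ y, IsSmoothHomAt Φ y) (hc : c ∈ IsManifold.maximalAtlas (𝓡 m) ∞ M)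
    (hx : x ∈ c.source) (i j : Fin m) :
    SmoothFieldAt m φ (fun y => covHom Φ y (coordVec c i y) (coordVec c j y)) x := by
  have hV := eventually_smoothFieldAt_coordVec hc hx j
  have h1 := smoothFieldAt_covAlong_coordVec hφ hc hx
    (hV.mono fun y hy => (hΦ y).smoothFieldAt hy) i
  have h2 := (hΦ x).smoothFieldAt
    (smoothFieldAt_covAlong_coordVec (φ := fun y : M => y) contMDiff_id hc hx hV i)
  exact (h1.sub h2).congr (hV.mono fun y hy => covHom_eq (hΦ y) hy _)

end SmoothCovariant

/-! ### Traces and raising of indices in coordinates -/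

section Trace

variable {m : ℕ} {M : Type*}
  [TopologicalSpace M] [ChartedSpace (EuclideanSpace ℝ (Fin m)) M] [IsManifold (𝓡 m) ∞ M]
  [Bundle.RiemannianBundle (fun x : M => TangentSpace (𝓡 m) x)]
  [IsContMDiffRiemannianBundle (𝓡 m) ∞ (EuclideanSpace ℝ (Fin m))
      (fun x : M => TangentSpace (𝓡 m) x)]
  {c : OpenPartialHomeomorph M (EuclideanSpace ℝ (Fin m))} {x : M}

/-- Expanding ∂_k in the orthonormal basis and taking its j-th component says that the Gram matrix
times the right-hand side is the identity. -/
theorem gram_inv_eq_sum (hc : c ∈ IsManifold.maximalAtlas (𝓡 m) ∞ M) (hx : x ∈ c.source)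
    {ι : Type*} [Fintype ι] (e : OrthonormalBasis ι ℝ (TangentSpace (𝓡 m) x)) :
    (gram c x)⁻¹ = Matrix.of fun i j => ∑ a, comp c x (e a) i * comp c x (e a) j := by
  refine Matrix.inv_eq_right_inv (Matrix.ext fun k j => ?_)
  have h1 : ∀ a, inner ℝ (e a) (coordVec c k x) = ∑ i, gram c x k i * comp c x (e a) i := by
    intro a
    rw [inner_eq_sum hc hx]
    simp only [comp_coordVec hc hx, PiLp.single_apply, mul_ite, mul_one, mul_zero, ite_mul,
      zero_mul, Finset.sum_ite_eq', Finset.mem_univ, if_true]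
    exact Finset.sum_congr rfl fun i _ => by rw [gram_comm, mul_comm]
  have h2 := congrArg (fun v => comp c x v j) (e.sum_repr' (coordVec c k x))
  simp only [comp_sum, comp_smul, h1, comp_coordVec hc hx] at h2
  rw [PiLp.single_apply, WithLp.ofLp_sum, Finset.sum_apply] at h2
  simp only [PiLp.smul_apply, smul_eq_mul, Finset.sum_mul] at h2
  rw [Matrix.mul_apply, Matrix.one_apply]
  simp only [Matrix.of_apply, Finset.mul_sum]
  rw [Finset.sum_comm]
  simp only [← mul_assoc]
  rw [h2]
  exact if_congr eq_comm rfl rfl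

/-- The standard orthonormal bases are chosen pointwise with no continuity. This replaces them by
coordinate fields and the inverse Gram matrix, which are smooth, and shows that traces do not depend
on the basis. -/
theorem sum_orthonormalBasis_eq (hc : c ∈ IsManifold.maximalAtlas (𝓡 m) ∞ M) (hx : x ∈ c.source)
    {ι : Type*} [Fintype ι] (e : OrthonormalBasis ι ℝ (TangentSpace (𝓡 m) x))
    {F : Type*} [AddCommGroup F] [Module ℝ F]
    {b : TangentSpace (𝓡 m) x → TangentSpace (𝓡 m) x → F}
    (h₁ : ∀ v, IsLinearMap ℝ fun u => b u v) (h₂ : ∀ u, IsLinearMap ℝ (b u)) :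
    ∑ a, b (e a) (e a) = ∑ i, ∑ j, (gram c x)⁻¹ i j • b (coordVec c i x) (coordVec c j x) := by
  have h : ∀ a, b (e a) (e a) =
      ∑ i, ∑ j, (comp c x (e a) i * comp c x (e a) j) • b (coordVec c i x) (coordVec c j x) := by
    intro a
    conv_lhs => rw [← sum_comp_smul_coordVec hc hx (e a)]
    rw [map_sum_smul_of_isLinearMap (h₁ _)]
    refine Finset.sum_congr rfl fun i _ => ?_
    rw [map_sum_smul_of_isLinearMap (h₂ _), Finset.smul_sum]
    exact Finset.sum_congr rfl fun j _ => by rw [mul_smul]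
  simp only [h, gram_inv_eq_sum hc hx e, Matrix.of_apply, Finset.sum_smul]
  rw [Finset.sum_comm]
  exact Finset.sum_congr rfl fun i _ => Finset.sum_comm

theorem inner_sharp {β : TangentSpace (𝓡 m) x → TangentSpace (𝓡 m) x → ℝ}
    (u : TangentSpace (𝓡 m) x) (h : IsLinearMap ℝ (β u)) (w : TangentSpace (𝓡 m) x) :
    inner ℝ (sharp x β u) w = β u w := by
  unfold sharp
  rw [sum_inner]
  simp only [real_inner_smul_left]
  conv_rhs => rw [← (stdOrthonormalBasis ℝ (TangentSpace (𝓡 m) x)).sum_repr' w]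
  rw [map_sum_smul_of_isLinearMap h]
  exact Finset.sum_congr rfl fun i _ => mul_comm _ _

theorem isLinearMap_sharp {β : TangentSpace (𝓡 m) x → TangentSpace (𝓡 m) x → ℝ}
    (h : ∀ v, IsLinearMap ℝ fun u => β u v) : IsLinearMap ℝ (sharp x β) where
  map_add u v := by
    simp only [sharp, (h _).map_add, add_smul, Finset.sum_add_distrib]
  map_smul r v := by
    simp only [sharp, (h _).map_smul, smul_assoc, Finset.smul_sum]

theorem sharp_eq_sum (hc : c ∈ IsManifold.maximalAtlas (𝓡 m) ∞ M) (hx : x ∈ c.source)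
    {β : TangentSpace (𝓡 m) x → TangentSpace (𝓡 m) x → ℝ}
    (u : TangentSpace (𝓡 m) x) (h : IsLinearMap ℝ (β u)) :
    sharp x β u = ∑ j, (∑ i, (gram c x)⁻¹ i j * β u (coordVec c i x)) • coordVec c j x := by
  have key := sum_orthonormalBasis_eq hc hx (stdOrthonormalBasis ℝ (TangentSpace (𝓡 m) x))
    (b := fun v w => β u v • w)
    (fun w => ⟨fun a b => by rw [h.map_add, add_smul],
      fun r a => by rw [h.map_smul, smul_assoc]⟩)
    (fun v => ⟨fun a b => smul_add _ _ _, fun r a => smul_comm _ _ _⟩)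
  refine key.trans ?_
  rw [Finset.sum_comm]
  refine Finset.sum_congr rfl fun j _ => ?_
  rw [Finset.sum_smul]
  exact Finset.sum_congr rfl fun i _ => by rw [smul_smul]

theorem isSmoothHomAt_sharp {β : ∀ y : M, TangentSpace (𝓡 m) y → TangentSpace (𝓡 m) y → ℝ}
    (h₁ : ∀ y v, IsLinearMap ℝ fun u => β y u v) (h₂ : ∀ y u, IsLinearMap ℝ (β y u))
    (hs : ∀ i j, ContMDiffAt (𝓡 m) 𝓘(ℝ, ℝ) ∞ (fun y =>
      β y (coordVec (chartAt (EuclideanSpace ℝ (Fin m)) x) i y)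
        (coordVec (chartAt (EuclideanSpace ℝ (Fin m)) x) j y)) x) :
    IsSmoothHomAt (φ := fun y : M => y) (fun y => sharp y (β y)) x where
  linear y := isLinearMap_sharp (h₁ y)
  smooth k := by
    set c := chartAt (EuclideanSpace ℝ (Fin m)) x
    have hc : c ∈ IsManifold.maximalAtlas (𝓡 m) ∞ M := chartAt_mem x
    have hx : x ∈ c.source := mem_chart_source _ x
    have h := SmoothFieldAt.sum_smul (φ := fun y : M => y) Finset.univ
      (f := fun j y => ∑ i, (gram c y)⁻¹ i j * β y (coordVec c k y) (coordVec c i y))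
      (fun j => contMDiffAt_finsetSum fun i _ =>
        contMDiffAt_fun_mul (contMDiffAt_gram_inv hc hx i j) (hs k i))
      (fun j => smoothFieldAt_coordVec hc hx j)
    refine h.congr ?_
    filter_upwards [c.open_source.mem_nhds hx] with y hy
    exact sharp_eq_sum hc hy _ (h₂ y _)

end Trace

/-! ### Second fundamental form, tension field and shape operator -/

section Submanifold

variable {m n : ℕ} {M N : Type*}
  [TopologicalSpace M] [ChartedSpace (EuclideanSpace ℝ (Fin m)) M] [IsManifold (𝓡 m) ∞ M]
  [Bundle.RiemannianBundle (fun x : M => TangentSpace (𝓡 m) x)]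
  [IsContMDiffRiemannianBundle (𝓡 m) ∞ (EuclideanSpace ℝ (Fin m))
      (fun x : M => TangentSpace (𝓡 m) x)]
  [TopologicalSpace N] [ChartedSpace (EuclideanSpace ℝ (Fin n)) N] [IsManifold (𝓡 n) ∞ N]
  [Bundle.RiemannianBundle (fun y : N => TangentSpace (𝓡 n) y)]
  [IsContMDiffRiemannianBundle (𝓡 n) ∞ (EuclideanSpace ℝ (Fin n))
      (fun y : N => TangentSpace (𝓡 n) y)]
  {c : OpenPartialHomeomorph M (EuclideanSpace ℝ (Fin m))} {φ : M → N} {x : M}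

theorem isLinearMap_secondFundForm_left (hφ : ContMDiff (𝓡 m) (𝓡 n) ∞ φ)
    (v : TangentSpace (𝓡 m) x) : IsLinearMap ℝ fun u => secondFundForm m n φ x u v :=
  ⟨fun a b => covHom_add_left (isSmoothHomAt_mfderiv hφ x) a b v,
    fun r a => covHom_smul_left (isSmoothHomAt_mfderiv hφ x) r a v⟩

theorem isLinearMap_secondFundForm_right (hφ : ContMDiff (𝓡 m) (𝓡 n) ∞ φ)
    (u : TangentSpace (𝓡 m) x) : IsLinearMap ℝ (secondFundForm m n φ x u) :=
  ⟨fun a b => covHom_add_right (isSmoothHomAt_mfderiv hφ x) u a b,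
    fun r a => covHom_smul_right (isSmoothHomAt_mfderiv hφ x) r u a⟩

theorem secondFundForm_eq_sum (hφ : ContMDiff (𝓡 m) (𝓡 n) ∞ φ)
    (hc : c ∈ IsManifold.maximalAtlas (𝓡 m) ∞ M) (hx : x ∈ c.source) (u v : TangentSpace (𝓡 m) x) :
    secondFundForm m n φ x u v = ∑ i, ∑ j, comp c x u i •
      comp c x v j • secondFundForm m n φ x (coordVec c i x) (coordVec c j x) := by
  conv_lhs => rw [← sum_comp_smul_coordVec hc hx u, ← sum_comp_smul_coordVec hc hx v]
  rw [map_sum_smul_of_isLinearMap (isLinearMap_secondFundForm_left hφ _)]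
  refine Finset.sum_congr rfl fun i _ => ?_
  rw [map_sum_smul_of_isLinearMap (isLinearMap_secondFundForm_right hφ _), Finset.smul_sum]

theorem leviCivita_coordVec_comm (hc : c ∈ IsManifold.maximalAtlas (𝓡 m) ∞ M)
    (hx : x ∈ c.source) (i j : Fin m) :
    leviCivita (coordVec c j) x (coordVec c i x) = leviCivita (coordVec c i) x (coordVec c j x) := by
  have h := covAlongIn_mfderiv_coordVec_comm (φ := fun y : M => y) contMDiff_id hc hx
    (chartAt_mem x) (mem_chart_source _ x) i j
  simp only [mfderiv_id_apply] at h
  exact h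

theorem secondFundForm_coordVec (hφ : ContMDiff (𝓡 m) (𝓡 n) ∞ φ)
    (hc : c ∈ IsManifold.maximalAtlas (𝓡 m) ∞ M) (hx : x ∈ c.source) (i j : Fin m) :
    secondFundForm m n φ x (coordVec c i x) (coordVec c j x) =
      covAlong φ (fun y => mfderiv (𝓡 m) (𝓡 n) φ y (coordVec c j y)) x (coordVec c i x) -
        mfderiv (𝓡 m) (𝓡 n) φ x (leviCivita (coordVec c j) x (coordVec c i x)) :=
  covHom_eq (isSmoothHomAt_mfderiv hφ x) (smoothFieldAt_coordVec hc hx j) _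

/-- On coordinate fields both terms of B are symmetric, because the pulled-back and the Levi-Civita
connections are torsion free. -/
theorem secondFundForm_comm (hφ : ContMDiff (𝓡 m) (𝓡 n) ∞ φ) (u v : TangentSpace (𝓡 m) x) :
    secondFundForm m n φ x u v = secondFundForm m n φ x v u := by
  have hc : chartAt (EuclideanSpace ℝ (Fin m)) x ∈ IsManifold.maximalAtlas (𝓡 m) ∞ M :=
    chartAt_mem x
  have hx := mem_chart_source (EuclideanSpace ℝ (Fin m)) x
  rw [secondFundForm_eq_sum hφ hc hx, secondFundForm_eq_sum hφ hc hx v, Finset.sum_comm]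
  refine Finset.sum_congr rfl fun j _ => Finset.sum_congr rfl fun i _ => ?_
  rw [smul_comm, secondFundForm_coordVec hφ hc hx, secondFundForm_coordVec hφ hc hx,
    leviCivita_coordVec_comm hc hx]
  congr 3
  exact covAlongIn_mfderiv_coordVec_comm hφ hc hx (chartAt_mem _) (mem_chart_source _ _) i j

/-- For an isometric immersion the tangential part of ∇_i(dφ ∂_j) and the vector dφ(∇_i ∂_j) are
given by the same Koszul expression, so B is normal. -/
theorem inner_secondFundForm_mfderiv (hφ : IsRiemannianImmersion m n φ)
    (u v w : TangentSpace (𝓡 m) x) :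
    inner ℝ (secondFundForm m n φ x u v) (mfderiv (𝓡 m) (𝓡 n) φ x w) = 0 := by
  have hc : chartAt (EuclideanSpace ℝ (Fin m)) x ∈ IsManifold.maximalAtlas (𝓡 m) ∞ M :=
    chartAt_mem x
  have hx := mem_chart_source (EuclideanSpace ℝ (Fin m)) x
  have key : ∀ i j k, inner ℝ (secondFundForm m n φ x
      (coordVec (chartAt (EuclideanSpace ℝ (Fin m)) x) i x)
      (coordVec (chartAt (EuclideanSpace ℝ (Fin m)) x) j x))
      (mfderiv (𝓡 m) (𝓡 n) φ x (coordVec (chartAt (EuclideanSpace ℝ (Fin m)) x) k x)) = 0 := by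
    intro i j k
    rw [secondFundForm_coordVec hφ.1 hc hx, inner_sub_left, hφ.2]
    exact sub_eq_zero.2 ((koszul_formula hφ.1 hφ.2 hc hx (chartAt_mem _)
      (mem_chart_source _ _) i j k).trans
        (koszul_formula_id hc hx (chartAt_mem x) (mem_chart_source _ x) i j k).symm)
  rw [secondFundForm_eq_sum hφ.1 hc hx, ← sum_comp_smul_coordVec hc hx w,
    map_sum_smul_of_isLinearMap ((isSmoothHomAt_mfderiv hφ.1 x).linear x)]
  simp only [sum_inner, inner_sum, real_inner_smul_left, real_inner_smul_right, key, mul_zero,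
    Finset.sum_const_zero]

theorem inner_tension_mfderiv (hφ : IsRiemannianImmersion m n φ) (w : TangentSpace (𝓡 m) x) :
    inner ℝ (tension m n φ x) (mfderiv (𝓡 m) (𝓡 n) φ x w) = 0 := by
  unfold tension
  rw [sum_inner]
  exact Finset.sum_eq_zero fun i _ => inner_secondFundForm_mfderiv hφ _ _ _

theorem smoothFieldAt_secondFundForm_coordVec (hφ : ContMDiff (𝓡 m) (𝓡 n) ∞ φ)
    (hc : c ∈ IsManifold.maximalAtlas (𝓡 m) ∞ M) (hx : x ∈ c.source) (i j : Fin m) :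
    SmoothFieldAt m φ (fun y => secondFundForm m n φ y (coordVec c i y) (coordVec c j y)) x :=
  smoothFieldAt_covHom_coordVec hφ (isSmoothHomAt_mfderiv hφ) hc hx i j

theorem tension_eq_sum (hφ : ContMDiff (𝓡 m) (𝓡 n) ∞ φ)
    (hc : c ∈ IsManifold.maximalAtlas (𝓡 m) ∞ M) (hx : x ∈ c.source) :
    tension m n φ x = ∑ p : Fin m × Fin m, (gram c x)⁻¹ p.1 p.2 •
      secondFundForm m n φ x (coordVec c p.1 x) (coordVec c p.2 x) := by
  rw [Fintype.sum_prod_type]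
  exact sum_orthonormalBasis_eq hc hx _ (isLinearMap_secondFundForm_left hφ)
    (isLinearMap_secondFundForm_right hφ)

theorem smoothFieldAt_tension (hφ : ContMDiff (𝓡 m) (𝓡 n) ∞ φ) (x : M) :
    SmoothFieldAt m φ (tension m n φ) x := by
  have hc : chartAt (EuclideanSpace ℝ (Fin m)) x ∈ IsManifold.maximalAtlas (𝓡 m) ∞ M :=
    chartAt_mem x
  have hx := mem_chart_source (EuclideanSpace ℝ (Fin m)) x
  have h := SmoothFieldAt.sum_smul Finset.univ
    (fun p : Fin m × Fin m => contMDiffAt_gram_inv hc hx p.1 p.2)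
    (fun p => smoothFieldAt_secondFundForm_coordVec hφ hc hx p.1 p.2)
  refine h.congr ?_
  filter_upwards [(chartAt (EuclideanSpace ℝ (Fin m)) x).open_source.mem_nhds hx] with y hy
  exact tension_eq_sum hφ hc hy

theorem meanCurvature_eq_smul_tension (x : M) :
    meanCurvature m n φ x = (1 / (m : ℝ)) • tension m n φ x := rfl

theorem smoothFieldAt_meanCurvature (hφ : ContMDiff (𝓡 m) (𝓡 n) ∞ φ) (x : M) :
    SmoothFieldAt m φ (meanCurvature m n φ) x :=
  (smoothFieldAt_tension hφ x).smul (contMDiffAt_const (c := 1 / (m : ℝ)))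

theorem contMDiffAt_inner_meanCurvature (hφ : ContMDiff (𝓡 m) (𝓡 n) ∞ φ) (x : M) :
    ContMDiffAt (𝓡 m) 𝓘(ℝ, ℝ) ∞
      (fun y => inner ℝ (meanCurvature m n φ y) (meanCurvature m n φ y)) x :=
  contMDiffAt_inner hφ (smoothFieldAt_meanCurvature hφ x) (smoothFieldAt_meanCurvature hφ x)

/-- Differentiating `⟨dφ U, τ⟩ = 0`. -/
theorem inner_mfderiv_covAlong_tension (hφ : IsRiemannianImmersion m n φ)
    (u v : TangentSpace (𝓡 m) x) :
    inner ℝ (mfderiv (𝓡 m) (𝓡 n) φ x u) (covAlong φ (tension m n φ) x v) =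
      -inner ℝ (secondFundForm m n φ x v u) (tension m n φ x) := by
  have hU := smoothFieldAt_localExtension u
  have hΦ := isSmoothHomAt_mfderiv hφ.1 x
  have h := mvfderiv_inner_covAlong hφ.1 (hΦ.smoothFieldAt hU) (smoothFieldAt_tension hφ.1 x) v
  have h0 : (fun y => inner ℝ (mfderiv (𝓡 m) (𝓡 n) φ y (localExtension x u y))
      (tension m n φ y)) = fun _ => (0 : ℝ) := by
    funext y
    rw [real_inner_comm, inner_tension_mfderiv hφ]
  have h1 := mvfderiv_const_apply (m := m) (M := M) (x := x) 0 v
  rw [← h0] at h1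
  rw [h1, localExtension_self] at h
  unfold secondFundForm
  rw [inner_sub_left, real_inner_comm (tension m n φ x) (mfderiv (𝓡 m) (𝓡 n) φ x _),
    inner_tension_mfderiv hφ]
  linarith

theorem isLinearMap_inner_left {V : Type*} [NormedAddCommGroup V] [InnerProductSpace ℝ V]
    {E : Type*} [AddCommGroup E] [Module ℝ E] {f : E → V} (hf : IsLinearMap ℝ f) (w : V) :
    IsLinearMap ℝ fun u => inner ℝ (f u) w :=
  ⟨fun a b => by rw [hf.map_add, inner_add_left],
    fun r a => by rw [hf.map_smul, real_inner_smul_left, smul_eq_mul]⟩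

theorem inner_shapeOperatorH (hφ : ContMDiff (𝓡 m) (𝓡 n) ∞ φ) (u w : TangentSpace (𝓡 m) x) :
    inner ℝ (shapeOperatorH m n φ x u) w =
      inner ℝ (secondFundForm m n φ x u w) (meanCurvature m n φ x) :=
  inner_sharp u (isLinearMap_inner_left (isLinearMap_secondFundForm_right hφ u) _) w

theorem isSmoothHomAt_shapeOperatorH (hφ : ContMDiff (𝓡 m) (𝓡 n) ∞ φ) (x : M) :
    IsSmoothHomAt (φ := fun y : M => y) (shapeOperatorH m n φ) x :=
  isSmoothHomAt_sharp
    (fun _ v => isLinearMap_inner_left (isLinearMap_secondFundForm_left hφ v) _)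
    (fun _ u => isLinearMap_inner_left (isLinearMap_secondFundForm_right hφ u) _)
    fun i j => contMDiffAt_inner hφ
      (smoothFieldAt_secondFundForm_coordVec hφ (chartAt_mem x) (mem_chart_source _ x) i j)
      (smoothFieldAt_meanCurvature hφ x)

theorem inner_shapeOperatorH_comm (hφ : ContMDiff (𝓡 m) (𝓡 n) ∞ φ)
    (u w : TangentSpace (𝓡 m) x) :
    inner ℝ (shapeOperatorH m n φ x u) w = inner ℝ (shapeOperatorH m n φ x w) u := by
  rw [inner_shapeOperatorH hφ, inner_shapeOperatorH hφ, secondFundForm_comm hφ]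

end Submanifold

/-! ### The stress-bienergy tensor of a surface -/

section Surface

variable {n : ℕ} {M N : Type*}
  [TopologicalSpace M] [ChartedSpace (EuclideanSpace ℝ (Fin 2)) M] [IsManifold (𝓡 2) ∞ M]
  [Bundle.RiemannianBundle (fun x : M => TangentSpace (𝓡 2) x)]
  [IsContMDiffRiemannianBundle (𝓡 2) ∞ (EuclideanSpace ℝ (Fin 2))
      (fun x : M => TangentSpace (𝓡 2) x)]
  [TopologicalSpace N] [ChartedSpace (EuclideanSpace ℝ (Fin n)) N] [IsManifold (𝓡 n) ∞ N]
  [Bundle.RiemannianBundle (fun y : N => TangentSpace (𝓡 n) y)]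
  [IsContMDiffRiemannianBundle (𝓡 n) ∞ (EuclideanSpace ℝ (Fin n))
      (fun y : N => TangentSpace (𝓡 n) y)]
  {c : OpenPartialHomeomorph M (EuclideanSpace ℝ (Fin 2))} {φ : M → N} {x : M}

theorem tension_eq_two_smul (x : M) : tension 2 n φ x = (2 : ℝ) • meanCurvature 2 n φ x := by
  rw [meanCurvature_eq_smul_tension, smul_smul]
  norm_num

theorem sum_inner_shapeOperatorH (hφ : ContMDiff (𝓡 2) (𝓡 n) ∞ φ) (x : M) :
    ∑ i, inner ℝ (shapeOperatorH 2 n φ x (stdOrthonormalBasis ℝ (TangentSpace (𝓡 2) x) i))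
        (stdOrthonormalBasis ℝ (TangentSpace (𝓡 2) x) i) =
      2 * inner ℝ (meanCurvature 2 n φ x) (meanCurvature 2 n φ x) := by
  simp only [inner_shapeOperatorH hφ]
  rw [← sum_inner, ← real_inner_smul_left, ← tension_eq_two_smul]
  rfl

/-- Substituting ⟨dφ u, ∇_v τ⟩ = -⟨B(v, u), τ⟩, the scalar part is ½|τ|² - |τ|² = -2|H|², and the
last two terms add up to 2⟨B(u, v), τ⟩ = 4⟨A_H u, v⟩. -/
theorem stressBienergy_eq (hφ : IsRiemannianImmersion 2 n φ) (x : M)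
    (u : TangentSpace (𝓡 2) x) :
    stressBienergy 2 n φ x u =
      (-2 * inner ℝ (meanCurvature 2 n φ x) (meanCurvature 2 n φ x)) • u +
        (4 : ℝ) • shapeOperatorH 2 n φ x u := by
  refine ext_inner_right ℝ fun w => ?_
  have hsum : ∑ i, inner ℝ (secondFundForm 2 n φ x
      (stdOrthonormalBasis ℝ (TangentSpace (𝓡 2) x) i)
      (stdOrthonormalBasis ℝ (TangentSpace (𝓡 2) x) i)) (tension 2 n φ x) =
      inner ℝ (tension 2 n φ x) (tension 2 n φ x) := by
    rw [← sum_inner]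
    rfl
  unfold stressBienergy
  simp only [inner_mfderiv_covAlong_tension hφ, Finset.sum_neg_distrib, hsum]
  rw [inner_sharp]
  · rw [inner_add_left, real_inner_smul_left, real_inner_smul_left, inner_shapeOperatorH hφ.1,
      secondFundForm_comm hφ.1 w u, tension_eq_two_smul, ← real_inner_self_eq_norm_sq,
      real_inner_smul_left, real_inner_smul_right, real_inner_smul_right]
    ring
  · refine ⟨fun a b => ?_, fun r a => ?_⟩
    · rw [inner_add_right, (isLinearMap_secondFundForm_left hφ.1 u).map_add,
        (isLinearMap_secondFundForm_right hφ.1 u).map_add, inner_add_left, inner_add_left]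
      ring
    · rw [real_inner_smul_right, (isLinearMap_secondFundForm_left hφ.1 u).map_smul,
        (isLinearMap_secondFundForm_right hφ.1 u).map_smul, real_inner_smul_left,
        real_inner_smul_left, smul_eq_mul]
      ring

/-- `∇(h I + r T) = dh ⊗ I + r ∇T`. -/
theorem covTensor_smul_id_add {T : ∀ x : M, TangentSpace (𝓡 2) x → TangentSpace (𝓡 2) x}
    (hT : IsSmoothHomAt (φ := fun y : M => y) T x) {f : M → ℝ}
    (hf : ContMDiffAt (𝓡 2) 𝓘(ℝ, ℝ) ∞ f x) (r : ℝ) (u v : TangentSpace (𝓡 2) x) :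
    covTensor (fun y w => f y • w + r • T y w) x u v =
      mvfderiv (𝓡 2) f x u • v + r • covTensor T x u v := by
  have hV := smoothFieldAt_localExtension v
  have hTV := hT.smoothFieldAt hV
  have h : leviCivita (fun y => f y • localExtension x v y + r • T y (localExtension x v y)) x u =
      (mvfderiv (𝓡 2) f x u • localExtension x v x + f x • leviCivita (localExtension x v) x u) +
        r • leviCivita (fun y => T y (localExtension x v y)) x u := by
    unfold leviCivita
    rw [covAlong_add (φ := fun y : M => y) (hV.smul hf) (hTV.smul contMDiffAt_const),
      covAlong_smul (φ := fun y : M => y) hf hV, covAlong_const_smul (φ := fun y : M => y) r hTV]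
  unfold covTensor
  rw [h, localExtension_self, smul_sub]
  have key : ∀ a b c d : TangentSpace (𝓡 2) x, a + b + c - (b + d) = a + (c - d) := by
    intros
    abel
  exact key _ _ _ _

theorem inner_divTensor_smul_id_add {T : ∀ x : M, TangentSpace (𝓡 2) x → TangentSpace (𝓡 2) x}
    (hT : IsSmoothHomAt (φ := fun y : M => y) T x) {f : M → ℝ}
    (hf : ContMDiffAt (𝓡 2) 𝓘(ℝ, ℝ) ∞ f x) (r : ℝ) (w : TangentSpace (𝓡 2) x) :
    inner ℝ (divTensor (fun y w => f y • w + r • T y w) x) w =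
      mvfderiv (𝓡 2) f x w + r * inner ℝ (divTensor T x) w := by
  unfold divTensor
  simp only [covTensor_smul_id_add hT hf, Finset.sum_add_distrib, inner_add_left, ← Finset.smul_sum,
    real_inner_smul_left]
  congr 1
  rw [sum_inner]
  conv_rhs => rw [← (stdOrthonormalBasis ℝ (TangentSpace (𝓡 2) x)).sum_repr' w, map_sum]
  exact Finset.sum_congr rfl fun i _ => by
    rw [real_inner_smul_left, map_smul, smul_eq_mul, mul_comm]

/-- The divergence of f I is grad f, applied to S₂ = -2|H|² I + 4 A_H. -/
theorem inner_divTensor_stressBienergy (hφ : IsRiemannianImmersion 2 n φ) (x : M)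
    (w : TangentSpace (𝓡 2) x) :
    inner ℝ (divTensor (stressBienergy 2 n φ) x) w =
      4 * inner ℝ (divTensor (shapeOperatorH 2 n φ) x) w - 2 * mvfderiv (𝓡 2)
        (fun y => inner ℝ (meanCurvature 2 n φ y) (meanCurvature 2 n φ y)) x w := by
  have hf := contMDiffAt_inner_meanCurvature hφ.1 x
  have h : stressBienergy 2 n φ = fun y w =>
      (-2 * inner ℝ (meanCurvature 2 n φ y) (meanCurvature 2 n φ y)) • w +
        (4 : ℝ) • shapeOperatorH 2 n φ y w := by
    funext y w
    exact stressBienergy_eq hφ y w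
  rw [h, inner_divTensor_smul_id_add (isSmoothHomAt_shapeOperatorH hφ.1 x)
    (contMDiffAt_fun_mul contMDiffAt_const hf), mvfderiv_mul_apply contMDiffAt_const hf,
    mvfderiv_const_apply]
  ring

end Surface

/-! ### Trace, symmetry and divergence of (1,1) tensors -/

section TensorTrace

variable {m : ℕ} {M : Type*}
  [TopologicalSpace M] [ChartedSpace (EuclideanSpace ℝ (Fin m)) M] [IsManifold (𝓡 m) ∞ M]
  [Bundle.RiemannianBundle (fun x : M => TangentSpace (𝓡 m) x)]
  [IsContMDiffRiemannianBundle (𝓡 m) ∞ (EuclideanSpace ℝ (Fin m))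
      (fun x : M => TangentSpace (𝓡 m) x)]
  {c : OpenPartialHomeomorph M (EuclideanSpace ℝ (Fin m))} {x : M}
  {T : ∀ x : M, TangentSpace (𝓡 m) x → TangentSpace (𝓡 m) x}

/-- The trace of a tensor field of type `(1,1)`. -/
def traceTensor (T : ∀ x : M, TangentSpace (𝓡 m) x → TangentSpace (𝓡 m) x) (x : M) : ℝ :=
  ∑ a, inner ℝ (T x (stdOrthonormalBasis ℝ (TangentSpace (𝓡 m) x) a))
    (stdOrthonormalBasis ℝ (TangentSpace (𝓡 m) x) a)

theorem sum_inner_orthonormalBasis_eq (hc : c ∈ IsManifold.maximalAtlas (𝓡 m) ∞ M)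
    (hx : x ∈ c.source) {ι : Type*} [Fintype ι]
    (e : OrthonormalBasis ι ℝ (TangentSpace (𝓡 m) x))
    {L : TangentSpace (𝓡 m) x → TangentSpace (𝓡 m) x} (hL : IsLinearMap ℝ L) :
    ∑ a, inner ℝ (L (e a)) (e a) = ∑ j, comp c x (L (coordVec c j x)) j := by
  rw [sum_orthonormalBasis_eq hc hx e (b := fun u v => inner ℝ (L u) v)
    (fun v => isLinearMap_inner_left hL v)
    (fun u => ⟨fun a b => inner_add_right _ _ _, fun r a => real_inner_smul_right _ _ _⟩)]
  refine Finset.sum_congr rfl fun i _ => ?_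
  have h : ∀ j, inner ℝ (L (coordVec c i x)) (coordVec c j x) =
      ∑ k, comp c x (L (coordVec c i x)) k * gram c x k j := by
    intro j
    rw [inner_eq_sum hc hx]
    simp only [comp_coordVec hc hx, PiLp.single_apply, mul_ite, mul_one, mul_zero, ite_mul,
      zero_mul, Finset.sum_ite_eq', Finset.mem_univ, if_true]
  have hinv : ∀ k, ∑ j, gram c x k j * (gram c x)⁻¹ i j = if k = i then 1 else 0 := by
    intro k
    have hs : (gram c x)⁻¹.transpose = (gram c x)⁻¹ := by
      rw [Matrix.transpose_nonsing_inv]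
      congr 1
      exact Matrix.ext fun a b => gram_comm b a
    rw [← sum_gram_inv_mul hc hx k i]
    exact Finset.sum_congr rfl fun j _ => by rw [← congrFun (congrFun hs j) i]; rfl
  simp only [h, smul_eq_mul, Finset.mul_sum]
  rw [Finset.sum_comm]
  have h2 : ∀ k, ∑ j, (gram c x)⁻¹ i j * (comp c x (L (coordVec c i x)) k * gram c x k j) =
      comp c x (L (coordVec c i x)) k * if k = i then 1 else 0 := by
    intro k
    rw [← hinv k, Finset.mul_sum]
    exact Finset.sum_congr rfl fun j _ => by ring
  simp only [h2, mul_ite, mul_one, mul_zero, Finset.sum_ite_eq', Finset.mem_univ, if_true]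

theorem traceTensor_eq_sum (hc : c ∈ IsManifold.maximalAtlas (𝓡 m) ∞ M)
    (hx : x ∈ c.source) (hT : IsLinearMap ℝ (T x)) :
    traceTensor T x = ∑ j, comp c x (T x (coordVec c j x)) j :=
  sum_inner_orthonormalBasis_eq hc hx _ hT

/-- `covTensor` unfolds to `covHom` along the identity map, so bilinearity is inherited. -/
theorem isLinearMap_covTensor_left (hT : IsSmoothHomAt (φ := fun y : M => y) T x)
    (v : TangentSpace (𝓡 m) x) : IsLinearMap ℝ fun u => covTensor T x u v :=
  ⟨fun a b => covHom_add_left (φ := fun y : M => y) hT a b v,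
    fun r a => covHom_smul_left (φ := fun y : M => y) hT r a v⟩

theorem isLinearMap_covTensor_right (hT : IsSmoothHomAt (φ := fun y : M => y) T x)
    (u : TangentSpace (𝓡 m) x) : IsLinearMap ℝ (covTensor T x u) :=
  ⟨fun a b => covHom_add_right (φ := fun y : M => y) hT u a b,
    fun r a => covHom_smul_right (φ := fun y : M => y) hT r u a⟩

theorem comp_leviCivita (hc : c ∈ IsManifold.maximalAtlas (𝓡 m) ∞ M) (hx : x ∈ c.source)
    {V : ∀ x : M, TangentSpace (𝓡 m) x} (hV : SmoothFieldAt m (fun y : M => y) V x)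
    (v : TangentSpace (𝓡 m) x) (a : Fin m) :
    comp c x (leviCivita V x v) a = mvfderiv (𝓡 m) (fun y => comp c y (V y) a) x v +
      ∑ i, ∑ j, christoffel c x a i j * comp c x v i * comp c x (V x) j := by
  rw [leviCivita_eq hc hx (SmoothFieldAt.smoothAlong (φ := fun y : M => y) contMDiff_id hV hc hx)]
  refine (comp_covAlongIn (φ := fun y : M => y) hc hx v a).trans ?_
  simp only [mfderiv_id_apply]

theorem comp_leviCivita_coordVec (hc : c ∈ IsManifold.maximalAtlas (𝓡 m) ∞ M)
    (hx : x ∈ c.source) (v : TangentSpace (𝓡 m) x) (j a : Fin m) :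
    comp c x (leviCivita (coordVec c j) x v) a = ∑ i, christoffel c x a i j * comp c x v i := by
  have h0 : mvfderiv (𝓡 m) (fun y => comp c y (coordVec c j y) a) x v = 0 := by
    rw [← mvfderiv_const_apply (M := M) ((EuclideanSpace.single j (1 : ℝ)) a) v]
    refine mvfderiv_congr ?_ v
    filter_upwards [c.open_source.mem_nhds hx] with y hy
    rw [comp_coordVec hc hy]
  rw [comp_leviCivita hc hx (smoothFieldAt_coordVec hc hx j), h0, zero_add, comp_coordVec hc hx]
  simp only [PiLp.single_apply, mul_ite, mul_one, mul_zero, Finset.sum_ite_eq', Finset.mem_univ,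
    if_true]

/-- The trace commutes with covariant differentiation. -/
theorem sum_inner_covTensor (hT : ∀ y, IsSmoothHomAt (φ := fun y : M => y) T y) (x : M)
    {ι : Type*} [Fintype ι] (e : OrthonormalBasis ι ℝ (TangentSpace (𝓡 m) x))
    (u : TangentSpace (𝓡 m) x) :
    ∑ a, inner ℝ (covTensor T x u (e a)) (e a) = mvfderiv (𝓡 m) (traceTensor T) x u := by
  set c := chartAt (EuclideanSpace ℝ (Fin m)) x
  have hc : c ∈ IsManifold.maximalAtlas (𝓡 m) ∞ M := chartAt_mem x
  have hx : x ∈ c.source := mem_chart_source _ x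
  have hV := smoothFieldAt_coordVec hc hx
  have hTV := fun j => (hT x).smoothFieldAt (hV j)
  have h1 : mvfderiv (𝓡 m) (traceTensor T) x u =
      ∑ j, mvfderiv (𝓡 m) (fun y => comp c y (T y (coordVec c j y)) j) x u := by
    rw [← mvfderiv_sum_apply _ fun j => (hTV j).contMDiffAt_comp hc hx j]
    refine mvfderiv_congr ?_ u
    filter_upwards [c.open_source.mem_nhds hx] with y hy
    exact traceTensor_eq_sum hc hy ((hT y).linear y)
  have h2 : ∀ j, comp c x (T x (leviCivita (coordVec c j) x u)) j =
      ∑ k, (∑ i, christoffel c x k i j * comp c x u i) * comp c x (T x (coordVec c k x)) j := by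
    intro j
    have h := (hT x).linear x
    conv_lhs => rw [← sum_comp_smul_coordVec hc hx (leviCivita (coordVec c j) x u),
      map_sum_smul_of_isLinearMap h, comp_sum, WithLp.ofLp_sum, Finset.sum_apply]
    refine Finset.sum_congr rfl fun k _ => ?_
    rw [comp_smul, PiLp.smul_apply, smul_eq_mul, comp_leviCivita_coordVec hc hx]
  rw [sum_inner_orthonormalBasis_eq hc hx e (isLinearMap_covTensor_right (hT x) u), h1]
  have h3 : ∀ j, comp c x (covTensor T x u (coordVec c j x)) j =
      mvfderiv (𝓡 m) (fun y => comp c y (T y (coordVec c j y)) j) x u +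
      (∑ i, ∑ k, christoffel c x j i k * comp c x u i * comp c x (T x (coordVec c j x)) k -
      ∑ k, (∑ i, christoffel c x k i j * comp c x u i) * comp c x (T x (coordVec c k x)) j) := by
    intro j
    have h : covTensor T x u (coordVec c j x) = _ := covHom_eq (φ := fun y : M => y) (hT x) (hV j) u
    rw [h, comp_sub, PiLp.sub_apply, h2, ← add_sub_assoc]
    congr 1
    exact comp_leviCivita hc hx (hTV j) u j
  -- The Christoffel terms form the trace of a commutator; after renaming indices the two sums
  -- coincide and cancel.
  rw [Finset.sum_congr rfl fun j _ => h3 j, Finset.sum_add_distrib, Finset.sum_sub_distrib,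
    add_eq_left, sub_eq_zero]
  rw [Finset.sum_comm' (t' := Finset.univ) (s' := fun _ => Finset.univ) (by simp)]
  conv_rhs => rw [Finset.sum_comm]
  simp only [Finset.sum_mul]
  rw [Finset.sum_comm]
  refine Finset.sum_congr rfl fun j _ => ?_
  rw [Finset.sum_comm]

theorem inner_covTensor_eq (hT : IsSmoothHomAt (φ := fun y : M => y) T x)
    {V W : ∀ x : M, TangentSpace (𝓡 m) x} (hV : SmoothFieldAt m (fun y : M => y) V x)
    (hW : SmoothFieldAt m (fun y : M => y) W x) (u : TangentSpace (𝓡 m) x) :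
    inner ℝ (covTensor T x u (V x)) (W x) =
      mvfderiv (𝓡 m) (fun y => inner ℝ (T y (V y)) (W y)) x u -
        inner ℝ (T x (leviCivita V x u)) (W x) - inner ℝ (T x (V x)) (leviCivita W x u) := by
  have h : covTensor T x u (V x) =
      leviCivita (fun y => T y (V y)) x u - T x (leviCivita V x u) :=
    covHom_eq (φ := fun y : M => y) hT hV u
  rw [h, inner_sub_left, mvfderiv_inner_leviCivita (hT.smoothFieldAt hV) hW]
  ring

/-- Because the connection is metric, ∇_u T inherits self-adjointness from T. -/
theorem inner_covTensor_comm (hT : IsSmoothHomAt (φ := fun y : M => y) T x)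
    (hs : ∀ y u w, inner ℝ (T y u) w = inner ℝ (T y w) u) (u v w : TangentSpace (𝓡 m) x) :
    inner ℝ (covTensor T x u v) w = inner ℝ (covTensor T x u w) v := by
  have hv := smoothFieldAt_localExtension v
  have hw := smoothFieldAt_localExtension w
  have h1 := inner_covTensor_eq hT hv hw u
  have h2 := inner_covTensor_eq hT hw hv u
  have h3 : (fun y => inner ℝ (T y (localExtension x v y)) (localExtension x w y)) =
      fun y => inner ℝ (T y (localExtension x w y)) (localExtension x v y) := by
    funext y
    exact hs _ _ _
  rw [localExtension_self, localExtension_self] at h1 h2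
  rw [h1, h2, h3, hs x _ w, hs x v]
  ring

/-- Needed because the standard basis is indexed by the rank of the tangent space, whereas the
surface arguments use a basis indexed by `Fin 2`. -/
theorem divTensor_eq_sum (hT : IsSmoothHomAt (φ := fun y : M => y) T x)
    {ι : Type*} [Fintype ι] (e : OrthonormalBasis ι ℝ (TangentSpace (𝓡 m) x)) :
    divTensor T x = ∑ a, covTensor T x (e a) (e a) := by
  have h := fun {ι : Type _} [Fintype ι] (e : OrthonormalBasis ι ℝ (TangentSpace (𝓡 m) x)) =>
    sum_orthonormalBasis_eq (chartAt_mem x) (mem_chart_source _ x) e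
      (isLinearMap_covTensor_left hT) (isLinearMap_covTensor_right hT)
  rw [sum_orthonormalBasis_eq (chartAt_mem x) (mem_chart_source _ x) e
      (isLinearMap_covTensor_left hT) (isLinearMap_covTensor_right hT)]
  exact h _

end TensorTrace

/-! ### The Codazzi equation as a divergence equation -/

section Codazzi

variable {M : Type*}
  [TopologicalSpace M] [ChartedSpace (EuclideanSpace ℝ (Fin 2)) M] [IsManifold (𝓡 2) ∞ M]
  [Bundle.RiemannianBundle (fun x : M => TangentSpace (𝓡 2) x)]
  [IsContMDiffRiemannianBundle (𝓡 2) ∞ (EuclideanSpace ℝ (Fin 2))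
      (fun x : M => TangentSpace (𝓡 2) x)]
  {x : M} {T : ∀ x : M, TangentSpace (𝓡 2) x → TangentSpace (𝓡 2) x}

/-- An orthonormal basis of the tangent plane of a surface. -/
def tangentBasis (x : M) : OrthonormalBasis (Fin 2) ℝ (TangentSpace (𝓡 2) x) :=
  (stdOrthonormalBasis ℝ (TangentSpace (𝓡 2) x)).reindex
    (finCongr (finrank_euclideanSpace_fin (𝕜 := ℝ) (n := 2)))

/-- On a surface, a symmetric tensor field is Codazzi if and only if its divergence is the gradient
of its trace. -/
theorem isCodazzi_iff (hT : ∀ y, IsSmoothHomAt (φ := fun y : M => y) T y)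
    (hs : ∀ y u w, inner ℝ (T y u) w = inner ℝ (T y w) u) :
    IsCodazzi T ↔ ∀ (x : M) (w : TangentSpace (𝓡 2) x),
      inner ℝ (divTensor T x) w = mvfderiv (𝓡 2) (traceTensor T) x w := by
  refine forall_congr' fun x => ?_
  set e := tangentBasis x
  have hsym := fun u v w => inner_covTensor_comm (hT x) hs u v w
  have htr := sum_inner_covTensor hT x e
  have hdiv := divTensor_eq_sum (hT x) e
  rw [Fin.sum_univ_two] at hdiv
  simp only [Fin.sum_univ_two] at htr
  constructor
  · intro h w
    have hb : ∀ c, inner ℝ (divTensor T x) (e c) = mvfderiv (𝓡 2) (traceTensor T) x (e c) := by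
      intro c
      -- Symmetry, then Codazzi: ⟨(∇_{e_a} T)e_a, e_c⟩ = ⟨(∇_{e_a} T)e_c, e_a⟩ = ⟨(∇_{e_c} T)e_a,
      -- e_a⟩, whose sum over a is the derivative of the trace.
      rw [← htr, hdiv, inner_add_left, hsym _ _ (e c), hsym _ _ (e c), h (e 0), h (e 1)]
    have hl := map_sum_smul_of_isLinearMap (f := fun w => inner ℝ (divTensor T x) w)
      ⟨fun a b => inner_add_right _ _ _, fun r a => real_inner_smul_right _ _ _⟩
      Finset.univ (fun i => inner ℝ (e i) w) e
    have hr := map_sum_smul_of_isLinearMap (f := fun w => mvfderiv (𝓡 2) (traceTensor T) x w)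
      (mvfderiv (𝓡 2) (traceTensor T) x).toLinearMap.isLinear
      Finset.univ (fun i => inner ℝ (e i) w) e
    simp only [e.sum_repr', hb] at hl hr
    rw [hl, hr]
  · intro h u v
    have h01 : covTensor T x (e 0) (e 1) = covTensor T x (e 1) (e 0) := by
      refine InnerProductSpace.ext_inner_right_basis e.toBasis fun c => ?_
      have h0 := h (e 0)
      have h1 := h (e 1)
      rw [← htr, hdiv, inner_add_left] at h0 h1
      -- In dimension two only the pair (e₀, e₁) matters. Its e₀-component comes from the divergence
      -- equation in direction e₁, and conversely.
      have hc : inner ℝ (covTensor T x (e 0) (e 1)) (e c) =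
          inner ℝ (covTensor T x (e 1) (e 0)) (e c) := by
        fin_cases c
        · have := hsym (e 0) (e 0) (e 1)
          simp only [Fin.zero_eta]
          linarith
        · have := hsym (e 1) (e 1) (e 0)
          simp only [Fin.mk_one]
          linarith
      simpa only [OrthonormalBasis.coe_toBasis] using hc
    have hu := e.sum_repr' u
    have hv := e.sum_repr' v
    rw [Fin.sum_univ_two] at hu hv
    rw [← hu, ← hv]
    simp only [(isLinearMap_covTensor_left (hT x) _).map_add,
      (isLinearMap_covTensor_left (hT x) _).map_smul, (isLinearMap_covTensor_right (hT x) _).map_add,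
      (isLinearMap_covTensor_right (hT x) _).map_smul, h01]
    module

end Codazzi

/-! ### Symmetric tensors in isothermal coordinates -/

section Conformal

variable {M : Type*}
  [TopologicalSpace M] [ChartedSpace (EuclideanSpace ℝ (Fin 2)) M] [IsManifold (𝓡 2) ∞ M]
  [Bundle.RiemannianBundle (fun x : M => TangentSpace (𝓡 2) x)]
  [IsContMDiffRiemannianBundle (𝓡 2) ∞ (EuclideanSpace ℝ (Fin 2))
      (fun x : M => TangentSpace (𝓡 2) x)]
  {x : M} {T : ∀ x : M, TangentSpace (𝓡 2) x → TangentSpace (𝓡 2) x}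
  {c : OpenPartialHomeomorph M (EuclideanSpace ℝ (Fin 2))} {L : M → ℝ}

theorem conformalFactor_ne_zero (hc : c ∈ IsManifold.maximalAtlas (𝓡 2) ∞ M) (hx : x ∈ c.source)
    (hL : gram c x = L x • (1 : Matrix (Fin 2) (Fin 2) ℝ)) : L x ≠ 0 := by
  intro h
  have h0 := gram_det_ne_zero hc hx
  rw [hL, h, zero_smul] at h0
  exact h0 Matrix.det_zero

theorem gram_inv_conformal (hc : c ∈ IsManifold.maximalAtlas (𝓡 2) ∞ M) (hx : x ∈ c.source)
    (hL : gram c x = L x • (1 : Matrix (Fin 2) (Fin 2) ℝ)) :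
    (gram c x)⁻¹ = (L x)⁻¹ • (1 : Matrix (Fin 2) (Fin 2) ℝ) := by
  refine Matrix.inv_eq_right_inv ?_
  rw [hL, smul_mul_smul_comm, mul_inv_cancel₀ (conformalFactor_ne_zero hc hx hL), one_smul, one_mul]

theorem gram_apply_conformal (hL : gram c x = L x • (1 : Matrix (Fin 2) (Fin 2) ℝ))
    (i j : Fin 2) : gram c x i j = if i = j then L x else 0 := by
  rw [hL, Matrix.smul_apply, Matrix.one_apply, smul_eq_mul, mul_ite, mul_one, mul_zero]

theorem contMDiffAt_conformalFactor (hc : c ∈ IsManifold.maximalAtlas (𝓡 2) ∞ M)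
    (hx : x ∈ c.source) (hL : ∀ p ∈ c.source, gram c p = L p • (1 : Matrix (Fin 2) (Fin 2) ℝ)) :
    ContMDiffAt (𝓡 2) 𝓘(ℝ, ℝ) ∞ L x := by
  refine (contMDiffAt_gram hc hx 0 0).congr_of_eventuallyEq ?_
  filter_upwards [c.open_source.mem_nhds hx] with y hy
  rw [gram_apply_conformal (hL y hy), if_pos rfl]

theorem dGram_conformal (hx : x ∈ c.source)
    (hL : ∀ p ∈ c.source, gram c p = L p • (1 : Matrix (Fin 2) (Fin 2) ℝ)) (k i j : Fin 2) :
    dGram c x k i j = if i = j then coordDeriv c k L x else 0 := by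
  split_ifs with h
  · refine mvfderiv_congr ?_ _
    filter_upwards [c.open_source.mem_nhds hx] with y hy
    rw [gram_apply_conformal (hL y hy), if_pos h]
  · rw [← mvfderiv_const_apply (M := M) (x := x) 0 (coordVec c k x)]
    refine mvfderiv_congr ?_ _
    filter_upwards [c.open_source.mem_nhds hx] with y hy
    rw [gram_apply_conformal (hL y hy), if_neg h]

theorem inner_leviCivita_coordVec (hc : c ∈ IsManifold.maximalAtlas (𝓡 2) ∞ M)
    (hx : x ∈ c.source) (i j k : Fin 2) :
    inner ℝ (leviCivita (coordVec c j) x (coordVec c i x)) (coordVec c k x) =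
      (1 / 2 : ℝ) * (dGram c x i j k + dGram c x j i k - dGram c x k i j) :=
  koszul_formula_id hc hx (chartAt_mem x) (mem_chart_source _ x) i j k

theorem inner_eq_sum_conformal (hc : c ∈ IsManifold.maximalAtlas (𝓡 2) ∞ M)
    (hx : x ∈ c.source) (hL : gram c x = L x • (1 : Matrix (Fin 2) (Fin 2) ℝ))
    (u v : TangentSpace (𝓡 2) x) :
    L x * inner ℝ u v = ∑ l, inner ℝ u (coordVec c l x) * inner ℝ v (coordVec c l x) := by
  simp only [inner_eq_sum hc hx, gram_apply_conformal hL, comp_coordVec hc hx, PiLp.single_apply,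
    Fin.sum_univ_two]
  simp
  ring

theorem conformalFactor_mul_traceTensor (hc : c ∈ IsManifold.maximalAtlas (𝓡 2) ∞ M)
    (hx : x ∈ c.source) (hL : gram c x = L x • (1 : Matrix (Fin 2) (Fin 2) ℝ))
    (hT : IsLinearMap ℝ (T x)) :
    L x * traceTensor T x = inner ℝ (T x (coordVec c 0 x)) (coordVec c 0 x) +
      inner ℝ (T x (coordVec c 1 x)) (coordVec c 1 x) := by
  unfold traceTensor
  rw [sum_orthonormalBasis_eq hc hx _ (b := fun u v => inner ℝ (T x u) v)
    (fun v => isLinearMap_inner_left hT v)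
    (fun u => ⟨fun a b => inner_add_right _ _ _, fun r a => real_inner_smul_right _ _ _⟩),
    gram_inv_conformal hc hx hL]
  have h0 := conformalFactor_ne_zero hc hx hL
  simp only [Fin.sum_univ_two, Matrix.smul_apply, Matrix.one_apply, smul_eq_mul]
  simp
  field_simp

theorem conformalFactor_mul_divTensor (hc : c ∈ IsManifold.maximalAtlas (𝓡 2) ∞ M)
    (hx : x ∈ c.source) (hL : gram c x = L x • (1 : Matrix (Fin 2) (Fin 2) ℝ))
    (hT : IsSmoothHomAt (φ := fun y : M => y) T x) (w : TangentSpace (𝓡 2) x) :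
    L x * inner ℝ (divTensor T x) w = inner ℝ (covTensor T x (coordVec c 0 x) (coordVec c 0 x)) w +
      inner ℝ (covTensor T x (coordVec c 1 x) (coordVec c 1 x)) w := by
  unfold divTensor
  rw [sum_orthonormalBasis_eq hc hx _ (isLinearMap_covTensor_left hT)
    (isLinearMap_covTensor_right hT), gram_inv_conformal hc hx hL]
  have h0 := conformalFactor_ne_zero hc hx hL
  simp only [Fin.sum_univ_two, Matrix.smul_apply, Matrix.one_apply, smul_eq_mul]
  simp [inner_add_left, real_inner_smul_left]
  field_simp

/-- The divergence of a symmetric tensor field in an isothermal chart. -/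
theorem conformalFactor_mul_divTensor_sub (hc : c ∈ IsManifold.maximalAtlas (𝓡 2) ∞ M)
    (hx : x ∈ c.source) (hL : ∀ p ∈ c.source, gram c p = L p • (1 : Matrix (Fin 2) (Fin 2) ℝ))
    (hT : ∀ y, IsSmoothHomAt (φ := fun y : M => y) T y)
    (hs : ∀ y u w, inner ℝ (T y u) w = inner ℝ (T y w) u) (k : Fin 2) :
    L x * (inner ℝ (divTensor T x) (coordVec c k x) -
        1 / 2 * mvfderiv (𝓡 2) (traceTensor T) x (coordVec c k x)) =
      (coordDeriv c 0 (fun y => inner ℝ (T y (coordVec c 0 y)) (coordVec c k y)) x +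
        coordDeriv c 1 (fun y => inner ℝ (T y (coordVec c 1 y)) (coordVec c k y)) x) -
      1 / 2 * (coordDeriv c k (fun y => inner ℝ (T y (coordVec c 0 y)) (coordVec c 0 y)) x +
        coordDeriv c k (fun y => inner ℝ (T y (coordVec c 1 y)) (coordVec c 1 y)) x) := by
  have hLx := hL x hx
  have h0 := conformalFactor_ne_zero hc hx hLx
  have hV := smoothFieldAt_coordVec hc hx
  have hTV := fun i => (hT x).smoothFieldAt (hV i)
  have hTs : ∀ i j, ContMDiffAt (𝓡 2) 𝓘(ℝ, ℝ) ∞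
      (fun y => inner ℝ (T y (coordVec c i y)) (coordVec c j y)) x := fun i j =>
    contMDiffAt_inner (φ := fun y : M => y) contMDiff_id (hTV i) (hV j)
  have htr : ContMDiffAt (𝓡 2) 𝓘(ℝ, ℝ) ∞ (traceTensor T) x := by
    have h : ContMDiffAt (𝓡 2) 𝓘(ℝ, ℝ) ∞
        (fun y => ∑ j, comp c y (T y (coordVec c j y)) j) x :=
      contMDiffAt_finsetSum fun j _ => (hTV j).contMDiffAt_comp hc hx j
    refine h.congr_of_eventuallyEq ?_
    filter_upwards [c.open_source.mem_nhds hx] with y hy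
    exact traceTensor_eq_sum hc hy ((hT y).linear y)
  -- The product rule applied to L tr T = T₀₀ + T₁₁.
  have hprod : coordDeriv c k (fun y => inner ℝ (T y (coordVec c 0 y)) (coordVec c 0 y)) x +
      coordDeriv c k (fun y => inner ℝ (T y (coordVec c 1 y)) (coordVec c 1 y)) x =
      coordDeriv c k L x * traceTensor T x +
        L x * mvfderiv (𝓡 2) (traceTensor T) x (coordVec c k x) := by
    unfold coordDeriv
    rw [← mvfderiv_mul_apply (contMDiffAt_conformalFactor hc hx hL) htr,
      ← mvfderiv_add_apply (hTs 0 0) (hTs 1 1)]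
    refine mvfderiv_congr ?_ _
    filter_upwards [c.open_source.mem_nhds hx] with y hy
    exact (conformalFactor_mul_traceTensor hc hy (hL y hy) ((hT y).linear y)).symm
  have htrx := conformalFactor_mul_traceTensor hc hx hLx ((hT x).linear x)
  have hcov : ∀ i, L x * inner ℝ (covTensor T x (coordVec c i x) (coordVec c i x))
      (coordVec c k x) = L x * coordDeriv c i
        (fun y => inner ℝ (T y (coordVec c i y)) (coordVec c k y)) x -
      L x * inner ℝ (leviCivita (coordVec c i) x (coordVec c i x)) (T x (coordVec c k x)) -
      L x * inner ℝ (leviCivita (coordVec c k) x (coordVec c i x)) (T x (coordVec c i x)) := by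
    intro i
    rw [inner_covTensor_eq (hT x) (hV i) (hV k), hs x _ (coordVec c k x),
      real_inner_comm _ (T x (coordVec c k x)), real_inner_comm _ (T x (coordVec c i x))]
    unfold coordDeriv
    ring
  have hdiv := conformalFactor_mul_divTensor hc hx hLx (hT x) (coordVec c k x)
  refine mul_left_cancel₀ h0 ?_
  -- The additional factor L lets each inner product with a Levi-Civita derivative be expanded in
  -- the coordinate frame. What remains of dL is a multiple of L tr T - T₀₀ - T₁₁, which vanishes by
  -- `htrx`.
  rw [mul_sub (L x) (inner ℝ _ _), hdiv, mul_sub, mul_add (L x) (inner ℝ _ _), hcov, hcov, hprod]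
  simp only [inner_eq_sum_conformal hc hx hLx, inner_leviCivita_coordVec hc hx,
    dGram_conformal hx hL, Fin.sum_univ_two]
  have h10 := hs x (coordVec c 1 x) (coordVec c 0 x)
  fin_cases k
  · simp [h10]
    linear_combination (coordDeriv c 0 L x / 2) * htrx
  · simp [h10]
    linear_combination (coordDeriv c 1 L x / 2) * htrx

end Conformal

/-- The identification `z = x + iy` of `ℂ` with the Euclidean plane. -/
def planeEquiv : ℂ ≃L[ℝ] EuclideanSpace ℝ (Fin 2) :=
  Complex.orthonormalBasisOneI.repr.toContinuousLinearEquiv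

theorem planeEquiv_apply (z : ℂ) : planeEquiv z = !₂[z.re, z.im] := by
  ext i
  exact congrFun (Complex.orthonormalBasisOneI_repr_apply z) i

theorem planeEquiv_one : planeEquiv 1 = EuclideanSpace.single 0 1 := by
  rw [planeEquiv_apply]
  ext i
  fin_cases i <;> simp

theorem planeEquiv_I : planeEquiv Complex.I = EuclideanSpace.single 1 1 := by
  rw [planeEquiv_apply]
  ext i
  fin_cases i <;> simp

/-! ### The Hopf function and the Cauchy-Riemann equations -/

section Hopf

variable {M : Type*}
  [TopologicalSpace M] [ChartedSpace (EuclideanSpace ℝ (Fin 2)) M] [IsManifold (𝓡 2) ∞ M]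
  [Bundle.RiemannianBundle (fun x : M => TangentSpace (𝓡 2) x)]
  [IsContMDiffRiemannianBundle (𝓡 2) ∞ (EuclideanSpace ℝ (Fin 2))
      (fun x : M => TangentSpace (𝓡 2) x)]
  {x : M} {T : ∀ x : M, TangentSpace (𝓡 2) x → TangentSpace (𝓡 2) x}
  {c : OpenPartialHomeomorph M (EuclideanSpace ℝ (Fin 2))} {L : M → ℝ}

theorem hasFDerivAt_comp_plane (hc : c ∈ IsManifold.maximalAtlas (𝓡 2) ∞ M) {z : ℂ}
    (hz : !₂[z.re, z.im] ∈ c.target) {f : M → ℝ}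
    (hf : ContMDiffAt (𝓡 2) 𝓘(ℝ, ℝ) ∞ f (c.symm !₂[z.re, z.im])) :
    ∃ f' : ℂ →L[ℝ] ℝ, HasFDerivAt (fun z : ℂ => f (c.symm !₂[z.re, z.im])) f' z ∧
      f' 1 = coordDeriv c 0 f (c.symm !₂[z.re, z.im]) ∧
      f' Complex.I = coordDeriv c 1 f (c.symm !₂[z.re, z.im]) := by
  have hx := c.map_target hz
  have hd := ((contDiffAt_comp_symm hc hx hf).differentiableAt (by simp)).hasFDerivAt
  have hm : MDifferentiableAt (𝓡 2) 𝓘(ℝ, ℝ) f (c.symm !₂[z.re, z.im]) :=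
    hf.mdifferentiableAt (by simp)
  rw [c.right_inv hz, ← planeEquiv_apply] at hd
  refine ⟨_, (hd.comp z planeEquiv.hasFDerivAt).congr_of_eventuallyEq
    (Eventually.of_forall fun w => by
      simp only [Function.comp_apply, planeEquiv_apply]), ?_, ?_⟩
  · rw [coordDeriv_eq_fderiv hc hx hm, c.right_inv hz, planeEquiv_apply, ← planeEquiv_one]
    rfl
  · rw [coordDeriv_eq_fderiv hc hx hm, c.right_inv hz, planeEquiv_apply, ← planeEquiv_I]
    rfl

/-- By symmetry the mixed terms coincide: 4⟨T ∂_z, ∂_z⟩ = T₀₀ - T₁₁ - 2i T₀₁. -/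
theorem hopfFunction_eq (hs : ∀ y u w, inner ℝ (T y u) w = inner ℝ (T y w) u) (p : M) :
    hopfFunction T c p = (1 / 4 : ℂ) *
      ((inner ℝ (T p (coordVec c 0 p)) (coordVec c 0 p) -
        inner ℝ (T p (coordVec c 1 p)) (coordVec c 1 p) : ℝ) -
      2 * Complex.I * (inner ℝ (T p (coordVec c 0 p)) (coordVec c 1 p) : ℝ)) := by
  unfold hopfFunction dzComp
  simp only [Fin.sum_univ_two, Matrix.cons_val_zero, Matrix.cons_val_one, Complex.ofReal_sub]
  rw [hs p (coordVec c 1 p) (coordVec c 0 p)]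
  linear_combination (1 / 4 : ℂ) * (inner ℝ (T p (coordVec c 1 p)) (coordVec c 1 p) : ℝ) *
    Complex.I_sq

/-- In an isothermal chart, the Cauchy-Riemann equations for the Hopf function of a symmetric tensor
field `T` are `div T = (1/2) grad (tr T)`. -/
theorem differentiableAt_hopfFunction_iff (hc : c ∈ IsManifold.maximalAtlas (𝓡 2) ∞ M)
    (hL : ∀ p ∈ c.source, gram c p = L p • (1 : Matrix (Fin 2) (Fin 2) ℝ))
    (hT : ∀ y, IsSmoothHomAt (φ := fun y : M => y) T y)
    (hs : ∀ y u w, inner ℝ (T y u) w = inner ℝ (T y w) u) {z : ℂ}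
    (hz : !₂[z.re, z.im] ∈ c.target) (hx : c.symm !₂[z.re, z.im] = x) :
    DifferentiableAt ℂ (fun z : ℂ => hopfFunction T c (c.symm !₂[z.re, z.im])) z ↔
      ∀ w, inner ℝ (divTensor T x) w = 1 / 2 * mvfderiv (𝓡 2) (traceTensor T) x w := by
  subst hx
  have hx := c.map_target hz
  set x := c.symm !₂[z.re, z.im]
  have h0 := conformalFactor_ne_zero hc hx (hL x hx)
  have hTV := fun i => (hT x).smoothFieldAt (smoothFieldAt_coordVec hc hx i)
  have hTs : ∀ i j, ContMDiffAt (𝓡 2) 𝓘(ℝ, ℝ) ∞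
      (fun y => inner ℝ (T y (coordVec c i y)) (coordVec c j y)) x := fun i j =>
    contMDiffAt_inner (φ := fun y : M => y) contMDiff_id (hTV i) (smoothFieldAt_coordVec hc hx j)
  obtain ⟨f₀, hf₀, hf₀0, hf₀1⟩ := hasFDerivAt_comp_plane hc hz (hTs 0 0)
  obtain ⟨f₁, hf₁, hf₁0, hf₁1⟩ := hasFDerivAt_comp_plane hc hz (hTs 1 1)
  obtain ⟨f₂, hf₂, hf₂0, hf₂1⟩ := hasFDerivAt_comp_plane hc hz (hTs 0 1)
  have hF : HasFDerivAt (fun z : ℂ => hopfFunction T c (c.symm !₂[z.re, z.im]))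
      ((1 / 4 : ℂ) • (Complex.ofRealCLM ∘L (f₀ - f₁) -
        (2 * Complex.I) • (Complex.ofRealCLM ∘L f₂))) z := by
    have h := (((Complex.ofRealCLM.hasFDerivAt).comp z (hf₀.sub hf₁)).sub
      (((Complex.ofRealCLM.hasFDerivAt).comp z hf₂).const_smul (2 * Complex.I))).const_smul
        (1 / 4 : ℂ)
    refine h.congr_of_eventuallyEq (Eventually.of_forall fun w => ?_)
    simp only [hopfFunction_eq hs]
    rfl
  -- These are the real and imaginary parts of (∂_x + i∂_y)(T₀₀ - T₁₁ - 2i T₀₁) = 0.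
  have hcr : DifferentiableAt ℂ (fun z : ℂ => hopfFunction T c (c.symm !₂[z.re, z.im])) z ↔
      f₀ 1 - f₁ 1 + 2 * f₂ Complex.I = 0 ∧ f₀ Complex.I - f₁ Complex.I - 2 * f₂ 1 = 0 := by
    rw [differentiableAt_complex_iff_differentiableAt_real, and_iff_right hF.differentiableAt,
      hF.fderiv, Complex.ext_iff]
    simp
    constructor
    · rintro ⟨h1, h2⟩
      constructor <;> linarith
    · rintro ⟨h1, h2⟩
      constructor <;> linarith
  -- The components of L(div T - ½ grad tr T) along ∂_x and ∂_y are half the first and minus half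
  -- the second Cauchy-Riemann expression.
  have k0 := conformalFactor_mul_divTensor_sub hc hx hL hT hs 0
  have k1 := conformalFactor_mul_divTensor_sub hc hx hL hT hs 1
  have h10 : (fun y => inner ℝ (T y (coordVec c 1 y)) (coordVec c 0 y)) =
      fun y => inner ℝ (T y (coordVec c 0 y)) (coordVec c 1 y) := by
    funext y
    exact hs _ _ _
  rw [h10] at k0
  rw [hcr, hf₀0, hf₀1, hf₁0, hf₁1, hf₂0, hf₂1]
  constructor
  · rintro ⟨h1, h2⟩ w
    have hk : ∀ k, inner ℝ (divTensor T x) (coordVec c k x) =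
        1 / 2 * mvfderiv (𝓡 2) (traceTensor T) x (coordVec c k x) := by
      intro k
      rw [← sub_eq_zero]
      refine (mul_eq_zero.1 ?_).resolve_left h0
      fin_cases k
      · exact k0.trans (by linarith)
      · exact k1.trans (by linarith)
    rw [← sum_comp_smul_coordVec hc hx w, inner_sum, map_sum, Finset.mul_sum]
    refine Finset.sum_congr rfl fun i _ => ?_
    rw [real_inner_smul_right, hk, map_smul, smul_eq_mul]
    ring
  · intro h
    rw [h, sub_self, mul_zero] at k0 k1
    constructor <;> linarith

theorem hasHolomorphicHopf_of_divTensor (o : OrientedAtlas M)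
    (hT : ∀ y, IsSmoothHomAt (φ := fun y : M => y) T y)
    (hs : ∀ y u w, inner ℝ (T y u) w = inner ℝ (T y w) u)
    (h : ∀ x w, inner ℝ (divTensor T x) w = 1 / 2 * mvfderiv (𝓡 2) (traceTensor T) x w) :
    HasHolomorphicHopf o T := by
  rintro c ⟨hc, -⟩ ⟨ρ, hρ⟩ z hz
  exact ((differentiableAt_hopfFunction_iff (L := fun p => Real.exp (2 * ρ p)) hc hρ hT hs hz
    rfl).2 (h _)).differentiableWithinAt

theorem HasHolomorphicHopf.inner_divTensor {o : OrientedAtlas M} (h : HasHolomorphicHopf o T)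
    (hT : ∀ y, IsSmoothHomAt (φ := fun y : M => y) T y)
    (hs : ∀ y u w, inner ℝ (T y u) w = inner ℝ (T y w) u) (hpos : o.IsPositive c)
    (hiso : IsIsothermal c) (hx : x ∈ c.source) (w : TangentSpace (𝓡 2) x) :
    inner ℝ (divTensor T x) w = 1 / 2 * mvfderiv (𝓡 2) (traceTensor T) x w := by
  have hd := h c hpos hiso
  obtain ⟨ρ, hρ⟩ := hiso
  have hp : !₂[(planeEquiv.symm (c x)).re, (planeEquiv.symm (c x)).im] = c x := by
    rw [← planeEquiv_apply, ContinuousLinearEquiv.apply_symm_apply]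
  have hz : !₂[(planeEquiv.symm (c x)).re, (planeEquiv.symm (c x)).im] ∈ c.target := by
    rw [hp]
    exact c.map_source hx
  have hopen : IsOpen {z : ℂ | !₂[z.re, z.im] ∈ c.target} := by
    simp only [← planeEquiv_apply]
    exact c.open_target.preimage planeEquiv.continuous
  refine (differentiableAt_hopfFunction_iff (L := fun p => Real.exp (2 * ρ p)) hpos.1 hρ hT hs hz
    ?_).1 (hd.differentiableAt (hopen.mem_nhds hz)) w
  rw [hp, c.left_inv hx]

end Hopf

/-! ### New charts from maps with nonzero Jacobian -/

section ChangeOfChart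

variable {m : ℕ} {M : Type*}
  [TopologicalSpace M] [ChartedSpace (EuclideanSpace ℝ (Fin m)) M] [IsManifold (𝓡 m) ∞ M]
  {c₀ : OpenPartialHomeomorph M (EuclideanSpace ℝ (Fin m))} {x : M}

/-- The inverse function theorem at u₀, restricted to an open set where P holds. Invertibility at
every point of that set, not just at u₀, makes the inverse smooth on the whole target. -/
theorem exists_openPartialHomeomorph_of_det_ne_zero
    {Ψ : EuclideanSpace ℝ (Fin m) → EuclideanSpace ℝ (Fin m)}
    (hΨ : ContDiff ℝ ∞ Ψ) {P : EuclideanSpace ℝ (Fin m) → Prop} {u₀ : EuclideanSpace ℝ (Fin m)}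
    (hP : ∀ᶠ u in 𝓝 u₀, P u) (hdet : ∀ u, P u → (fderiv ℝ Ψ u).det ≠ 0) :
    ∃ Q : OpenPartialHomeomorph (EuclideanSpace ℝ (Fin m)) (EuclideanSpace ℝ (Fin m)),
      u₀ ∈ Q.source ∧ (∀ u ∈ Q.source, P u) ∧ (∀ u, Q u = Ψ u) ∧
      ContDiffOn ℝ ∞ Q.symm Q.target := by
  obtain ⟨V, hVP, hVo, hxV⟩ := mem_nhds_iff.1 hP
  have hd : ∀ u (hu : P u), HasFDerivAt Ψ
      (((fderiv ℝ Ψ u).toContinuousLinearEquivOfDetNeZero (hdet u hu) :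
        EuclideanSpace ℝ (Fin m) ≃L[ℝ] EuclideanSpace ℝ (Fin m)) :
        EuclideanSpace ℝ (Fin m) →L[ℝ] EuclideanSpace ℝ (Fin m)) u := by
    intro u hu
    rw [ContinuousLinearMap.coe_toContinuousLinearEquivOfDetNeZero]
    exact (hΨ.differentiable (by simp) u).hasFDerivAt
  have hP₀ : P u₀ := hVP hxV
  set Q₀ := (hΨ.contDiffAt (x := u₀)).toOpenPartialHomeomorph Ψ (hd u₀ hP₀) (by simp)
  have hQ₀ : ∀ u, Q₀ u = Ψ u := fun u => rfl
  refine ⟨Q₀.restrOpen V hVo, ⟨?_, hxV⟩, fun u hu => hVP hu.2, hQ₀, fun a ha => ?_⟩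
  · exact ContDiffAt.mem_toOpenPartialHomeomorph_source _ _ _
  · have hs := (Q₀.restrOpen V hVo).map_target ha
    exact ((Q₀.restrOpen V hVo).contDiffAt_symm ha (hd _ (hVP hs.2))
      hΨ.contDiffAt).contDiffWithinAt

/-- The predicate P carries pointwise information on the derivative of Ψ, here conformality and
orientation, to the whole domain of the new chart. -/
theorem exists_chart_of_det_ne_zero (hc₀ : c₀ ∈ IsManifold.maximalAtlas (𝓡 m) ∞ M)
    (hx : x ∈ c₀.source) {Ψ : EuclideanSpace ℝ (Fin m) → EuclideanSpace ℝ (Fin m)}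
    (hΨ : ContDiff ℝ ∞ Ψ) {P : EuclideanSpace ℝ (Fin m) → Prop} (hP : ∀ᶠ u in 𝓝 (c₀ x), P u)
    (hdet : ∀ u, P u → (fderiv ℝ Ψ u).det ≠ 0) :
    ∃ c ∈ IsManifold.maximalAtlas (𝓡 m) ∞ M, x ∈ c.source ∧ ∀ p ∈ c.source, p ∈ c₀.source ∧
      P (c₀ p) ∧ ∀ v, comp c p v = fderiv ℝ Ψ (c₀ p) (comp c₀ p v) := by
  obtain ⟨Q, hxQ, hQP, hQΨ, hQs⟩ := exists_openPartialHomeomorph_of_det_ne_zero hΨ hP hdet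
  have hsmooth := contMDiffOn_of_mem_maximalAtlas hc₀
  have hsymm := contMDiffOn_symm_of_mem_maximalAtlas hc₀
  have hQ : ContMDiffOn (𝓡 m) (𝓡 m) ∞ Q Q.source := by
    have : (Q : EuclideanSpace ℝ (Fin m) → EuclideanSpace ℝ (Fin m)) = Ψ := funext hQΨ
    rw [this]
    exact hΨ.contMDiff.contMDiffOn
  have hc : c₀.trans Q ∈ IsManifold.maximalAtlas (𝓡 m) ∞ M := by
    refine (c₀.trans Q).mem_maximalAtlas_of_contMDiffOn ?_ ?_
    · exact hQ.comp (hsmooth.mono fun p hp => by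
        rw [OpenPartialHomeomorph.trans_source] at hp
        exact hp.1) fun p hp => by
          rw [OpenPartialHomeomorph.trans_source] at hp
          exact hp.2
    · exact hsymm.comp (hQs.contMDiffOn.mono fun p hp => by
        rw [OpenPartialHomeomorph.trans_target] at hp
        exact hp.1) fun p hp => by
          rw [OpenPartialHomeomorph.trans_target] at hp
          exact hp.2
  refine ⟨c₀.trans Q, hc, ?_, fun p hp => ?_⟩
  · rw [OpenPartialHomeomorph.trans_source]
    exact ⟨hx, hxQ⟩
  · have hp' := hp
    rw [OpenPartialHomeomorph.trans_source] at hp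
    refine ⟨hp.1, hQP _ hp.2, fun v => ?_⟩
    have h := mvfderiv_eq_fderiv (f := fun y => (c₀.trans Q) y) hc₀ hp.1
      ((mdifferentiable_of_mem_maximalAtlas hc).mdifferentiableAt hp') v
    refine h.trans ?_
    congr 1
    refine Filter.EventuallyEq.fderiv_eq ?_
    filter_upwards [c₀.open_target.mem_nhds (c₀.map_source hp.1)] with u hu
    simp only [Function.comp_apply, OpenPartialHomeomorph.coe_trans, c₀.right_inv hu, hQΨ]

/-- The Jacobian of the change from `c` to `d`, computed by means of a third chart. -/
theorem det_change_of_chart {c d : OpenPartialHomeomorph M (EuclideanSpace ℝ (Fin m))}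
    (hc₀ : c₀ ∈ IsManifold.maximalAtlas (𝓡 m) ∞ M) (hc : c ∈ IsManifold.maximalAtlas (𝓡 m) ∞ M)
    (hd : d ∈ IsManifold.maximalAtlas (𝓡 m) ∞ M) (hx₀ : x ∈ c₀.source) (hx : x ∈ c.source)
    (hxd : x ∈ d.source) {J : EuclideanSpace ℝ (Fin m) →L[ℝ] EuclideanSpace ℝ (Fin m)}
    (hJ : ∀ v, comp c x v = J (comp c₀ x v)) :
    (fderiv ℝ (fun y => d (c₀.symm y)) (c₀ x)).det =
      (fderiv ℝ (fun y => d (c.symm y)) (c x)).det * J.det := by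
  have hmd := (mdifferentiable_of_mem_maximalAtlas hd).mdifferentiableAt hxd
  have h : fderiv ℝ (fun y => d (c₀.symm y)) (c₀ x) =
      (fderiv ℝ (fun y => d (c.symm y)) (c x)).comp J := by
    ext1 a
    have h1 := mvfderiv_eq_fderiv (f := fun y => d y) hc₀ hx₀ hmd (vecOfComp c₀ x a)
    have h2 := mvfderiv_eq_fderiv (f := fun y => d y) hc hx hmd (vecOfComp c₀ x a)
    rw [hJ, comp_vecOfComp hc₀ hx₀] at h2
    rw [comp_vecOfComp hc₀ hx₀] at h1
    exact h1.symm.trans h2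
  rw [h]
  exact LinearMap.det_comp _ _

end ChangeOfChart

/-! ### Criteria for isothermal charts -/

section Isothermal

theorem det_eq_of_plane (A : EuclideanSpace ℝ (Fin 2) →L[ℝ] EuclideanSpace ℝ (Fin 2)) :
    A.det = A (EuclideanSpace.single 0 1) 0 * A (EuclideanSpace.single 1 1) 1 -
      A (EuclideanSpace.single 1 1) 0 * A (EuclideanSpace.single 0 1) 1 := by
  have h : A.det = LinearMap.det (A : EuclideanSpace ℝ (Fin 2) →ₗ[ℝ] EuclideanSpace ℝ (Fin 2)) := rfl
  rw [h, ← LinearMap.det_toMatrix (EuclideanSpace.basisFun (Fin 2) ℝ).toBasis,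
    Matrix.det_fin_two]
  simp [LinearMap.toMatrix_apply]

variable {M : Type*}
  [TopologicalSpace M] [ChartedSpace (EuclideanSpace ℝ (Fin 2)) M] [IsManifold (𝓡 2) ∞ M]
  [Bundle.RiemannianBundle (fun x : M => TangentSpace (𝓡 2) x)]
  [IsContMDiffRiemannianBundle (𝓡 2) ∞ (EuclideanSpace ℝ (Fin 2))
      (fun x : M => TangentSpace (𝓡 2) x)]
  {x : M} {c c₀ : OpenPartialHomeomorph M (EuclideanSpace ℝ (Fin 2))}

/-- Evaluated on coordinate vectors, the hypothesis says that the Gram matrix is κ⁻¹ times the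
identity, so ρ = ½ log g₀₀ works. -/
theorem isIsothermal_of_inner_comp (hc : c ∈ IsManifold.maximalAtlas (𝓡 2) ∞ M)
    (h : ∀ p ∈ c.source, ∃ κ : ℝ, 0 < κ ∧ ∀ u v : TangentSpace (𝓡 2) p,
      comp c p u 0 * comp c p v 0 + comp c p u 1 * comp c p v 1 = κ * inner ℝ u v) :
    IsIsothermal c := by
  refine ⟨fun p => 1 / 2 * Real.log (gram c p 0 0), fun p hp => ?_⟩
  obtain ⟨κ, hκ, hκi⟩ := h p hp
  have hg : ∀ i j, gram c p i j = κ⁻¹ * (1 : Matrix (Fin 2) (Fin 2) ℝ) i j := by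
    intro i j
    have := hκi (coordVec c i p) (coordVec c j p)
    rw [comp_coordVec hc hp, comp_coordVec hc hp] at this
    rw [eq_inv_mul_iff_mul_eq₀ hκ.ne']
    refine this.symm.trans ?_
    fin_cases i <;> fin_cases j <;> simp
  have h0 : gram c p 0 0 = κ⁻¹ := by rw [hg]; simp
  have hρ : Real.exp (2 * (1 / 2 * Real.log (gram c p 0 0))) = κ⁻¹ := by
    rw [h0, ← mul_assoc, mul_one_div_cancel two_ne_zero, one_mul, Real.exp_log (inv_pos.2 hκ)]
  refine Matrix.ext fun i j => (hg i j).trans ?_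
  rw [← hρ]
  rfl

theorem gram_diag_pos (hc : c ∈ IsManifold.maximalAtlas (𝓡 2) ∞ M) (hx : x ∈ c.source)
    (i : Fin 2) : 0 < gram c x i i := by
  refine (real_inner_self_pos (F := TangentSpace (𝓡 2) x)).2 fun h => ?_
  have h1 := comp_coordVec hc hx i
  rw [h] at h1
  have h2 := congrArg (fun a => a i) h1
  have h3 := congrArg (fun a => a i) (comp_smul (c := c) (x := x) 0 0)
  simp at h2 h3
  rw [h3] at h2
  exact zero_ne_one h2

theorem gram_det_pos (hc : c ∈ IsManifold.maximalAtlas (𝓡 2) ∞ M) (hx : x ∈ c.source) :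
    0 < gram c x 0 0 * gram c x 1 1 - gram c x 0 1 ^ 2 := by
  have h0 := gram_det_ne_zero hc hx
  rw [Matrix.det_fin_two, gram_comm 1 0] at h0
  have h1 := real_inner_mul_inner_self_le (coordVec c 0 x) (coordVec c 1 x)
  refine lt_of_le_of_ne ?_ fun h => h0 (by linarith)
  have h2 : gram c x 0 1 * gram c x 0 1 ≤ gram c x 0 0 * gram c x 1 1 := h1
  linarith

end Isothermal

/-! ### Existence of isothermal charts -/

section Existence

/-- The hypotheses are the real form of E β = (F + iD) α. They make the metric pulled back by the
differential with columns α, β equal to |α|²/E times that with coefficients E, F, G, and its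
Jacobian |α|²/E times D. -/
theorem conformal_algebra {D E F G a₁ a₂ b₁ b₂ : ℝ} (hE : 0 < E) (hD : D ^ 2 = E * G - F ^ 2)
    (h₁ : E * b₁ = F * a₁ - D * a₂) (h₂ : E * b₂ = F * a₂ + D * a₁) :
    a₁ * b₁ + a₂ * b₂ = (a₁ ^ 2 + a₂ ^ 2) / E * F ∧
      b₁ ^ 2 + b₂ ^ 2 = (a₁ ^ 2 + a₂ ^ 2) / E * G ∧
      a₁ * b₂ - b₁ * a₂ = (a₁ ^ 2 + a₂ ^ 2) / E * D := by
  have e₁ : b₁ = (F * a₁ - D * a₂) / E := by rw [eq_div_iff hE.ne', ← h₁, mul_comm]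
  have e₂ : b₂ = (F * a₂ + D * a₁) / E := by rw [eq_div_iff hE.ne', ← h₂, mul_comm]
  subst e₁ e₂
  refine ⟨?_, ?_, ?_⟩
  · field_simp
    ring
  · field_simp
    linear_combination (a₁ ^ 2 + a₂ ^ 2) * hD
  · field_simp
    ring

variable {M : Type*}
  [TopologicalSpace M] [ChartedSpace (EuclideanSpace ℝ (Fin 2)) M] [IsManifold (𝓡 2) ∞ M]
  [Bundle.RiemannianBundle (fun x : M => TangentSpace (𝓡 2) x)]
  [IsContMDiffRiemannianBundle (𝓡 2) ∞ (EuclideanSpace ℝ (Fin 2))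
      (fun x : M => TangentSpace (𝓡 2) x)]
  {c₀ : OpenPartialHomeomorph M (EuclideanSpace ℝ (Fin 2))}

theorem contDiffAt_gram_plane (hc₀ : c₀ ∈ IsManifold.maximalAtlas (𝓡 2) ∞ M) {z : ℂ}
    (hz : planeEquiv z ∈ c₀.target) (i j : Fin 2) :
    ContDiffAt ℝ ∞ (fun z => gram c₀ (c₀.symm (planeEquiv z)) i j) z := by
  have h := contDiffAt_comp_symm hc₀ (c₀.map_target hz) (contMDiffAt_gram hc₀ (c₀.map_target hz) i j)
  rw [c₀.right_inv hz] at h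
  exact h.comp z planeEquiv.contDiff.contDiffAt

theorem fderiv_conj_planeEquiv {w : ℂ → ℂ} (hw : ContDiff ℝ ∞ w)
    (u a : EuclideanSpace ℝ (Fin 2)) :
    fderiv ℝ (fun u => planeEquiv (w (planeEquiv.symm u))) u a =
      planeEquiv (fderiv ℝ w (planeEquiv.symm u) (planeEquiv.symm a)) := by
  have h := planeEquiv.hasFDerivAt.comp u (((hw.differentiable (by simp)
    (planeEquiv.symm u)).hasFDerivAt).comp u planeEquiv.symm.hasFDerivAt)
  exact congrArg (fun A => A a) h.fderiv

/-- Every point of a surface lies in a positively oriented isothermal chart. -/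
theorem exists_isothermal_chart (o : OrientedAtlas M) (x : M) :
    ∃ c, o.IsPositive c ∧ IsIsothermal c ∧ x ∈ c.source := by
  obtain ⟨c₀, hc₀o, hx⟩ := o.cover x
  have hc₀ := o.smooth c₀ hc₀o
  set U : Set ℂ := planeEquiv ⁻¹' c₀.target with hUdef
  have hU : IsOpen U := c₀.open_target.preimage planeEquiv.continuous
  set g : Fin 2 → Fin 2 → ℂ → ℝ := fun i j z => gram c₀ (c₀.symm (planeEquiv z)) i j with hg
  set D : ℂ → ℝ := fun z => Real.sqrt (g 0 0 z * g 1 1 z - g 0 1 z ^ 2)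
  have hgs : ∀ i j, ∀ z ∈ U, ContDiffAt ℝ ∞ (g i j) z := fun i j z hz =>
    contDiffAt_gram_plane hc₀ hz i j
  have hpos : ∀ z ∈ U, 0 < g 0 0 z * g 1 1 z - g 0 1 z ^ 2 := fun z hz =>
    gram_det_pos hc₀ (c₀.map_target hz)
  have hE : ∀ z ∈ U, 0 < g 0 0 z := fun z hz => gram_diag_pos hc₀ (c₀.map_target hz) 0
  have hD : ∀ z ∈ U, 0 < D z := fun z hz => Real.sqrt_pos.2 (hpos z hz)
  have hDs : ∀ z ∈ U, ContDiffAt ℝ ∞ D z := fun z hz =>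
    (((hgs 0 0 z hz).mul (hgs 1 1 z hz)).sub ((hgs 0 1 z hz).pow 2)).sqrt (hpos z hz).ne'
  have hx₀ : planeEquiv.symm (c₀ x) ∈ U := by
    rw [hUdef, Set.mem_preimage, ContinuousLinearEquiv.apply_symm_apply]
    exact c₀.map_source hx
  -- The frame D ∂_x, -F ∂_x + E ∂_y, with D² = EG - F², is orthogonal for the metric, and both
  -- vectors have squared length E D².
  have he₁ : ContDiffOn ℝ ∞ (fun z => (D z : ℂ)) U := fun z hz =>
    (Complex.ofRealCLM.contDiff.contDiffAt.comp z (hDs z hz)).contDiffWithinAt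
  have he₂ : ContDiffOn ℝ ∞ (fun z => -(g 0 1 z : ℂ) + (g 0 0 z : ℂ) * Complex.I) U := fun z hz =>
    ((Complex.ofRealCLM.contDiff.contDiffAt.comp z (hgs 0 1 z hz)).neg.add
      ((Complex.ofRealCLM.contDiff.contDiffAt.comp z (hgs 0 0 z hz)).mul
        contDiffAt_const)).contDiffWithinAt
  obtain ⟨w, hw, hev⟩ := exists_conformal_map hU hx₀ he₁ he₂ (by
    simpa using ⟨(hD _ hx₀).ne', (hE _ hx₀).ne'⟩)
  set Ψ : EuclideanSpace ℝ (Fin 2) → EuclideanSpace ℝ (Fin 2) :=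
    fun u => planeEquiv (w (planeEquiv.symm u))
  have hΨ : ContDiff ℝ ∞ Ψ :=
    planeEquiv.contDiff.comp (hw.comp planeEquiv.symm.contDiff)
  -- Conformality of Ψ for the metric in c₀, together with preservation of orientation.
  set P : EuclideanSpace ℝ (Fin 2) → Prop := fun u => ∃ κ : ℝ, 0 < κ ∧ 0 < (fderiv ℝ Ψ u).det ∧
    ∀ a b, fderiv ℝ Ψ u a 0 * fderiv ℝ Ψ u b 0 + fderiv ℝ Ψ u a 1 * fderiv ℝ Ψ u b 1 =
      κ * ∑ i, ∑ j, a i * b j * gram c₀ (c₀.symm u) i j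
  have hP : ∀ᶠ u in 𝓝 (c₀ x), P u := by
    have h1 := planeEquiv.symm.continuous.continuousAt.tendsto.eventually hev
    filter_upwards [h1, c₀.open_target.mem_nhds (c₀.map_source hx)] with u hu hut
    set z := planeEquiv.symm u with hzdef
    have hz : planeEquiv z = u := planeEquiv.apply_symm_apply u
    have hzU : z ∈ U := by
      rw [hUdef, Set.mem_preimage, hz]
      exact hut
    obtain ⟨hne, hcr⟩ := hu
    set α := fderiv ℝ w z 1 with hα
    set β := fderiv ℝ w z Complex.I with hβ
    have hlin : ∀ r s : ℝ, fderiv ℝ w z (r + s * Complex.I) = r * α + s * β := by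
      intro r s
      have : (r : ℂ) + s * Complex.I = r • (1 : ℂ) + s • Complex.I := by simp
      rw [this, map_add, map_smul, map_smul]
      simp [hα, hβ]
    have h10 := hlin (D z) 0
    have h01 := hlin (-(g 0 1 z)) (g 0 0 z)
    simp only [Complex.ofReal_zero, zero_mul, add_zero, Complex.ofReal_neg] at h10 h01
    rw [h10, h01] at hcr
    rw [h10] at hne
    have hα0 : α ≠ 0 := fun h => hne (by rw [h, mul_zero])
    have hre := congrArg Complex.re hcr
    have him := congrArg Complex.im hcr
    simp at hre him
    have hDz : D z ^ 2 = g 0 0 z * g 1 1 z - g 0 1 z ^ 2 := Real.sq_sqrt (hpos z hzU).le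
    obtain ⟨k1, k2, k3⟩ := conformal_algebra (a₁ := α.re) (a₂ := α.im) (b₁ := β.re) (b₂ := β.im)
      (hE z hzU) hDz (by linarith) (by linarith)
    have hα2 : 0 < α.re ^ 2 + α.im ^ 2 := by
      have := Complex.normSq_pos.2 hα0
      rw [Complex.normSq_apply] at this
      linarith
    have hJ : ∀ a : EuclideanSpace ℝ (Fin 2), fderiv ℝ Ψ u a 0 = a 0 * α.re + a 1 * β.re ∧
        fderiv ℝ Ψ u a 1 = a 0 * α.im + a 1 * β.im := by
      intro a
      have ha : planeEquiv.symm a = (a 0 : ℂ) + a 1 * Complex.I :=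
        Complex.orthonormalBasisOneI_repr_symm_apply a
      have h := fderiv_conj_planeEquiv hw u a
      rw [ha, ← hzdef, hlin, planeEquiv_apply] at h
      rw [h]
      simp
    have hsym : gram c₀ (c₀.symm u) 1 0 = g 0 1 z := by
      rw [gram_comm, hg]
      simp only [hz]
    have hguz : ∀ i j, gram c₀ (c₀.symm u) i j = g i j z := fun i j => by
      rw [hg]
      simp only [hz]
    refine ⟨(α.re ^ 2 + α.im ^ 2) / g 0 0 z, div_pos hα2 (hE z hzU), ?_, fun a b => ?_⟩
    · rw [det_eq_of_plane, (hJ _).1, (hJ _).1, (hJ _).2, (hJ _).2]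
      simp
      have := mul_pos (div_pos hα2 (hE z hzU)) (hD z hzU)
      linarith
    · have hEz := (hE z hzU).ne'
      rw [(hJ a).1, (hJ a).2, (hJ b).1, (hJ b).2]
      simp only [Fin.sum_univ_two, hsym]
      rw [hguz, hguz, hguz]
      have k0 : α.re ^ 2 + α.im ^ 2 = (α.re ^ 2 + α.im ^ 2) / g 0 0 z * g 0 0 z := by
        field_simp
      linear_combination (a 0 * b 0) * k0 + (a 0 * b 1 + a 1 * b 0) * k1 + (a 1 * b 1) * k2
  obtain ⟨c, hc, hxc, hcp⟩ := exists_chart_of_det_ne_zero hc₀ hx hΨ hP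
    fun u ⟨_, _, h, _⟩ => h.ne'
  refine ⟨c, ⟨hc, fun d hd p hp => ?_⟩, isIsothermal_of_inner_comp hc fun p hp => ?_, hxc⟩
  · obtain ⟨hp₀, ⟨κ, hκ, hdet, -⟩, hJ⟩ := hcp p hp.1
    have h1 := o.det_pos c₀ hc₀o d hd p ⟨hp₀, hp.2⟩
    rw [det_change_of_chart hc₀ hc (o.smooth d hd) hp₀ hp.1 hp.2 hJ] at h1
    -- The Jacobian from c₀ to d is positive and factors through c, with positive factor from c₀ to
    -- c, so the factor from c to d is positive too.
    exact (pos_iff_pos_of_mul_pos h1).2 hdet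
  · obtain ⟨hp₀, ⟨κ, hκ, -, hin⟩, hJ⟩ := hcp p hp
    refine ⟨κ, hκ, fun u v => ?_⟩
    rw [hJ, hJ, hin, c₀.left_inv hp₀, inner_eq_sum hc₀ hp₀]

end Existence

theorem isLocallyConstant_of_mvfderiv_eq_zero {m : ℕ} {M : Type*} [TopologicalSpace M]
    [ChartedSpace (EuclideanSpace ℝ (Fin m)) M] [IsManifold (𝓡 m) ∞ M] {f : M → ℝ}
    (hf : ∀ x, ContMDiffAt (𝓡 m) 𝓘(ℝ, ℝ) ∞ f x) (h : ∀ x v, mvfderiv (𝓡 m) f x v = 0) :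
    IsLocallyConstant f := by
  rw [IsLocallyConstant.iff_eventually_eq]
  intro x
  set c := chartAt (EuclideanSpace ℝ (Fin m)) x
  have hc : c ∈ IsManifold.maximalAtlas (𝓡 m) ∞ M := chartAt_mem x
  have hx : x ∈ c.source := mem_chart_source _ x
  obtain ⟨r, hr, hball⟩ := Metric.isOpen_iff.1 c.open_target (c x) (c.map_source hx)
  have hd : ∀ u ∈ Metric.ball (c x) r, DifferentiableAt ℝ (f ∘ c.symm) u := fun u hu => by
    have := contDiffAt_comp_symm hc (c.map_target (hball hu)) (hf (c.symm u))
    rw [c.right_inv (hball hu)] at this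
    exact this.differentiableAt (by simp)
  have h0 : Set.EqOn (fderiv ℝ (f ∘ c.symm)) 0 (Metric.ball (c x) r) := fun u hu => by
    have hu' := c.map_target (hball hu)
    ext1 a
    have := mvfderiv_eq_fderiv hc hu' ((hf (c.symm u)).mdifferentiableAt (by simp))
      (vecOfComp c (c.symm u) a)
    rw [comp_vecOfComp hc hu', c.right_inv (hball hu), h] at this
    exact this.symm
  filter_upwards [c.open_source.mem_nhds hx,
    (c.continuousAt hx).preimage_mem_nhds (Metric.ball_mem_nhds _ hr)] with y hy hyb
  have := Metric.isOpen_ball.is_const_of_fderiv_eq_zero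
    (convex_ball (c x) r).isPreconnected (fun u hu => (hd u hu).differentiableWithinAt) h0 hyb
    (Metric.mem_ball_self hr)
  simpa only [Function.comp_apply, c.left_inv hy, c.left_inv hx] using this

/-! ### The four conditions as linear relations -/

section Characterizations

variable {n : ℕ} {M N : Type*}
  [TopologicalSpace M] [ChartedSpace (EuclideanSpace ℝ (Fin 2)) M] [IsManifold (𝓡 2) ∞ M]
  [Bundle.RiemannianBundle (fun x : M => TangentSpace (𝓡 2) x)]
  [IsContMDiffRiemannianBundle (𝓡 2) ∞ (EuclideanSpace ℝ (Fin 2))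
      (fun x : M => TangentSpace (𝓡 2) x)]
  [TopologicalSpace N] [ChartedSpace (EuclideanSpace ℝ (Fin n)) N] [IsManifold (𝓡 n) ∞ N]
  [Bundle.RiemannianBundle (fun y : N => TangentSpace (𝓡 n) y)]
  [IsContMDiffRiemannianBundle (𝓡 n) ∞ (EuclideanSpace ℝ (Fin n))
      (fun y : N => TangentSpace (𝓡 n) y)]
  {φ : M → N}

/-- The squared length `|H|²` of the mean curvature vector field. -/
def sqMeanCurvature (n : ℕ) {M N : Type*}
    [TopologicalSpace M] [ChartedSpace (EuclideanSpace ℝ (Fin 2)) M]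
    [Bundle.RiemannianBundle (fun x : M => TangentSpace (𝓡 2) x)]
    [TopologicalSpace N] [ChartedSpace (EuclideanSpace ℝ (Fin n)) N]
    [Bundle.RiemannianBundle (fun y : N => TangentSpace (𝓡 n) y)] (φ : M → N) (x : M) : ℝ :=
  inner ℝ (meanCurvature 2 n φ x) (meanCurvature 2 n φ x)

theorem contMDiffAt_sqMeanCurvature (hφ : ContMDiff (𝓡 2) (𝓡 n) ∞ φ) (x : M) :
    ContMDiffAt (𝓡 2) 𝓘(ℝ, ℝ) ∞ (sqMeanCurvature n φ) x :=
  contMDiffAt_inner_meanCurvature hφ x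

theorem mvfderiv_traceTensor_shapeOperatorH (hφ : IsRiemannianImmersion 2 n φ) (x : M)
    (w : TangentSpace (𝓡 2) x) :
    mvfderiv (𝓡 2) (traceTensor (shapeOperatorH 2 n φ)) x w =
      2 * mvfderiv (𝓡 2) (sqMeanCurvature n φ) x w := by
  have h : traceTensor (shapeOperatorH 2 n φ) = fun y => 2 * sqMeanCurvature n φ y :=
    funext fun y => sum_inner_shapeOperatorH hφ.1 y
  rw [h, mvfderiv_mul_apply contMDiffAt_const (contMDiffAt_sqMeanCurvature hφ.1 x),
    mvfderiv_const_apply]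
  ring

theorem isBiconservative_iff (hφ : IsRiemannianImmersion 2 n φ) :
    IsBiconservative 2 n φ ↔ ∀ x w, 2 * inner ℝ (divTensor (shapeOperatorH 2 n φ) x) w =
      mvfderiv (𝓡 2) (sqMeanCurvature n φ) x w := by
  refine forall_congr' fun x => ⟨fun h w => ?_, fun h => ext_inner_right ℝ fun w => ?_⟩
  · have h1 := inner_divTensor_stressBienergy hφ x w
    rw [h, inner_zero_left] at h1
    change 2 * _ = mvfderiv (𝓡 2)
      (fun y => inner ℝ (meanCurvature 2 n φ y) (meanCurvature 2 n φ y)) x w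
    linarith
  · rw [inner_divTensor_stressBienergy hφ, inner_zero_left]
    have h1 : 2 * _ = mvfderiv (𝓡 2)
      (fun y => inner ℝ (meanCurvature 2 n φ y) (meanCurvature 2 n φ y)) x w := h w
    linarith

/-- The squared length is used because |H| need not be differentiable at zeros of H. A vanishing
differential gives local constancy, and connectedness makes it global. -/
theorem hasConstantMeanCurvature_iff [ConnectedSpace M] (hφ : IsRiemannianImmersion 2 n φ) :
    HasConstantMeanCurvature 2 n φ ↔ ∀ x w, mvfderiv (𝓡 2) (sqMeanCurvature n φ) x w = 0 := by
  constructor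
  · rintro ⟨r, hr⟩ x w
    have h : sqMeanCurvature n φ = fun _ => r ^ 2 := funext fun y => by
      rw [← hr y, sqMeanCurvature, real_inner_self_eq_norm_sq]
    rw [h, mvfderiv_const_apply]
  · intro h
    have hloc := isLocallyConstant_of_mvfderiv_eq_zero
      (contMDiffAt_sqMeanCurvature hφ.1) h
    obtain ⟨x₀⟩ := (inferInstance : Nonempty M)
    refine ⟨‖meanCurvature 2 n φ x₀‖, fun x => ?_⟩
    have hx : inner ℝ (meanCurvature 2 n φ x) (meanCurvature 2 n φ x) =
        inner ℝ (meanCurvature 2 n φ x₀) (meanCurvature 2 n φ x₀) :=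
      hloc.apply_eq_of_preconnectedSpace x x₀
    rw [real_inner_self_eq_norm_sq, real_inner_self_eq_norm_sq] at hx
    exact (sq_eq_sq₀ (norm_nonneg _) (norm_nonneg _)).1 hx

/-- The factor ½ cancels against tr A_H = 2|H|². Existence of isothermal charts enters only in the
forward direction; without them the holomorphy condition could be vacuous. -/
theorem hasHolomorphicHopf_shapeOperatorH_iff (o : OrientedAtlas M)
    (hφ : IsRiemannianImmersion 2 n φ) :
    HasHolomorphicHopf o (shapeOperatorH 2 n φ) ↔ ∀ x w,
      inner ℝ (divTensor (shapeOperatorH 2 n φ) x) w =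
        mvfderiv (𝓡 2) (sqMeanCurvature n φ) x w := by
  have hT := isSmoothHomAt_shapeOperatorH (m := 2) (n := n) hφ.1
  have hs := fun (y : M) u w => inner_shapeOperatorH_comm (m := 2) (n := n) (x := y) hφ.1 u w
  constructor
  · intro h x w
    obtain ⟨c, hc, hiso, hx⟩ := exists_isothermal_chart o x
    rw [h.inner_divTensor hT hs hc hiso hx w, mvfderiv_traceTensor_shapeOperatorH hφ]
    ring
  · intro h
    refine hasHolomorphicHopf_of_divTensor o hT hs fun x w => ?_
    rw [h, mvfderiv_traceTensor_shapeOperatorH hφ]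
    ring

theorem isCodazzi_shapeOperatorH_iff (hφ : IsRiemannianImmersion 2 n φ) :
    IsCodazzi (shapeOperatorH 2 n φ) ↔ ∀ x w,
      inner ℝ (divTensor (shapeOperatorH 2 n φ) x) w =
        2 * mvfderiv (𝓡 2) (sqMeanCurvature n φ) x w := by
  rw [isCodazzi_iff (isSmoothHomAt_shapeOperatorH (m := 2) (n := n) hφ.1)
    fun y u w => inner_shapeOperatorH_comm (m := 2) (n := n) (x := y) hφ.1 u w]
  simp only [mvfderiv_traceTensor_shapeOperatorH hφ]

end Characterizations

/-- Two independent relations `p i * a = q i * b` between real numbers force `a = b = 0`. -/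
theorem anyTwoImplyAll_of_linear {X ι : Type*} (a b : X → ℝ) {p q : ι → ℝ}
    (h : ∀ i j, i ≠ j → p i * q j - p j * q i ≠ 0) {P : ι → Prop}
    (hP : ∀ i, P i ↔ ∀ x, p i * a x = q i * b x) : AnyTwoImplyAll P := by
  intro i j hij hi hj k
  rw [hP] at hi hj ⊢
  intro x
  have ha : a x = 0 := (mul_eq_zero.1 (by linear_combination q j * hi x - q i * hj x)).resolve_left
    (h i j hij)
  have hb : b x = 0 := (mul_eq_zero.1 (by linear_combination p j * hi x - p i * hj x)).resolve_left
    (h i j hij)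
  rw [ha, hb, mul_zero, mul_zero]

end SurfaceGeometry

end

theorem mainTheorem1 {n : ℕ} {M N : Type*}
    [TopologicalSpace M] [T2Space M] [SecondCountableTopology M] [ConnectedSpace M]
    [ChartedSpace (EuclideanSpace ℝ (Fin 2)) M] [IsManifold (𝓡 2) ∞ M]
    [Bundle.RiemannianBundle (fun x : M => TangentSpace (𝓡 2) x)]
    [IsContMDiffRiemannianBundle (𝓡 2) ∞ (EuclideanSpace ℝ (Fin 2))
      (fun x : M => TangentSpace (𝓡 2) x)]
    (o : OrientedAtlas M)
    [TopologicalSpace N] [T2Space N] [SecondCountableTopology N]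
    [ChartedSpace (EuclideanSpace ℝ (Fin n)) N] [IsManifold (𝓡 n) ∞ N]
    [Bundle.RiemannianBundle (fun y : N => TangentSpace (𝓡 n) y)]
    [IsContMDiffRiemannianBundle (𝓡 n) ∞ (EuclideanSpace ℝ (Fin n))
      (fun y : N => TangentSpace (𝓡 n) y)]
    (φ : M → N) (hφ : IsRiemannianImmersion 2 n φ) :
    AnyTwoImplyAll
      ![IsBiconservative 2 n φ,
        HasConstantMeanCurvature 2 n φ,
        HasHolomorphicHopf o (shapeOperatorH 2 n φ),
        IsCodazzi (shapeOperatorH 2 n φ)] := by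
  -- The relations 2a = b, 0 = b, a = b and a = 2b are imposed on all tangent vectors at all points
  -- at once; the entries of p and q are their coefficients.
  refine anyTwoImplyAll_of_linear (X := Σ x : M, TangentSpace (𝓡 2) x)
    (fun v => inner ℝ (divTensor (shapeOperatorH 2 n φ) v.1) v.2)
    (fun v => mvfderiv (𝓡 2) (sqMeanCurvature n φ) v.1 v.2)
    (p := ![2, 0, 1, 1]) (q := ![1, 1, 1, 2]) ?_ ?_
  · intro i j
    fin_cases i <;> fin_cases j <;> norm_num
  · intro i
    rw [Sigma.forall]
    fin_cases i
    · simpa using isBiconservative_iff hφ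
    · simpa [eq_comm] using hasConstantMeanCurvature_iff hφ
    · simpa using hasHolomorphicHopf_shapeOperatorH_iff o hφ
    · simpa using isCodazzi_shapeOperatorH_iff hφ
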